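/- Let $\mathbf{Dia}$ be a full sub-2-category of the 2-category of small categories that contains all countable posets and is closed under products and under the slice categories $J_{/k}$, $J_{k/}$ of functors $u\colon J\to K$ (for example all small categories, or all posets). Let $\mathbb D$ be a pointed derivator with domain $\mathbf{Dia}$, i.e. a strict 2-functor $\mathbf{Dia}^{\mathrm{op}}\to\mathbf{CAT}$ satisfying the axioms Der1–Der4 (coproducts go to products; isomorphisms are detected pointwise; every $u^*$ has a left adjoint $u_!$ and a right adjoint $u_*$; Kan extensions are computed pointwise on slices) whose base $\mathbb D(e)$ has a zero object. For $A\in\mathbf{Dia}$ let $\mathbb D^A$ be the prederivator $K\mapsto\mathbb D(K\times A)$. Morphisms of prederivators are pseudonatural transformations, 2-cells are modifications, and for $u\colon A\to B$ (respectively a point $a$ of $A$) the Kan extensions $u_!,u_*\colon\mathbb D^A\to\mathbb D^B$ (respectively $a_!,a_*\colon\mathbb D\to\mathbb D^A$) are the left and right adjoint morphisms of the restriction $u^*$ (respectively $a^*$). Let $V=\{(i,j)\in\mathbb Z^2:|i-j|\le 1\}$ with the product order, $\partial V=\{(i,j)\in V:|i-j|=1\}$, $V^{\le 0}=\{(i,j)\in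 V: i,j\le 0\}$ and $V'=V^{\le 0}\cup\partial V$, with inclusions $\iota_{\le0}\colon V^{\le 0}\to V'$ and $\iota\colon V'\to V$. Let $\operatorname{Sp}\mathbb D\subset\mathbb D^V$ be the full subprederivator on those $X\in\mathbb D(K\times V)$ whose restriction to $K\times\partial V$ is zero, and for $n\in\mathbb Z$ let $(n,n)^*\colon\operatorname{Sp}\mathbb D\to\mathbb D$, $X\mapsto X_n$, be evaluation at $(n,n)$. Let $\square=\{0,1\}^2$, and let $\Sigma\colon\mathbb D\to\mathbb D$ be the suspension: right Kan extension along the point $(0,0)$ of $\square\setminus\{(1,1)\}$, then left Kan extension to $\square$, then evaluation at $(1,1)$. A square $X\in\mathbb D(K\times\square)$ is cocartesian if it lies in the essential image of left Kan extension along $K\times(\square\setminus\{(1,1)\})\to K\times\square$. Then there is a morphism $L\colon\mathbb D\to\operatorname{Sp}\mathbb D$ such that: 1. $L$ is left adjoint to $(0,0)^*\colon\operatorname{Sp}\mathbb D\to\mathbb D$ (with unit and counit modifications satisfying the triangle identities). 2. The morphisms $(0,0)_!\colon\mathbb D\to\mathbb D^{V^{\le 0}}$, $\iota_{\le 0,*}\colon\mathbb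 D^{V^{\le 0}}\to\mathbb D^{V'}$ and $\iota_!\colon\mathbb D^{V'}\to\mathbb D^V$ exist, $\iota_{\le 0,*}$ has a right adjoint $\iota_{\le 0}^!$, the composite of $L$ with the inclusion $\operatorname{Sp}\mathbb D\subset\mathbb D^V$ is isomorphic to $\iota_!\,\iota_{\le 0,*}\,(0,0)_!$, and $(0,0)^*\iota_{\le 0}^!\,\iota^*$ restricted to $\operatorname{Sp}\mathbb D$ is isomorphic to $(0,0)^*$. 3. $\Sigma$ exists as a morphism, and for every $n\ge 0$ there is an isomodification $(n,n)^*L\cong\Sigma^n$; in particular $(Lx)_0\cong x$ and $(Lx)_n\cong\Sigma^n x$. 4. $(Lx)_n$ is a zero object for every $n<0$ and every $x$. 5. For every $n\ge 0$ and every $x$, the square obtained by restricting $Lx$ along $\square\to V$, $(a,b)\mapsto(a+n,b+n)$, is cocartesian. -/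

import Mathlib

open CategoryTheory CategoryTheory.Limits

universe w v u v' u' v'' u''

/-! ## Domains of diagram shapes -/

/-- A domain `Dia` of diagram shapes, i.e. a full 2-subcategory of the 2-category of small
categories, given by its class of objects. It contains all countable posets (thin skeletal
categories with countably many objects) and is closed under products and under the slice
categories `J_{/k}` and `J_{k/}` of functors `u : J ⥤ K`. Examples are the class of all small
categories and the class of all posets. -/
structure DiagramDomain where
  /-- the small categories that belong to the domain -/
  mem : ∀ (K : Type w) [SmallCategory K], Prop
  poset : ∀ (K : Type w) [SmallCategory K], Countable K → Quiver.IsThin K → Skeletal K → mem K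
  prod : ∀ (J K : Type w) [SmallCategory J] [SmallCategory K], mem J → mem K → mem (J × K)
  sliceOver : ∀ (J K : Type w) [SmallCategory J] [SmallCategory K] (F : J ⥤ K) (k : K),
    mem J → mem K → mem (CostructuredArrow F k)
  sliceUnder : ∀ (J K : Type w) [SmallCategory J] [SmallCategory K] (F : J ⥤ K) (k : K),
    mem J → mem K → mem (StructuredArrow k F)

/-- The diagram shapes of the domain `Dia`. -/
structure DiagramDomain.Shape (Dia : DiagramDomain.{w}) where
  carrier : Type w
  [str : SmallCategory carrier]
  mem : Dia.mem carrier

namespace DiagramDomain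

variable {Dia : DiagramDomain.{w}}

instance : CoeSort Dia.Shape (Type w) := ⟨Shape.carrier⟩

instance (K : Dia.Shape) : SmallCategory.{w} K := K.str

/-- A countable poset as a diagram shape. -/
abbrev ofPoset (Dia : DiagramDomain.{w}) (P : Type w) [PartialOrder P] [Countable P] : Dia.Shape where
  carrier := P
  mem := Dia.poset P inferInstance inferInstance
    fun _ _ ⟨e⟩ => le_antisymm (leOfHom e.hom) (leOfHom e.inv)

/-- The terminal category `e`. -/
abbrev point (Dia : DiagramDomain.{w}) : Dia.Shape where
  carrier := Discrete PUnit.{w + 1}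
  mem := Dia.poset _ inferInstance inferInstance fun _ _ _ => Subsingleton.elim _ _

/-- The product of two shapes. -/
abbrev Shape.times (J K : Dia.Shape) : Dia.Shape where
  carrier := J × K
  mem := Dia.prod J K J.mem K.mem

/-- The slice category `J_{/k}`, with objects `(j, u j ⟶ k)`. -/
abbrev Shape.over {J K : Dia.Shape} (F : J ⥤ K) (k : K) : Dia.Shape where
  carrier := CostructuredArrow F k
  mem := Dia.sliceOver J K F k J.mem K.mem

/-- The slice category `J_{k/}`, with objects `(j, k ⟶ u j)`. -/
abbrev Shape.under {J K : Dia.Shape} (F : J ⥤ K) (k : K) : Dia.Shape where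
  carrier := StructuredArrow k F
  mem := Dia.sliceUnder J K F k J.mem K.mem

/-- The functor `k : e ⥤ K` classifying an object `k`. -/
def pt {K : Dia.Shape} (k : K) : Dia.point ⥤ K := (Functor.const (Discrete PUnit.{w + 1})).obj k

/-- The projection `π : K ⥤ e`. -/
def toPoint (K : Dia.Shape) : K ⥤ Dia.point :=
  (Functor.const K).obj (Discrete.mk PUnit.unit : Discrete PUnit.{w + 1})

/-- The forgetful functor `pr : J_{/k} ⥤ J`. -/
def overProj {J K : Dia.Shape} (F : J ⥤ K) (k : K) : Shape.over F k ⥤ J :=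
  CostructuredArrow.proj F k

/-- The forgetful functor `pr : J_{k/} ⥤ J`. -/
def underProj {J K : Dia.Shape} (F : J ⥤ K) (k : K) : Shape.under F k ⥤ J :=
  StructuredArrow.proj k F

/-- The functor `F × U : J × A ⥤ K × B`. -/
def timesMap {J K A B : Dia.Shape} (F : J ⥤ K) (U : A ⥤ B) : J.times A ⥤ K.times B := F.prod U

/-- The natural transformation `α × β : F × U ⟶ G × W`. -/
def timesMap₂ {J K A B : Dia.Shape} {F G : J ⥤ K} {U W : A ⥤ B} (α : F ⟶ G) (β : U ⟶ W) :
    timesMap F U ⟶ timesMap G W := NatTrans.prod α β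

/-- The functor `K ⥤ K × A`, `k ↦ (k, a)`. -/
def slot (K : Dia.Shape) {A : Dia.Shape} (a : A) : K ⥤ K.times A := Prod.sectL K a

theorem timesMap_square {J K A B : Dia.Shape} (F : J ⥤ K) (U : A ⥤ B) :
    timesMap F (𝟭 A) ⋙ timesMap (𝟭 K) U = timesMap (𝟭 J) U ⋙ timesMap F (𝟭 B) := rfl

theorem timesMap₂_square {J K A B : Dia.Shape} {F G : J ⥤ K} (α : F ⟶ G) (U : A ⥤ B) :
    Functor.whiskerRight (timesMap₂ α (𝟙 (𝟭 A))) (timesMap (𝟭 K) U) =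
      eqToHom (timesMap_square F U) ≫
        Functor.whiskerLeft (timesMap (𝟭 J) U) (timesMap₂ α (𝟙 (𝟭 B))) ≫
        eqToHom (timesMap_square G U).symm := by
  refine NatTrans.ext (funext fun x => ?_)
  rw [NatTrans.comp_app, NatTrans.comp_app, eqToHom_app, eqToHom_app]
  refine Eq.trans ?_ ((Category.id_comp _).trans (Category.comp_id _)).symm
  exact Prod.ext rfl (U.map_id x.2)

theorem slot_square {J K A : Dia.Shape} (F : J ⥤ K) (a : A) :
    F ⋙ slot K a = slot J a ⋙ timesMap F (𝟭 A) := rfl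

theorem timesMap₂_slot {J K A : Dia.Shape} {F G : J ⥤ K} (α : F ⟶ G) (a : A) :
    Functor.whiskerRight α (slot K a) =
      eqToHom (slot_square F a) ≫
        Functor.whiskerLeft (slot J a) (timesMap₂ α (𝟙 (𝟭 A))) ≫
        eqToHom (slot_square G a).symm := by
  refine NatTrans.ext (funext fun x => ?_)
  rw [NatTrans.comp_app, NatTrans.comp_app, eqToHom_app, eqToHom_app]
  refine Eq.trans ?_ ((Category.id_comp _).trans (Category.comp_id _)).symm
  rfl

/-- The natural transformation `u ∘ pr ⟶ k ∘ π` on `J_{/k}`. -/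
def overCell {J K : Dia.Shape} (F : J ⥤ K) (k : K) :
    overProj F k ⋙ F ⟶ toPoint (Shape.over F k) ⋙ pt k where
  app f := CostructuredArrow.hom (S := F) (T := k) f
  naturality f g a := by
    have h := CostructuredArrow.w (S := F) (T := k) a
    exact h.trans (Category.comp_id _).symm

/-- The natural transformation `k ∘ π ⟶ u ∘ pr` on `J_{k/}`. -/
def underCell {J K : Dia.Shape} (F : J ⥤ K) (k : K) :
    toPoint (Shape.under F k) ⋙ pt k ⟶ underProj F k ⋙ F where
  app f := StructuredArrow.hom (T := F) (S := k) f
  naturality f g a := by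
    have h := StructuredArrow.w (T := F) (S := k) a
    exact (Category.id_comp _).trans h.symm

end DiagramDomain

open DiagramDomain

/-! ## Prederivators and derivators -/

/-- A prederivator with domain `Dia`: a strict 2-functor `Diaᵒᵖ → CAT` (contravariant in functors,
covariant in natural transformations). -/
structure Prederivator (Dia : DiagramDomain.{w}) where
  /-- the category `𝔻(K)` -/
  cat : Dia.Shape → Type u
  [str : ∀ K, Category.{v} (cat K)]
  /-- the functor `F^*` -/
  pull : ∀ {J K : Dia.Shape}, (J ⥤ K) → (cat K ⥤ cat J)
  /-- the natural transformation `α^*` -/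
  pull₂ : ∀ {J K : Dia.Shape} {F G : J ⥤ K}, (F ⟶ G) → (pull F ⟶ pull G)
  pull_id : ∀ K : Dia.Shape, pull (𝟭 K) = 𝟭 (cat K)
  pull_comp : ∀ {I J K : Dia.Shape} (F : I ⥤ J) (G : J ⥤ K), pull (F ⋙ G) = pull G ⋙ pull F
  pull₂_id : ∀ {J K : Dia.Shape} (F : J ⥤ K), pull₂ (𝟙 F) = 𝟙 (pull F)
  pull₂_comp : ∀ {J K : Dia.Shape} {F G H : J ⥤ K} (α : F ⟶ G) (β : G ⟶ H),
    pull₂ (α ≫ β) = pull₂ α ≫ pull₂ β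
  pull₂_whiskerLeft : ∀ {I J K : Dia.Shape} (F : I ⥤ J) {G H : J ⥤ K} (α : G ⟶ H),
    pull₂ (Functor.whiskerLeft F α) =
      eqToHom (pull_comp F G) ≫ Functor.whiskerRight (pull₂ α) (pull F) ≫
        eqToHom (pull_comp F H).symm
  pull₂_whiskerRight : ∀ {I J K : Dia.Shape} {F G : I ⥤ J} (α : F ⟶ G) (H : J ⥤ K),
    pull₂ (Functor.whiskerRight α H) =
      eqToHom (pull_comp F H) ≫ Functor.whiskerLeft (pull H) (pull₂ α) ≫
        eqToHom (pull_comp G H).symm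

namespace Prederivator

variable {Dia : DiagramDomain.{w}}

attribute [instance] Prederivator.str

/-- The equality `(𝟭 K)^* = 𝟭`, as an isomorphism. -/
def pullId (D : Prederivator.{w, v, u} Dia) (K : Dia.Shape) : D.pull (𝟭 K) ≅ 𝟭 (D.cat K) :=
  eqToIso (D.pull_id K)

/-- The equality `(G ∘ F)^* = F^* ∘ G^*`, as an isomorphism. -/
def pullComp (D : Prederivator.{w, v, u} Dia) {I J K : Dia.Shape} (F : I ⥤ J) (G : J ⥤ K) :
    D.pull (F ⋙ G) ≅ D.pull G ⋙ D.pull F :=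
  eqToIso (D.pull_comp F G)

/-- The natural transformation `pr^* u^* ⟶ π^* k^*` induced by `overCell`. -/
def overSquare (D : Prederivator.{w, v, u} Dia) {J K : Dia.Shape} (F : J ⥤ K) (k : K) :
    TwoSquare (D.pull F) (D.pull (pt k)) (D.pull (overProj F k))
      (D.pull (toPoint (Shape.over F k))) :=
  (D.pullComp _ _).inv ≫ D.pull₂ (overCell F k) ≫ (D.pullComp _ _).hom

/-- The natural transformation `π^* k^* ⟶ pr^* u^*` induced by `underCell`. -/
def underSquare (D : Prederivator.{w, v, u} Dia) {J K : Dia.Shape} (F : J ⥤ K) (k : K) :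
    TwoSquare (D.pull (pt k)) (D.pull F) (D.pull (toPoint (Shape.under F k)))
      (D.pull (underProj F k)) :=
  (D.pullComp _ _).inv ≫ D.pull₂ (underCell F k) ≫ (D.pullComp _ _).hom

/-- The axioms of a derivator. In `der4_left` and `der4_right` the natural transformation is the
mate `π_! pr^* ⟶ k^* u_!`, respectively `k^* u_* ⟶ π_* pr^*`. -/
structure IsDerivator (D : Prederivator.{w, v, u} Dia) : Prop where
  der1 : ∀ (I : Type w) (K : I → Dia.Shape) (h : Dia.mem (Σ i, K i)),
    (Functor.pi' fun i =>
      D.pull (K := ⟨Σ i, K i, h⟩) (Sigma.incl (C := fun i => (K i : Type w)) i)).IsEquivalence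
  der2 : ∀ {K : Dia.Shape} {X Y : D.cat K} (f : X ⟶ Y),
    IsIso f ↔ ∀ k : K, IsIso ((D.pull (pt k)).map f)
  der3_left : ∀ {J K : Dia.Shape} (F : J ⥤ K), (D.pull F).IsRightAdjoint
  der3_right : ∀ {J K : Dia.Shape} (F : J ⥤ K), (D.pull F).IsLeftAdjoint
  der4_left : ∀ {J K : Dia.Shape} (F : J ⥤ K) (k : K)
    (lanF : D.cat J ⥤ D.cat K) (adjF : lanF ⊣ D.pull F)
    (colim : D.cat (Shape.over F k) ⥤ D.cat Dia.point)
    (adj : colim ⊣ D.pull (toPoint (Shape.over F k))),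
    IsIso ((mateEquiv adjF adj).symm (D.overSquare F k)).natTrans
  der4_right : ∀ {J K : Dia.Shape} (F : J ⥤ K) (k : K)
    (ranF : D.cat J ⥤ D.cat K) (adjF : D.pull F ⊣ ranF)
    (lim : D.cat (Shape.under F k) ⥤ D.cat Dia.point)
    (adj : D.pull (toPoint (Shape.under F k)) ⊣ lim),
    IsIso (mateEquiv adjF adj (D.underSquare F k)).natTrans

/-- A derivator is pointed if its base `𝔻(e)` has a zero object. -/
def IsPointed (D : Prederivator.{w, v, u} Dia) : Prop := HasZeroObject (D.cat Dia.point)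

/-! ## Morphisms, modifications and adjunctions -/

/-- A morphism of prederivators: a pseudonatural transformation. -/
structure Hom (D : Prederivator.{w, v, u} Dia) (E : Prederivator.{w, v', u'} Dia) where
  app : ∀ K : Dia.Shape, D.cat K ⥤ E.cat K
  /-- the isomorphism `γ_F : F^* Φ_K ⟶ Φ_J F^*` -/
  nat : ∀ {J K : Dia.Shape} (F : J ⥤ K), app K ⋙ E.pull F ≅ D.pull F ⋙ app J
  nat_id : ∀ (K : Dia.Shape) (X : D.cat K),
    (nat (𝟭 K)).hom.app X ≫ (app K).map ((D.pullId K).hom.app X) =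
      (E.pullId K).hom.app ((app K).obj X)
  nat_comp : ∀ {I J K : Dia.Shape} (F : I ⥤ J) (G : J ⥤ K) (X : D.cat K),
    (nat (F ⋙ G)).hom.app X ≫ (app I).map ((D.pullComp F G).hom.app X) =
      (E.pullComp F G).hom.app ((app K).obj X) ≫ (E.pull F).map ((nat G).hom.app X) ≫
        (nat F).hom.app ((D.pull G).obj X)
  nat_naturality : ∀ {J K : Dia.Shape} {F G : J ⥤ K} (α : F ⟶ G) (X : D.cat K),
    (nat F).hom.app X ≫ (app J).map ((D.pull₂ α).app X) =
      (E.pull₂ α).app ((app K).obj X) ≫ (nat G).hom.app X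

/-- The identity morphism. -/
def Hom.id (D : Prederivator.{w, v, u} Dia) : Hom D D where
  app K := 𝟭 (D.cat K)
  nat F := Functor.leftUnitor _ ≪≫ (Functor.rightUnitor _).symm
  nat_id K X := by simp
  nat_comp F G X := by simp
  nat_naturality α X := by simp

/-- Composition of morphisms, in diagrammatic order: `(Φ.comp Ψ)_K = Ψ_K ∘ Φ_K`. -/
def Hom.comp {D : Prederivator.{w, v, u} Dia} {E : Prederivator.{w, v', u'} Dia}
    {E' : Prederivator.{w, v'', u''} Dia} (Φ : Hom D E) (Ψ : Hom E E') : Hom D E' where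
  app K := Φ.app K ⋙ Ψ.app K
  nat F := Functor.associator _ _ _ ≪≫ Functor.isoWhiskerLeft (Φ.app _) (Ψ.nat F) ≪≫
    (Functor.associator _ _ _).symm ≪≫ Functor.isoWhiskerRight (Φ.nat F) (Ψ.app _) ≪≫
    Functor.associator _ _ _
  nat_id K X := by
    simp [← Functor.map_comp, Φ.nat_id, Ψ.nat_id]
  nat_comp F G X := by
    have h := Ψ.nat_comp F G ((Φ.app _).obj X)
    have h' := (Ψ.nat F).hom.naturality ((Φ.nat G).hom.app X)
    simp only [Functor.comp_map, Functor.comp_obj] at h'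
    simp [← Functor.map_comp, Φ.nat_comp]
    simp only [Functor.map_comp, reassoc_of% h, Category.assoc, reassoc_of% h']
  nat_naturality α X := by
    have h := Ψ.nat_naturality α ((Φ.app _).obj X)
    simp [← Functor.map_comp, Φ.nat_naturality]
    simp [reassoc_of% h]

/-- The iterates of an endomorphism. -/
def Hom.iterate {D : Prederivator.{w, v, u} Dia} (Φ : Hom D D) : ℕ → Hom D D
  | 0 => Hom.id D
  | n + 1 => (Hom.iterate Φ n).comp Φ

/-- A modification between morphisms of prederivators. -/
structure Modification {D : Prederivator.{w, v, u} Dia} {E : Prederivator.{w, v', u'} Dia}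
    (Φ Ψ : Hom D E) where
  app : ∀ K : Dia.Shape, Φ.app K ⟶ Ψ.app K
  naturality : ∀ {J K : Dia.Shape} (F : J ⥤ K) (X : D.cat K),
    (E.pull F).map ((app K).app X) ≫ (Ψ.nat F).hom.app X =
      (Φ.nat F).hom.app X ≫ (app J).app ((D.pull F).obj X)

/-- Two morphisms are isomorphic if there is an isomodification between them. -/
def Hom.IsIsomorphic {D : Prederivator.{w, v, u} Dia} {E : Prederivator.{w, v', u'} Dia}
    (Φ Ψ : Hom D E) : Prop :=
  ∃ ρ : Modification Φ Ψ, ∀ K, IsIso (ρ.app K)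

/-- An adjunction between morphisms of prederivators: a unit and a counit that are modifications and
satisfy the triangle identities. -/
structure Hom.Adjunction {D : Prederivator.{w, v, u} Dia} {E : Prederivator.{w, v', u'} Dia}
    (Φ : Hom D E) (Ψ : Hom E D) where
  unit : Modification (Hom.id D) (Φ.comp Ψ)
  counit : Modification (Ψ.comp Φ) (Hom.id E)
  left_triangle : ∀ (K : Dia.Shape) (X : D.cat K),
    (Φ.app K).map ((unit.app K).app X) ≫ (counit.app K).app ((Φ.app K).obj X) =
      𝟙 ((Φ.app K).obj X)
  right_triangle : ∀ (K : Dia.Shape) (Y : E.cat K),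
    (unit.app K).app ((Ψ.app K).obj Y) ≫ (Ψ.app K).map ((counit.app K).app Y) =
      𝟙 ((Ψ.app K).obj Y)

/-- `Φ` is left adjoint to `Ψ` in the 2-category of prederivators. -/
def Hom.IsLeftAdjointTo {D : Prederivator.{w, v, u} Dia} {E : Prederivator.{w, v', u'} Dia}
    (Φ : Hom D E) (Ψ : Hom E D) : Prop :=
  Nonempty (Hom.Adjunction Φ Ψ)

/-! ## Shifted prederivators, restriction and evaluation -/

/-- The shifted prederivator `𝔻^A : K ↦ 𝔻(K × A)`. -/
def shift (D : Prederivator.{w, v, u} Dia) (A : Dia.Shape) : Prederivator.{w, v, u} Dia where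
  cat K := D.cat (K.times A)
  pull F := D.pull (timesMap F (𝟭 A))
  pull₂ α := D.pull₂ (timesMap₂ α (𝟙 (𝟭 A)))
  pull_id K := D.pull_id (K.times A)
  pull_comp F G := D.pull_comp (timesMap F (𝟭 A)) (timesMap G (𝟭 A))
  pull₂_id F := D.pull₂_id (timesMap F (𝟭 A))
  pull₂_comp α β := by
    rw [← D.pull₂_comp]
    congr 1
    ext x
    · rfl
    · exact (Category.comp_id _).symm
  pull₂_whiskerLeft F _ _ α :=
    D.pull₂_whiskerLeft (timesMap F (𝟭 A)) (timesMap₂ α (𝟙 (𝟭 A)))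
  pull₂_whiskerRight α H :=
    D.pull₂_whiskerRight (timesMap₂ α (𝟙 (𝟭 A))) (timesMap H (𝟭 A))

theorem pull_square (D : Prederivator.{w, v, u} Dia) {I J J' K : Dia.Shape} {F : I ⥤ J}
    {G : J ⥤ K} {F' : I ⥤ J'} {G' : J' ⥤ K} (h : F ⋙ G = F' ⋙ G') :
    D.pull G ⋙ D.pull F = D.pull G' ⋙ D.pull F' := by
  rw [← D.pull_comp, h, D.pull_comp]

theorem square_id (D : Prederivator.{w, v, u} Dia) {S T : Dia.Shape} (C : S ⥤ T)
    (h : D.pull C ⋙ D.pull (𝟭 S) = D.pull (𝟭 T) ⋙ D.pull C) (X : D.cat T) :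
    (eqToHom h).app X ≫ (D.pull C).map ((eqToHom (D.pull_id T)).app X) =
      (eqToHom (D.pull_id S)).app ((D.pull C).obj X) := by
  simp [eqToHom_map]

theorem square_comp (D : Prederivator.{w, v, u} Dia) {S S' S'' T T' T'' : Dia.Shape} (C : S ⥤ T)
    (C' : S' ⥤ T') (C'' : S'' ⥤ T'') (F : S ⥤ S') (G : S' ⥤ S'') (F' : T ⥤ T') (G' : T' ⥤ T'')
    (h : D.pull C'' ⋙ D.pull (F ⋙ G) = D.pull (F' ⋙ G') ⋙ D.pull C)
    (hF : D.pull C' ⋙ D.pull F = D.pull F' ⋙ D.pull C)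
    (hG : D.pull C'' ⋙ D.pull G = D.pull G' ⋙ D.pull C') (X : D.cat T'') :
    (eqToHom h).app X ≫ (D.pull C).map ((eqToHom (D.pull_comp F' G')).app X) =
      (eqToHom (D.pull_comp F G)).app ((D.pull C'').obj X) ≫
        (D.pull F).map ((eqToHom hG).app X) ≫ (eqToHom hF).app ((D.pull G').obj X) := by
  simp [eqToHom_map]

theorem square_naturality (D : Prederivator.{w, v, u} Dia) {S S' T T' : Dia.Shape} (C : S ⥤ T)
    (C' : S' ⥤ T') {F G : S ⥤ S'} {F' G' : T ⥤ T'} (α : F ⟶ G) (α' : F' ⟶ G')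
    (hF : F ⋙ C' = C ⋙ F') (hG : G ⋙ C' = C ⋙ G')
    (h : Functor.whiskerRight α C' = eqToHom hF ≫ Functor.whiskerLeft C α' ≫ eqToHom hG.symm)
    (X : D.cat T') :
    (eqToHom (D.pull_square hF)).app X ≫ (D.pull C).map ((D.pull₂ α').app X) =
      (D.pull₂ α).app ((D.pull C').obj X) ≫ (eqToHom (D.pull_square hG)).app X := by
  have e : ∀ {J K : Dia.Shape} {P Q : J ⥤ K} (e : P = Q),
      D.pull₂ (eqToHom e) = eqToHom (congrArg D.pull e) := by
    intro J K P Q e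
    subst e
    simp [D.pull₂_id]
  have h1 := congrArg D.pull₂ h
  rw [D.pull₂_comp, D.pull₂_comp, D.pull₂_whiskerLeft, D.pull₂_whiskerRight, e, e] at h1
  simp only [Category.assoc, eqToHom_trans, eqToHom_trans_assoc] at h1
  have h2 : Functor.whiskerLeft (D.pull C') (D.pull₂ α) =
      eqToHom (D.pull_comp F C').symm ≫ (eqToHom (D.pull_comp F C') ≫
        Functor.whiskerLeft (D.pull C') (D.pull₂ α) ≫ eqToHom (D.pull_comp G C').symm) ≫
        eqToHom (D.pull_comp G C') := by simp
  rw [h1] at h2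
  have h3 := congrArg (fun a => a.app X) h2
  simp only [Functor.whiskerLeft_app, NatTrans.comp_app, Functor.whiskerRight_app] at h3
  rw [h3]
  simp

/-- For `u : A ⥤ B`, the restriction morphism `u^* : 𝔻^B → 𝔻^A`, given by `(id_K × u)^*`. -/
def res (D : Prederivator.{w, v, u} Dia) {A B : Dia.Shape} (U : A ⥤ B) :
    Hom (D.shift B) (D.shift A) where
  app K := D.pull (timesMap (𝟭 K) U)
  nat F := eqToIso (D.pull_square (timesMap_square F U))
  nat_id K X := D.square_id (timesMap (𝟭 K) U)
    (D.pull_square (timesMap_square (𝟭 K) U)) X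
  nat_comp {I J K} F G X := D.square_comp (timesMap (𝟭 I) U) (timesMap (𝟭 J) U)
    (timesMap (𝟭 K) U) (timesMap F (𝟭 A)) (timesMap G (𝟭 A)) (timesMap F (𝟭 B))
    (timesMap G (𝟭 B)) (D.pull_square (timesMap_square (F ⋙ G) U))
    (D.pull_square (timesMap_square F U)) (D.pull_square (timesMap_square G U)) X
  nat_naturality {J K F G} α X := D.square_naturality (timesMap (𝟭 J) U) (timesMap (𝟭 K) U)
    (timesMap₂ α (𝟙 (𝟭 A))) (timesMap₂ α (𝟙 (𝟭 B)))
    (timesMap_square F U) (timesMap_square G U) (timesMap₂_square α U) X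

/-- For `a : A`, the evaluation morphism `a^* : 𝔻^A → 𝔻`, given by restriction along
`K ⥤ K × A`, `k ↦ (k, a)`. -/
def ev (D : Prederivator.{w, v, u} Dia) {A : Dia.Shape} (a : A) : Hom (D.shift A) D where
  app K := D.pull (slot K a)
  nat F := eqToIso (D.pull_square (slot_square F a))
  nat_id K X := D.square_id (slot K a) (D.pull_square (slot_square (𝟭 K) a)) X
  nat_comp {I J K} F G X := D.square_comp (slot I a) (slot J a) (slot K a) F G
    (timesMap F (𝟭 A)) (timesMap G (𝟭 A)) (D.pull_square (slot_square (F ⋙ G) a))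
    (D.pull_square (slot_square F a)) (D.pull_square (slot_square G a)) X
  nat_naturality {J K F G} α X := D.square_naturality (slot J a) (slot K a) α
    (timesMap₂ α (𝟙 (𝟭 A))) (slot_square F a) (slot_square G a) (timesMap₂_slot α a) X

/-! ## Vanishing subprederivators -/

theorem pull_isZero {D : Prederivator.{w, v, u} Dia} (hD : D.IsDerivator) {J K : Dia.Shape}
    (F : J ⥤ K) {X : D.cat K} (hX : IsZero X) : IsZero ((D.pull F).obj X) := by
  have := hD.der3_left F
  have := hD.der3_right F
  exact ⟨fun Y => ⟨⟨⟨((Adjunction.ofIsLeftAdjoint (D.pull F)).homEquiv X Y).symm (hX.to_ _)⟩,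
      fun _ => ((Adjunction.ofIsLeftAdjoint (D.pull F)).homEquiv X Y).injective (hX.eq_of_src _ _)⟩⟩,
    fun Y => ⟨⟨⟨(Adjunction.ofIsRightAdjoint (D.pull F)).homEquiv Y X (hX.from_ _)⟩,
      fun _ => ((Adjunction.ofIsRightAdjoint (D.pull F)).homEquiv Y X).symm.injective
        (hX.eq_of_tgt _ _)⟩⟩⟩

/-- The objects `X` of `𝔻(K × B)` with `(id_K × i)^* X = 0` in `𝔻(K × A)`. -/
def vanishes (D : Prederivator.{w, v, u} Dia) {A B : Dia.Shape} (i : A ⥤ B) (K : Dia.Shape) :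
    ObjectProperty ((D.shift B).cat K) :=
  fun X => IsZero (((D.res i).app K).obj X)

theorem vanishes_pull {D : Prederivator.{w, v, u} Dia} (hD : D.IsDerivator) {A B : Dia.Shape}
    (i : A ⥤ B) {J K : Dia.Shape} (F : J ⥤ K) (X : (D.shift B).cat K)
    (hX : D.vanishes i K X) : D.vanishes i J (((D.shift B).pull F).obj X) :=
  IsZero.of_iso (pull_isZero hD (timesMap F (𝟭 A)) hX) (((D.res i).nat F).symm.app X)

theorem eqToHom_hom {C : Type*} [Category C] {P : ObjectProperty C} {X Y : P.FullSubcategory}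
    (h : X = Y) (h' : X.obj = Y.obj) : (eqToHom h).hom = eqToHom h' := by
  subst h
  rfl

theorem fullSubcategory_functor_ext {C : Type*} [Category C] {C' : Type*} [Category C']
    {P : ObjectProperty C} {F G : C' ⥤ P.FullSubcategory} (h : F ⋙ P.ι = G ⋙ P.ι) : F = G := by
  have h₀ : ∀ X, F.obj X = G.obj X := fun X =>
    ObjectProperty.FullSubcategory.ext (Functor.congr_obj h X)
  refine CategoryTheory.Functor.ext h₀ fun X Y f => ?_
  apply P.hom_ext
  rw [ObjectProperty.FullSubcategory.comp_hom, ObjectProperty.FullSubcategory.comp_hom,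
    eqToHom_hom _ (Functor.congr_obj h X), eqToHom_hom _ (Functor.congr_obj h Y).symm]
  exact Functor.congr_hom h f

theorem eqToHom_app_hom {C : Type*} [Category C] {C' : Type*} [Category C']
    {P : ObjectProperty C} {F G : C' ⥤ P.FullSubcategory} (h : F = G) (X : C')
    (h' : (F.obj X).obj = (G.obj X).obj) : ((eqToHom h).app X).hom = eqToHom h' := by
  subst h
  rfl

theorem comp_map_id_aux {C : Type*} [Category C] {C' : Type*} [Category C'] (M : C ⥤ C') {Z : C'}
    {Y : C} (a : Z ⟶ M.obj Y) : a = a ≫ M.map (𝟙 Y) ≫ 𝟙 (M.obj Y) := by simp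

/-- The vanishing prederivator `𝔻^{B,A}` of a functor `i : A ⥤ B` (in practice the inclusion of a
full subcategory): `K` is sent to the full subcategory of `𝔻(K × B)` on the objects `X` with
`(id_K × i)^* X = 0`. -/
def vanishing (D : Prederivator.{w, v, u} Dia) (hD : D.IsDerivator) {A B : Dia.Shape}
    (i : A ⥤ B) : Prederivator.{w, v, u} Dia where
  cat K := (D.vanishes i K).FullSubcategory
  pull {J K} F := (D.vanishes i J).lift ((D.vanishes i K).ι ⋙ (D.shift B).pull F)
    fun X => vanishes_pull hD i F X.obj X.property
  pull₂ α := { app := fun X => ObjectProperty.homMk (((D.shift B).pull₂ α).app X.obj)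
               naturality := fun X Y f => by
                ext
                exact ((D.shift B).pull₂ α).naturality f.hom }
  pull_id K := fullSubcategory_functor_ext
    (congrArg (fun G => (D.vanishes i K).ι ⋙ G) ((D.shift B).pull_id K))
  pull_comp {I J K} F G := fullSubcategory_functor_ext
    (congrArg (fun G => (D.vanishes i K).ι ⋙ G) ((D.shift B).pull_comp F G))
  pull₂_id F := by
    ext X
    simp [(D.shift B).pull₂_id]
  pull₂_comp α β := by
    ext X
    simp [(D.shift B).pull₂_comp]
  pull₂_whiskerLeft {I J K} F {G H} α := by
    ext X
    have h := congrArg (fun a => a.app X.obj) ((D.shift B).pull₂_whiskerLeft F α)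
    simp only [NatTrans.comp_app, eqToHom_app] at h
    refine h.trans ?_
    simp only [NatTrans.comp_app, ObjectProperty.FullSubcategory.comp_hom]
    rw [eqToHom_app_hom, eqToHom_app_hom]
    rfl
  pull₂_whiskerRight {I J K} {F G} α H := by
    ext X
    have h := congrArg (fun a => a.app X.obj) ((D.shift B).pull₂_whiskerRight α H)
    simp only [NatTrans.comp_app, eqToHom_app] at h
    refine h.trans ?_
    simp only [NatTrans.comp_app, ObjectProperty.FullSubcategory.comp_hom]
    rw [eqToHom_app_hom, eqToHom_app_hom]
    rfl

/-- The inclusion `𝔻^{B,A} → 𝔻^B`. -/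
def vanishingIncl (D : Prederivator.{w, v, u} Dia) (hD : D.IsDerivator) {A B : Dia.Shape}
    (i : A ⥤ B) : Hom (D.vanishing hD i) (D.shift B) where
  app K := (D.vanishes i K).ι
  nat _ := Iso.refl _
  nat_id K X := (Category.id_comp _).trans
    ((eqToHom_app_hom ((D.vanishing hD i).pull_id K) X _).trans
      (eqToHom_app ((D.shift B).pull_id K) X.obj).symm)
  nat_comp F G X := (Category.id_comp _).trans
    ((eqToHom_app_hom ((D.vanishing hD i).pull_comp F G) X _).trans
      ((eqToHom_app ((D.shift B).pull_comp F G) X.obj).symm.trans (comp_map_id_aux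
          ((D.shift B).pull F) (((D.shift B).pullComp F G).hom.app X.obj))))
  nat_naturality _ _ := (Category.id_comp _).trans (Category.comp_id _).symm

end Prederivator

/-! ## The posets `□`, `V` and their subposets -/

/-- The poset `□ = {0, 1} × {0, 1}`. -/
@[ext]
structure Sq : Type w where
  fst : Fin 2
  snd : Fin 2

namespace Sq

/-- The underlying pair. -/
def toProd (s : Sq.{w}) : Fin 2 × Fin 2 := (s.fst, s.snd)

theorem toProd_injective : Function.Injective Sq.toProd.{w} := by
  rintro ⟨a, b⟩ ⟨c, d⟩ h
  simpa [toProd] using h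

instance : PartialOrder Sq.{w} := PartialOrder.lift toProd toProd_injective

instance : Countable Sq.{w} := toProd_injective.countable

end Sq

/-- The poset `V` of all `(i, j) ∈ ℤ × ℤ` with `|i - j| ≤ 1`. -/
@[ext]
structure VPoset : Type w where
  fst : ℤ
  snd : ℤ
  le_one : |fst - snd| ≤ 1

namespace VPoset

/-- The underlying pair. -/
def toProd (s : VPoset.{w}) : ℤ × ℤ := (s.fst, s.snd)

theorem toProd_injective : Function.Injective VPoset.toProd.{w} := by
  rintro ⟨a, b, _⟩ ⟨c, d, _⟩ h
  simpa [toProd] using h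

noncomputable instance : PartialOrder VPoset.{w} := PartialOrder.lift toProd toProd_injective

instance : Countable VPoset.{w} := toProd_injective.countable

/-- The point `(n, n)`. -/
def diag (n : ℤ) : VPoset.{w} := ⟨n, n, by simp⟩

/-- The condition `i, j ≤ 0` defining `V^{≤ 0}`. -/
def IsNonpos (x : VPoset.{w}) : Prop := x.fst ≤ 0 ∧ x.snd ≤ 0

/-- The condition `|i - j| = 1` defining `∂V`. -/
def IsBoundary (x : VPoset.{w}) : Prop := |x.fst - x.snd| = 1

/-- The square `i_n : □ → V`, `(a, b) ↦ (a + n, b + n)`. -/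
def square (n : ℤ) (s : Sq.{w}) : VPoset.{w} where
  fst := (s.fst : ℕ) + n
  snd := (s.snd : ℕ) + n
  le_one := by
    have h₁ := s.fst.isLt
    have h₂ := s.snd.isLt
    rw [abs_le]
    omega

theorem square_monotone (n : ℤ) : Monotone (square.{w} n) := by
  intro s t h
  have h₁ : (s.fst : ℕ) ≤ t.fst := h.1
  have h₂ : (s.snd : ℕ) ≤ t.snd := h.2
  refine ⟨?_, ?_⟩
  · change ((s.fst : ℕ) : ℤ) + n ≤ (t.fst : ℕ) + n
    omega
  · change ((s.snd : ℕ) : ℤ) + n ≤ (t.snd : ℕ) + n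
    omega

end VPoset

namespace DiagramDomain

variable (Dia : DiagramDomain.{w})

/-- The shape `□`. -/
abbrev square : Dia.Shape := Dia.ofPoset Sq.{w}

/-- The shape `□` without `(1, 1)`. -/
abbrev lowerCorner : Dia.Shape := Dia.ofPoset {s : Sq.{w} // s ≠ ⟨1, 1⟩}

/-- The shape `□` without `(0, 0)`. -/
abbrev upperCorner : Dia.Shape := Dia.ofPoset {s : Sq.{w} // s ≠ ⟨0, 0⟩}

/-- The shape `V`. -/
noncomputable abbrev V : Dia.Shape := Dia.ofPoset VPoset.{w}

/-- The shape `∂V`. -/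
noncomputable abbrev boundaryV : Dia.Shape := Dia.ofPoset {x : VPoset.{w} // x.IsBoundary}

/-- The shape `V^{≤ 0}`. -/
noncomputable abbrev nonposV : Dia.Shape := Dia.ofPoset {x : VPoset.{w} // x.IsNonpos}

/-- The shape `V'`: the union of `V^{≤ 0}` and `∂V`. -/
noncomputable abbrev primeV : Dia.Shape := Dia.ofPoset {x : VPoset.{w} // x.IsNonpos ∨ x.IsBoundary}

/-- The inclusion of `□` without `(1, 1)` into `□`. -/
def lowerCornerIncl : Dia.lowerCorner ⥤ Dia.square :=
  Monotone.functor (f := Subtype.val) fun _ _ h => h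

/-- The inclusion of `□` without `(0, 0)` into `□`. -/
def upperCornerIncl : Dia.upperCorner ⥤ Dia.square :=
  Monotone.functor (f := Subtype.val) fun _ _ h => h

/-- The inclusion `∂V ⥤ V`. -/
noncomputable def boundaryIncl : Dia.boundaryV ⥤ Dia.V :=
  Monotone.functor (f := Subtype.val) fun _ _ h => h

/-- The inclusion `ι_{≤ 0} : V^{≤ 0} ⥤ V'`. -/
noncomputable def nonposIncl : Dia.nonposV ⥤ Dia.primeV :=
  Monotone.functor (f := fun x => ⟨x.1, Or.inl x.2⟩) fun _ _ h => h

/-- The inclusion `ι : V' ⥤ V`. -/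
noncomputable def primeIncl : Dia.primeV ⥤ Dia.V :=
  Monotone.functor (f := Subtype.val) fun _ _ h => h

/-- The functor `i_n : □ ⥤ V`. -/
noncomputable def squareIncl (n : ℤ) : Dia.square ⥤ Dia.V :=
  Monotone.functor (f := VPoset.square n) (VPoset.square_monotone n)

/-- The point `(0, 0)` of `V^{≤ 0}`. -/
noncomputable def nonposOrigin : Dia.nonposV :=
  (⟨VPoset.diag 0, le_rfl, le_rfl⟩ : {x : VPoset.{w} // x.IsNonpos})

/-- The point `(0, 0)` of `□` without `(1, 1)`. -/
def lowerOrigin : Dia.lowerCorner :=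
  (⟨⟨0, 0⟩, by simp⟩ : {s : Sq.{w} // s ≠ ⟨1, 1⟩})

/-- The point `(1, 1)` of `□` without `(0, 0)`. -/
def upperApex : Dia.upperCorner :=
  (⟨⟨1, 1⟩, by simp⟩ : {s : Sq.{w} // s ≠ ⟨0, 0⟩})

end DiagramDomain

namespace Prederivator

variable {Dia : DiagramDomain.{w}}

/-! ## Suspension, cocartesian squares and prespectra -/

/-- `S : 𝔻 → 𝔻` is a suspension morphism: it is (isomorphic to) the composite
`𝔻 → 𝔻^⌞ → 𝔻^□ → 𝔻^⌝ → 𝔻` of the right Kan extension along `(0, 0)`, the left Kan extension along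
`⌞ ⊂ □`, restriction to `⌝` and evaluation at `(1, 1)`. As morphisms of derivators, Kan extensions
are the adjoints of the restriction morphisms. -/
def IsSuspension (D : Prederivator.{w, v, u} Dia) (S : Hom D D) : Prop :=
  ∃ (r : Hom D (D.shift Dia.lowerCorner))
    (l : Hom (D.shift Dia.lowerCorner) (D.shift Dia.square)),
    (D.ev Dia.lowerOrigin).IsLeftAdjointTo r ∧
    l.IsLeftAdjointTo (D.res Dia.lowerCornerIncl) ∧
    S.IsIsomorphic
      (((r.comp l).comp (D.res Dia.upperCornerIncl)).comp (D.ev Dia.upperApex))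

/-- A coherent square `X ∈ 𝔻^□(K)` is cocartesian if it lies in the essential image of the left Kan
extension along `⌞ ⊂ □`. -/
def IsCocartesian (D : Prederivator.{w, v, u} Dia) {K : Dia.Shape}
    (X : (D.shift Dia.square).cat K) : Prop :=
  ∃ l : (D.shift Dia.lowerCorner).cat K ⥤ (D.shift Dia.square).cat K,
    Nonempty (l ⊣ (D.res Dia.lowerCornerIncl).app K) ∧ l.essImage X

/-- The prederivator `Sp 𝔻 = 𝔻^{V, ∂V}` of prespectrum objects. -/
noncomputable def Sp (D : Prederivator.{w, v, u} Dia) (hD : D.IsDerivator) : Prederivator.{w, v, u} Dia :=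
  D.vanishing hD Dia.boundaryIncl

/-- The inclusion `Sp 𝔻 → 𝔻^V`. -/
noncomputable def SpIncl (D : Prederivator.{w, v, u} Dia) (hD : D.IsDerivator) :
    Hom (D.Sp hD) (D.shift Dia.V) :=
  D.vanishingIncl hD Dia.boundaryIncl

/-- The morphism `(n, n)^* : Sp 𝔻 → 𝔻`, `X ↦ X_n`. -/
noncomputable def SpEv (D : Prederivator.{w, v, u} Dia) (hD : D.IsDerivator) (n : ℤ) : Hom (D.Sp hD) D :=
  (D.SpIncl hD).comp (D.ev (A := Dia.V) (VPoset.diag n))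

end Prederivator

/-! ## Universal arrows -/

/-! Write `e` for ι_{≤0,*} and put L = ι_! ∘ e ∘ (0,0)_!. The values of L x are governed by one
principle: a Kan extension vanishes where the relevant slice is empty, and a Kan extension along a
fully faithful functor does not change the given values. As (0,0) is the greatest element of V^{≤0},
(0,0)_! puts x at (0,0) and zero elsewhere. As V^{≤0} is a sieve in V', `e` is extension by zero. As
ι is fully faithful, ι_! keeps these values. Hence L x vanishes on ∂V and at (n,n) for n < 0, and
has value x at (0,0).

For n ≥ 0 the point (n+1,n+1) is not in V', so L x is also left Kan extended from its restriction to
V without that point (`isUniv_id_of_comp`). Every other point below the square i_n has a least upper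
bound in the corner of i_n (`VPoset.exists_least_corner`), which makes the square i_n^* L x
cocartesian (`isIso_counit_square`). Its values at (1,0) and (0,1) are zero, so its last value is
the suspension of its first (`suspensionIso`), and (L x)_n ≅ Σ^n x by induction.

For the adjunction, (0,0)_! and ι_! are left adjoints by construction. The point is that `e`, a
right adjoint, also has a right adjoint, since it is extension by zero along a sieve
(`exists_rightAdjoint_of_sieve`, proved on a mapping cylinder). The total right adjoint is
evaluation at (0,0) on prespectra: the restriction of a prespectrum to V' is itself extended by zero
from V^{≤0}, and `e` is fully faithful (`spEvIso`). Since Sp is a full subprederivator, the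
adjunction restricts to it.

All this has to hold for morphisms of prederivators, compatibly with restriction in K. Universal
arrows (`IsUniv`) replace chosen adjoints, and Der4 becomes a Beck–Chevalley criterion: a square is
exact if its induced functors on slices are final (`isUniv_of_final_sliceMap`), and right adjoints
are final (`final_of_adjunction`). Applied to products of shapes, this assembles the pointwise Kan
extensions into morphisms (`exists_lan`, `exists_ran`). Facts on right Kan extensions are deduced
from those on left ones by adjunction. -/

section UniversalArrows

variable {C : Type*} [Category C] {C' : Type*} [Category C']

/-- The arrow `f : X ⟶ G Y` is universal from `X` to `G`. -/
def IsUniv (G : C ⥤ C') {X : C'} {Y : C} (f : X ⟶ G.obj Y) : Prop :=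
  ∀ (Y' : C) (h : X ⟶ G.obj Y'), ∃! g : Y ⟶ Y', f ≫ G.map g = h

/-- The arrow `f : G Y ⟶ X` is universal from `G` to `X`. -/
def IsCouniv (G : C ⥤ C') {X : C'} {Y : C} (f : G.obj Y ⟶ X) : Prop :=
  ∀ (Y' : C) (h : G.obj Y' ⟶ X), ∃! g : Y' ⟶ Y, G.map g ≫ f = h

variable {G : C ⥤ C'}

namespace IsUniv

variable {X : C'} {Y : C} {f : X ⟶ G.obj Y}

/-- The factorization through a universal arrow. -/
noncomputable def desc (hf : IsUniv G f) {Y' : C} (h : X ⟶ G.obj Y') : Y ⟶ Y' := (hf Y' h).choose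

@[simp]
theorem fac (hf : IsUniv G f) {Y' : C} (h : X ⟶ G.obj Y') : f ≫ G.map (hf.desc h) = h :=
  (hf Y' h).choose_spec.1

@[simp]
theorem fac_assoc (hf : IsUniv G f) {Y' : C} (h : X ⟶ G.obj Y') {Z : C'} (k : G.obj Y' ⟶ Z) :
    f ≫ G.map (hf.desc h) ≫ k = h ≫ k := by
  rw [← Category.assoc, hf.fac]

theorem hom_ext (hf : IsUniv G f) {Y' : C} {g g' : Y ⟶ Y'} (h : f ≫ G.map g = f ≫ G.map g') :
    g = g' := (hf Y' _).unique h rfl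

theorem precomp_iso (hf : IsUniv G f) {X' : C'} (i : X' ⟶ X) [IsIso i] : IsUniv G (i ≫ f) := by
  intro Y' h
  refine ⟨hf.desc (inv i ≫ h), by simp, fun g hg => hf.hom_ext ?_⟩
  simp [← hg]

theorem postcomp_iso (hf : IsUniv G f) {Y' : C} (i : Y ⟶ Y') [IsIso i] :
    IsUniv G (f ≫ G.map i) := by
  intro Z h
  refine ⟨inv i ≫ hf.desc h, by simp, fun g hg => ?_⟩
  rw [← cancel_epi i, IsIso.hom_inv_id_assoc]
  exact hf.hom_ext (by simpa using hg)

theorem of_precomp_iso {X' : C'} (i : X' ⟶ X) [IsIso i] (hf : IsUniv G (i ≫ f)) : IsUniv G f := by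
  simpa using hf.precomp_iso (inv i)

theorem of_postcomp_iso {Y' : C} (i : Y ⟶ Y') [IsIso i] (hf : IsUniv G (f ≫ G.map i)) :
    IsUniv G f := by
  simpa using hf.postcomp_iso (inv i)

theorem isIso_of_fac (hf : IsUniv G f) {Y' : C} {f' : X ⟶ G.obj Y'} (hf' : IsUniv G f')
    {g : Y ⟶ Y'} (hg : f ≫ G.map g = f') : IsIso g :=
  ⟨hf'.desc f, hf.hom_ext (by simp [reassoc_of% hg]), hf'.hom_ext (by simp [hg])⟩

theorem exists_iso (hf : IsUniv G f) {Y' : C} {f' : X ⟶ G.obj Y'} (hf' : IsUniv G f') :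
    ∃ i : Y ≅ Y', f ≫ G.map i.hom = f' := by
  have := hf.isIso_of_fac hf' (hf.fac f')
  exact ⟨asIso (hf.desc f'), by simp⟩

theorem comp {C'' : Type*} [Category C''] {H : C' ⥤ C''} {Z : C''}
    {e : Z ⟶ H.obj X} (he : IsUniv H e) (hf : IsUniv G f) :
    IsUniv (G ⋙ H) (e ≫ H.map f) := by
  intro Y' h
  refine ⟨hf.desc (he.desc h), ?_, fun k hk => hf.hom_ext (he.hom_ext ?_)⟩
  · simp [← H.map_comp]
  · simpa using hk

/-- Cancellation: together with `comp` it lets universality pass in both directions across a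
universal first factor. -/
theorem of_comp {C'' : Type*} [Category C''] {H : C' ⥤ C''} {Z : C''}
    {e : Z ⟶ H.obj X} (he : IsUniv H e)
    (hef : IsUniv (G ⋙ H) (e ≫ H.map f)) : IsUniv G f := by
  intro Y' h
  refine ⟨hef.desc (e ≫ H.map h), he.hom_ext ?_, fun k hk => hef.hom_ext ?_⟩
  · simpa using hef.fac (e ≫ H.map h)
  · rw [hef.fac]
    simp [← hk]

theorem of_natTrans {G' : C ⥤ C'} (α : G ⟶ G') [IsIso α] (hf : IsUniv G f) :
    IsUniv G' (f ≫ α.app Y) := by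
  intro Y' h
  refine ⟨hf.desc (h ≫ (inv α).app Y'), ?_, fun g hg => hf.hom_ext ?_⟩
  · change (f ≫ α.app Y) ≫ _ = h
    rw [Category.assoc, ← α.naturality, hf.fac_assoc]
    simp
  · rw [hf.fac, ← hg]
    simp

theorem isIso_of_isEquivalence [G.IsEquivalence] (hf : IsUniv G f) : IsIso f := by
  -- Since `G` is essentially surjective, the universal property can be tested against an
  -- isomorphism out of `X`; this yields a retraction of `f`.
  obtain ⟨g, hg, -⟩ := hf (G.objPreimage X) (G.objObjPreimageIso X).inv
  have : Mono f := by
    have : Mono (f ≫ G.map g) := by rw [hg]; infer_instance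
    exact mono_of_mono f (G.map g)
  have hk : (G.objObjPreimageIso X).hom ≫ f = G.map (G.preimage ((G.objObjPreimageIso X).hom ≫ f)) := by
    simp
  refine ⟨G.map g ≫ (G.objObjPreimageIso X).hom, by rw [reassoc_of% hg]; simp, ?_⟩
  have : g ≫ G.preimage ((G.objObjPreimageIso X).hom ≫ f) = 𝟙 _ := hf.hom_ext (by
    rw [G.map_comp, ← hk, reassoc_of% hg]; simp)
  rw [Category.assoc, hk, ← G.map_comp, this, G.map_id]

theorem of_isIso [G.Full] [G.Faithful] [IsIso f] : IsUniv G f := fun Y' h =>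
  ⟨G.preimage (inv f ≫ h), by simp, fun g hg => G.map_injective (by simp [← hg])⟩

end IsUniv

namespace IsCouniv

variable {X : C'} {Y : C} {f : G.obj Y ⟶ X}

/-- The factorization through a couniversal arrow. -/
noncomputable def lift (hf : IsCouniv G f) {Y' : C} (h : G.obj Y' ⟶ X) : Y' ⟶ Y := (hf Y' h).choose

@[simp]
theorem fac (hf : IsCouniv G f) {Y' : C} (h : G.obj Y' ⟶ X) : G.map (hf.lift h) ≫ f = h :=
  (hf Y' h).choose_spec.1

theorem hom_ext (hf : IsCouniv G f) {Y' : C} {g g' : Y' ⟶ Y} (h : G.map g ≫ f = G.map g' ≫ f) :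
    g = g' := (hf Y' _).unique h rfl

theorem isIso_of_isEquivalence [G.IsEquivalence] (hf : IsCouniv G f) : IsIso f := by
  obtain ⟨g, hg, -⟩ := hf (G.objPreimage X) (G.objObjPreimageIso X).hom
  have hk : f ≫ (G.objObjPreimageIso X).inv = G.map (G.preimage (f ≫ (G.objObjPreimageIso X).inv)) := by
    simp
  refine ⟨(G.objObjPreimageIso X).inv ≫ G.map g, ?_, by rw [Category.assoc, hg]; simp⟩
  have : G.preimage (f ≫ (G.objObjPreimageIso X).inv) ≫ g = 𝟙 _ := hf.hom_ext (by
    rw [G.map_comp, ← hk, Category.assoc, hg]; simp)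
  rw [← Category.assoc, hk, ← G.map_comp, this, G.map_id]

theorem of_isIso [G.Full] [G.Faithful] [IsIso f] : IsCouniv G f := fun Y' h =>
  ⟨G.preimage (h ≫ inv f), by simp, fun g hg => G.map_injective (by simp [← hg])⟩

end IsCouniv

theorem isUniv_unit {F : C' ⥤ C} (adj : F ⊣ G) (X : C') : IsUniv G (adj.unit.app X) := by
  refine fun Y' h => ⟨(adj.homEquiv X _).symm h, ?_, fun g hg => ?_⟩
  · exact (adj.homEquiv_unit X _ _).symm.trans ((adj.homEquiv _ _).apply_symm_apply h)
  · exact ((adj.homEquiv X _).eq_symm_apply).2 ((adj.homEquiv_unit X _ _).trans hg)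

theorem isCouniv_counit {F : C' ⥤ C} (adj : G ⊣ F) (X : C') : IsCouniv G (adj.counit.app X) := by
  refine fun Y' h => ⟨adj.homEquiv _ X h, ?_, fun g hg => ?_⟩
  · exact (adj.homEquiv_counit _ X _).symm.trans ((adj.homEquiv _ _).symm_apply_apply h)
  · exact ((adj.homEquiv _ X).symm_apply_eq).1 ((adj.homEquiv_counit _ X _).trans hg)

theorem exists_isUniv (G : C ⥤ C') [G.IsRightAdjoint] (X : C') :
    ∃ (Y : C) (f : X ⟶ G.obj Y), IsUniv G f :=
  ⟨_, _, isUniv_unit (Adjunction.ofIsRightAdjoint G) X⟩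

theorem isRightAdjoint_of_exists_isUniv (h : ∀ X : C', ∃ (Y : C) (f : X ⟶ G.obj Y), IsUniv G f) :
    G.IsRightAdjoint := by
  choose Y f hf using h
  exact ⟨_, ⟨Adjunction.adjunctionOfEquivLeft (F_obj := Y) (G := G)
    (fun X Y' => { toFun := fun g => f X ≫ G.map g
                   invFun := (hf X).desc
                   left_inv := fun g => (hf X).hom_ext (by simp)
                   right_inv := fun h => by simp }) (by intros; simp)⟩⟩

end UniversalArrows

/-! ## Arrows over functors -/

namespace Prederivator

variable {Dia : DiagramDomain.{w}} (D : Prederivator.{w, v, u} Dia)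

section Over

variable {I J K L : Dia.Shape}

/-- The composite over `F ⋙ G` of an arrow `f : X ⟶ F^* Y` over `F` and an arrow `g : Y ⟶ G^* Z`
over `G`. -/
def overComp {F : I ⥤ J} {G : J ⥤ K} {X : D.cat I} {Y : D.cat J} {Z : D.cat K}
    (f : X ⟶ (D.pull F).obj Y) (g : Y ⟶ (D.pull G).obj Z) : X ⟶ (D.pull (F ⋙ G)).obj Z :=
  f ≫ (D.pull F).map g ≫ (D.pullComp F G).inv.app Z

/-- Arrows over functors compose as in a Grothendieck construction. Both sides have the same type
because composition of functors is associative by definition. -/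
theorem overComp_assoc {F : I ⥤ J} {G : J ⥤ K} {H : K ⥤ L} {X : D.cat I} {Y : D.cat J}
    {Z : D.cat K} {T : D.cat L} (f : X ⟶ (D.pull F).obj Y) (g : Y ⟶ (D.pull G).obj Z)
    (h : Z ⟶ (D.pull H).obj T) :
    D.overComp (D.overComp f g) h = D.overComp (G := G ⋙ H) f (D.overComp g h) := by
  have := (D.pullComp F G).inv.naturality h
  simp only [overComp, pullComp, Category.assoc, Functor.map_comp, Functor.comp_map,
    eqToIso.inv] at this ⊢
  rw [← reassoc_of% this]
  simp [eqToHom_map]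

theorem comp_overComp {F : I ⥤ J} {G : J ⥤ K} {X X' : D.cat I} {Y : D.cat J} {Z : D.cat K}
    (a : X' ⟶ X) (f : X ⟶ (D.pull F).obj Y) (g : Y ⟶ (D.pull G).obj Z) :
    D.overComp (a ≫ f) g = a ≫ D.overComp f g := by
  simp [overComp]

theorem overComp_map_left {F : I ⥤ J} {G : J ⥤ K} {X : D.cat I} {Y Y' : D.cat J} {Z : D.cat K}
    (f : X ⟶ (D.pull F).obj Y) (b : Y ⟶ Y') (g : Y' ⟶ (D.pull G).obj Z) :
    D.overComp (f ≫ (D.pull F).map b) g = D.overComp f (b ≫ g) := by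
  simp [overComp]

theorem overComp_map_right {F : I ⥤ J} {G : J ⥤ K} {X : D.cat I} {Y : D.cat J} {Z Z' : D.cat K}
    (f : X ⟶ (D.pull F).obj Y) (g : Y ⟶ (D.pull G).obj Z) (c : Z ⟶ Z') :
    D.overComp f (g ≫ (D.pull G).map c) = D.overComp f g ≫ (D.pull (F ⋙ G)).map c := by
  have h := (D.pullComp F G).inv.naturality c
  rw [Functor.comp_map] at h
  simp [overComp, h]

theorem overComp_pull₂_right {F : I ⥤ J} {G G' : J ⥤ K} (β : G ⟶ G') {X : D.cat I} {Y : D.cat J}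
    {Z : D.cat K} (f : X ⟶ (D.pull F).obj Y) (g : Y ⟶ (D.pull G).obj Z) :
    D.overComp f (g ≫ (D.pull₂ β).app Z) =
      D.overComp f g ≫ (D.pull₂ (Functor.whiskerLeft F β)).app Z := by
  simp [overComp, D.pull₂_whiskerLeft, pullComp]

theorem overComp_pull₂_left {F F' : I ⥤ J} {G : J ⥤ K} (α : F ⟶ F') {X : D.cat I} {Y : D.cat J}
    {Z : D.cat K} (f : X ⟶ (D.pull F).obj Y) (g : Y ⟶ (D.pull G).obj Z) :
    D.overComp (f ≫ (D.pull₂ α).app Y) g =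
      D.overComp f g ≫ (D.pull₂ (Functor.whiskerRight α G)).app Z := by
  simp [overComp, D.pull₂_whiskerRight, pullComp]

/-- The tautological arrow over `F` with target `Y`. -/
def cart (F : I ⥤ J) (Y : D.cat J) : (D.pull F).obj Y ⟶ (D.pull F).obj Y := 𝟙 _

theorem overComp_cart {F : I ⥤ J} {G : J ⥤ K} {X : D.cat I} {Z : D.cat K}
    (f : X ⟶ (D.pull F).obj ((D.pull G).obj Z)) :
    D.overComp f (D.cart G Z) = f ≫ (D.pullComp F G).inv.app Z := by
  simp [overComp, cart]

/-- An arrow over a composite factors through the tautological arrow. -/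
def overLift {F : I ⥤ J} {G : J ⥤ K} {X : D.cat I} {Z : D.cat K}
    (f : X ⟶ (D.pull (F ⋙ G)).obj Z) : X ⟶ (D.pull F).obj ((D.pull G).obj Z) :=
  f ≫ (D.pullComp F G).hom.app Z

@[simp]
theorem overLift_overComp_cart {F : I ⥤ J} {G : J ⥤ K} {X : D.cat I} {Z : D.cat K}
    (f : X ⟶ (D.pull (F ⋙ G)).obj Z) : D.overComp (D.overLift f) (D.cart G Z) = f := by
  simp [overComp_cart, overLift]

/-- Reduces an identity of arrows to one over the composite functor, where it becomes an identity
between 2-cells of shapes. -/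
theorem overComp_cart_injective {F : I ⥤ J} {G : J ⥤ K} {X : D.cat I} {Z : D.cat K}
    {f f' : X ⟶ (D.pull F).obj ((D.pull G).obj Z)}
    (h : D.overComp f (D.cart G Z) = D.overComp f' (D.cart G Z)) : f = f' := by
  rw [overComp_cart, overComp_cart] at h
  exact (cancel_mono _).1 h

theorem map_overComp_cart {F : I ⥤ J} {G : J ⥤ K} {Y : D.cat J} {Z : D.cat K}
    (g : Y ⟶ (D.pull G).obj Z) :
    D.overComp ((D.pull F).map g) (D.cart G Z) = D.overComp (D.cart F Y) g := by
  simp [overComp, cart]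

theorem isUniv_overComp {F : I ⥤ J} {G : J ⥤ K} {X : D.cat I} {Y : D.cat J} {Z : D.cat K}
    {f : X ⟶ (D.pull F).obj Y} {g : Y ⟶ (D.pull G).obj Z} (hf : IsUniv (D.pull F) f)
    (hg : IsUniv (D.pull G) g) : IsUniv (D.pull (F ⋙ G)) (D.overComp f g) := by
  have := (hf.comp hg).of_natTrans (D.pullComp F G).inv
  rwa [Category.assoc] at this

theorem isUniv_of_overComp {F : I ⥤ J} {G : J ⥤ K} {X : D.cat I} {Y : D.cat J} {Z : D.cat K}
    {f : X ⟶ (D.pull F).obj Y} {g : Y ⟶ (D.pull G).obj Z} (hf : IsUniv (D.pull F) f)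
    (hfg : IsUniv (D.pull (F ⋙ G)) (D.overComp f g)) : IsUniv (D.pull G) g := by
  refine hf.of_comp ?_
  have := hfg.of_natTrans (D.pullComp F G).hom
  simpa [overComp] using this

instance isIso_pull₂ {F G : J ⥤ K} (α : F ⟶ G) [IsIso α] : IsIso (D.pull₂ α) :=
  ⟨D.pull₂ (inv α), by rw [← D.pull₂_comp, IsIso.hom_inv_id, D.pull₂_id],
    by rw [← D.pull₂_comp, IsIso.inv_hom_id, D.pull₂_id]⟩

theorem pull₂_app_comp {F G H : J ⥤ K} (α : F ⟶ G) (β : G ⟶ H) (X : D.cat K) :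
    (D.pull₂ α).app X ≫ (D.pull₂ β).app X = (D.pull₂ (α ≫ β)).app X := by
  rw [D.pull₂_comp, NatTrans.comp_app]

/-- `F^*` and `G^*` are isomorphic if `F` and `G` are. -/
def pullIso {F G : J ⥤ K} (e : F ≅ G) : D.pull F ≅ D.pull G where
  hom := D.pull₂ e.hom
  inv := D.pull₂ e.inv
  hom_inv_id := by rw [← D.pull₂_comp, e.hom_inv_id, D.pull₂_id]
  inv_hom_id := by rw [← D.pull₂_comp, e.inv_hom_id, D.pull₂_id]

end Over

/-! ## Pointwise detection and final functors -/

section Der4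

variable {D} {J K : Dia.Shape}

/-- The arrow over `J_{/k} ⥤ e` induced by an arrow over `u : J ⥤ K`. -/
def sliceArrow (D : Prederivator.{w, v, u} Dia) {u : J ⥤ K} {Z : D.cat J} {W : D.cat K}
    (f : Z ⟶ (D.pull u).obj W) (k : K) : (D.pull (overProj u k)).obj Z ⟶
      (D.pull (toPoint (Shape.over u k))).obj ((D.pull (pt k)).obj W) :=
  D.overLift (D.overComp (D.cart (overProj u k) Z) f ≫ (D.pull₂ (overCell u k)).app W)

theorem sliceArrow_eq {u : J ⥤ K} {Z : D.cat J} {W : D.cat K} (f : Z ⟶ (D.pull u).obj W) (k : K) :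
    D.sliceArrow f k = (D.pull (overProj u k)).map f ≫ (D.overSquare u k).natTrans.app W := by
  simp [sliceArrow, overLift, overComp, cart, overSquare]

/-- Der4 in terms of universal arrows. For `f` the unit of u_! ⊣ u^*, the slice arrow is the unit of
π_! ⊣ π^* followed by the Der4 mate, which is invertible; a general universal `f` differs from the
unit by an isomorphism. -/
theorem isUniv_sliceArrow (hD : D.IsDerivator) {u : J ⥤ K} {Z : D.cat J} {W : D.cat K}
    {f : Z ⟶ (D.pull u).obj W} (hf : IsUniv (D.pull u) f) (k : K) :
    IsUniv (D.pull (toPoint (Shape.over u k))) (D.sliceArrow f k) := by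
  have := hD.der3_left u
  have := hD.der3_left (toPoint (Shape.over u k))
  let adjF := Adjunction.ofIsRightAdjoint (D.pull u)
  let adj := Adjunction.ofIsRightAdjoint (D.pull (toPoint (Shape.over u k)))
  have hmate := hD.der4_left u k _ adjF _ adj
  have h₁ := unit_mateEquiv_symm adjF adj (D.overSquare u k) Z
  obtain ⟨i, hi⟩ := (isUniv_unit adjF Z).exists_iso hf
  have h₂ : D.sliceArrow f k = (adj.unit.app _ ≫ (D.pull (toPoint (Shape.over u k))).map
      (((mateEquiv adjF adj).symm (D.overSquare u k)).natTrans.app Z)) ≫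
      (D.pull (toPoint (Shape.over u k))).map ((D.pull (pt k)).map i.hom) := by
    rw [sliceArrow_eq, ← hi, Functor.map_comp, Category.assoc]
    erw [(D.overSquare u k).natTrans.naturality i.hom]
    rw [← Category.assoc]
    exact congrArg (· ≫ _) h₁
  rw [h₂]
  exact ((isUniv_unit adj _).postcomp_iso _).postcomp_iso _

/-- Compare `f` with a universal arrow `f₀` provided by Der3. The comparison is invertible at each
point `k`, both slice arrows being universal there, and Der2 concludes. -/
theorem isUniv_of_sliceArrow (hD : D.IsDerivator) {u : J ⥤ K} {Z : D.cat J} {W : D.cat K}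
    {f : Z ⟶ (D.pull u).obj W}
    (hf : ∀ k, IsUniv (D.pull (toPoint (Shape.over u k))) (D.sliceArrow f k)) :
    IsUniv (D.pull u) f := by
  have := hD.der3_left u
  obtain ⟨W₀, f₀, hf₀⟩ := exists_isUniv (D.pull u) Z
  have hf' := hf₀.fac f
  have : IsIso (hf₀.desc f) := (hD.der2 _).2 fun k => by
    refine (isUniv_sliceArrow hD hf₀ k).isIso_of_fac (hf k) ?_
    rw [sliceArrow_eq, sliceArrow_eq]
    conv_rhs => rw [← hf', Functor.map_comp, Category.assoc]
    rw [Category.assoc]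
    congr 1
    exact ((D.overSquare u k).natTrans.naturality _).symm
  rw [← hf']
  exact hf₀.postcomp_iso _

end Der4

end Prederivator

namespace Prederivator

variable {Dia : DiagramDomain.{w}} (D : Prederivator.{w, v, u} Dia)

/-! ### Identity arrows and changes of 2-cell -/

section Identity

variable {I J K : Dia.Shape}

/-- The identity arrow, as an arrow over the identity functor. -/
def one (X : D.cat J) : X ⟶ (D.pull (𝟭 J)).obj X := (D.pullId J).inv.app X

theorem one_naturality {X Y : D.cat J} (f : X ⟶ Y) :
    f ≫ D.one Y = D.one X ≫ (D.pull (𝟭 J)).map f :=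
  (D.pullId J).inv.naturality f

theorem comp_one_injective {X Y : D.cat J} {f g : X ⟶ Y} (h : f ≫ D.one Y = g ≫ D.one Y) :
    f = g :=
  (cancel_mono ((D.pullId J).inv.app Y)).1 h

theorem one_overComp {F : J ⥤ K} {X : D.cat J} {Y : D.cat K} (f : X ⟶ (D.pull F).obj Y) :
    D.overComp (D.one X) f = f := by
  have h := (D.pullId J).inv.naturality f
  rw [Functor.id_map] at h
  rw [overComp, one, ← Category.assoc, ← h]
  simp [pullId, pullComp]

theorem overComp_one {F : J ⥤ K} {X : D.cat J} {Y : D.cat K} (f : X ⟶ (D.pull F).obj Y) :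
    D.overComp f (D.one Y) = f := by
  simp [overComp, one, pullId, pullComp, eqToHom_map]

theorem cart_overComp_cart (F : I ⥤ J) (G : J ⥤ K) (X : D.cat K) :
    D.overComp (D.cart F ((D.pull G).obj X)) (D.cart G X) =
      (D.pullComp F G).inv.app X ≫ D.cart (F ⋙ G) X := by
  simp [overComp, cart]

theorem isUniv_comp_pull₂_iff {F G : J ⥤ K} (α : F ⟶ G) [IsIso α] {X : D.cat J} {Y : D.cat K}
    {f : X ⟶ (D.pull F).obj Y} :
    IsUniv (D.pull G) (f ≫ (D.pull₂ α).app Y) ↔ IsUniv (D.pull F) f := by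
  refine ⟨fun h => ?_, fun h => h.of_natTrans _⟩
  have := h.of_natTrans (D.pull₂ (inv α))
  rwa [Category.assoc, pull₂_app_comp, IsIso.hom_inv_id, D.pull₂_id, NatTrans.id_app,
    Category.comp_id] at this

theorem pull₂_app_comp₃ {F G H L : J ⥤ K} (α : F ⟶ G) (β : G ⟶ H) (γ : H ⟶ L) (X : D.cat K) :
    (D.pull₂ α).app X ≫ (D.pull₂ β).app X ≫ (D.pull₂ γ).app X = (D.pull₂ (α ≫ β ≫ γ)).app X := by
  rw [pull₂_app_comp, pull₂_app_comp]

theorem comp_pull₂_comp_pull₂ {F G : J ⥤ K} {α : F ⟶ G} {β : G ⟶ F} (h : α ≫ β = 𝟙 F)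
    {X : D.cat J} {Y : D.cat K} (f : X ⟶ (D.pull F).obj Y) :
    (f ≫ (D.pull₂ α).app Y) ≫ (D.pull₂ β).app Y = f := by
  rw [Category.assoc, pull₂_app_comp, h, D.pull₂_id, NatTrans.id_app, Category.comp_id]

end Identity

instance isIso_toPoint {J : Dia.Shape} {F G : J ⥤ Dia.point} (α : F ⟶ G) : IsIso α := by
  have : ∀ j, IsIso (α.app j) := fun j =>
    ⟨eqToHom (Subsingleton.elim (α := Discrete PUnit) _ _), Subsingleton.elim _ _, Subsingleton.elim _ _⟩
  exact NatIso.isIso_of_isIso_app α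

/-- The functor `w` is final for `D`: restriction along `w` preserves and reflects colimits. -/
def Final {I J : Dia.Shape} (w : I ⥤ J) : Prop :=
  ∀ (X : D.cat J) (T : D.cat Dia.point) (f : X ⟶ (D.pull (toPoint J)).obj T),
    IsUniv (D.pull (toPoint J)) f ↔
      IsUniv (D.pull (w ⋙ toPoint J)) (D.overComp (D.cart w X) f)

variable {D}

/-- With `Final.comp` and `Final.of_iso` this gives the cancellation by which slice functors of
product squares are shown to be final. -/
theorem Final.of_comp {I J K : Dia.Shape} {w : I ⥤ J} {w' : J ⥤ K} (hw : D.Final w)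
    (h : D.Final (w ⋙ w')) : D.Final w' := by
  intro X T f
  rw [h X T f]
  have h₁ := hw _ _ (D.overComp (D.cart w' X) f)
  have h₂ : D.overComp (G := w' ⋙ toPoint K) (D.cart w _) (D.overComp (D.cart w' X) f) =
      (D.pullComp w w').inv.app X ≫ D.overComp (D.cart (w ⋙ w') X) f := by
    rw [← overComp_assoc, cart_overComp_cart, comp_overComp]
  refine ⟨fun h₃ => h₁.2 ?_, fun h₃ => ?_⟩
  · erw [h₂]
    exact h₃.precomp_iso _
  · have h₄ := h₁.1 h₃
    erw [h₂] at h₄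
    exact h₄.of_precomp_iso _

theorem Final.comp {I J K : Dia.Shape} {w : I ⥤ J} {w' : J ⥤ K} (hw : D.Final w)
    (hw' : D.Final w') : D.Final (w ⋙ w') := by
  intro X T f
  rw [hw' X T f]
  have h₁ := hw _ _ (D.overComp (D.cart w' X) f)
  have h₂ : D.overComp (G := w' ⋙ toPoint K) (D.cart w _) (D.overComp (D.cart w' X) f) =
      (D.pullComp w w').inv.app X ≫ D.overComp (D.cart (w ⋙ w') X) f := by
    rw [← overComp_assoc, cart_overComp_cart, comp_overComp]
  refine ⟨fun h₃ => ?_, fun h₃ => h₁.2 ?_⟩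
  · have h₄ := h₁.1 h₃
    erw [h₂] at h₄
    exact h₄.of_precomp_iso _
  · erw [h₂]
    exact h₃.precomp_iso _

/-! ### Right adjoints are final -/

section RightAdjoint

variable {I J : Dia.Shape} {w : I ⥤ J} {l : J ⥤ I} (adj : l ⊣ w)

/-- The unit of the adjunction `w^* ⊣ l^*` induced by `l ⊣ w`. -/
def adjArrow (X : D.cat J) : X ⟶ (D.pull l).obj ((D.pull w).obj X) :=
  D.overLift (D.one X ≫ (D.pull₂ adj.unit).app X)

theorem adjArrow_overComp {K : Dia.Shape} {G : J ⥤ K} {X : D.cat J} {Y : D.cat K}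
    (h : X ⟶ (D.pull G).obj Y) :
    D.overComp (adjArrow adj X) (D.overComp (D.cart w X) h) =
      h ≫ (D.pull₂ (Functor.whiskerRight adj.unit G)).app Y := by
  rw [← overComp_assoc, adjArrow, overLift_overComp_cart, overComp_pull₂_left, one_overComp]

theorem cart_overComp_adjArrow (X : D.cat J) :
    D.overComp (D.cart w X) (adjArrow adj X) ≫ (D.pull₂ adj.counit).app _ = D.one _ := by
  apply D.overComp_cart_injective
  rw [overComp_pull₂_left, overComp_assoc, adjArrow, overLift_overComp_cart, one_overComp,
    overComp_pull₂_right, overComp_one]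
  have : Functor.whiskerLeft w adj.unit ≫ Functor.whiskerRight adj.counit w = 𝟙 w := by
    ext x
    exact adj.right_triangle_components x
  exact D.comp_pull₂_comp_pull₂ this _

/-- A prederivator reverses functors but not transformations, so l ⊣ w turns into w^* ⊣ l^*. The two
triangle identities of the original adjunction give existence and uniqueness. -/
theorem isUniv_adjArrow (X : D.cat J) : IsUniv (D.pull l) (adjArrow adj X) := by
  intro Y h
  refine ⟨(D.overComp (D.cart w X) h ≫ (D.pull₂ adj.counit).app Y) ≫ (D.pullId I).hom.app Y,
    ?_, fun g hg => ?_⟩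
  · have h₁ : ((D.overComp (D.cart w X) h ≫ (D.pull₂ adj.counit).app Y) ≫
        (D.pullId I).hom.app Y) ≫ D.one Y =
        D.overComp (D.cart w X) h ≫ (D.pull₂ adj.counit).app Y := by
      simp [one]
    change _ ≫ _ = h
    rw [← D.overComp_one (_ ≫ _), overComp_map_left, h₁, overComp_pull₂_right,
      adjArrow_overComp]
    have : Functor.whiskerRight adj.unit l ≫ Functor.whiskerLeft l adj.counit = 𝟙 l := by
      ext x
      exact adj.left_triangle_components x
    exact D.comp_pull₂_comp_pull₂ this _
  · apply D.comp_one_injective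
    have h₁ := (D.pull₂ adj.counit).naturality g
    have h₂ : D.overComp (D.cart w X) h ≫ (D.pull₂ adj.counit).app Y = g ≫ D.one Y := by
      rw [← show adjArrow adj X ≫ (D.pull l).map g = h from hg, overComp_map_right,
        Category.assoc]
      erw [h₁]
      rw [← Category.assoc, cart_overComp_adjArrow, one_naturality]
    rw [h₂]
    simp [one]

include adj in
-- Here w^* is left Kan extension along `l`, so a cocone on w^* X composed with the universal arrow
-- X ⟶ l^* w^* X is, up to an invertible 2-cell, the given cocone on `X`. The 2-cell is invertible
-- because its target shape is a point.
theorem final_of_adjunction : D.Final w := by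
  intro X T f
  have h := D.isUniv_comp_pull₂_iff (Functor.whiskerRight adj.unit (toPoint J)) (f := f)
  rw [← adjArrow_overComp] at h
  refine h.symm.trans ⟨fun h => D.isUniv_of_overComp (isUniv_adjArrow adj X) h,
    fun h => D.isUniv_overComp (isUniv_adjArrow adj X) h⟩

end RightAdjoint

theorem final_of_isRightAdjoint {I J : Dia.Shape} (w : I ⥤ J) [w.IsRightAdjoint] : D.Final w :=
  final_of_adjunction (Adjunction.ofIsRightAdjoint w)

/-! ## Exact squares -/

theorem comp_cancel_middle {C : Type*} [Category C] {P Q R S : C} (x : P ⟶ Q) (y : Q ⟶ R)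
    (z : R ⟶ Q) (h : y ≫ z = 𝟙 Q) (r : Q ⟶ S) : (x ≫ y) ≫ z ≫ r = x ≫ r := by
  rw [Category.assoc, reassoc_of% h]

section Exact

variable {A C J K : Dia.Shape} {p : A ⥤ J} {t : J ⥤ K} {q : A ⥤ C} {s : C ⥤ K}

/-- The functor `A_{/c} ⥤ J_{/s c}` induced by a square with a natural transformation. -/
def sliceMap (α : p ⋙ t ⟶ q ⋙ s) (c : C) : Shape.over q c ⥤ Shape.over t (s.obj c) where
  obj y := CostructuredArrow.mk (Y := p.obj y.left) (α.app y.left ≫ s.map y.hom)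
  map {y z} g := CostructuredArrow.homMk (p.map g.left) (by
    have h₁ := α.naturality g.left
    have h₂ := CostructuredArrow.w g
    simp only [Functor.comp_map] at h₁
    simp only [CostructuredArrow.mk_hom_eq_self]
    rw [reassoc_of% h₁, ← s.map_comp, h₂])
  map_id y := by ext; exact p.map_id _
  map_comp f g := by ext; exact p.map_comp _ _

/-- The comparison of `pt c ⋙ s` with `pt (s c)`. -/
def ptComp (s : C ⥤ K) (c : C) : pt c ⋙ s ≅ pt (s.obj c) :=
  NatIso.ofComponents (fun _ => Iso.refl _) (fun _ => by simp [pt])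

/-- Beck–Chevalley. By Der4 both universality statements are about colimits over slices, at `s c`
for `f` and at `c` for `f'`; finality of the functor between the slices identifies the colimits. -/
theorem isUniv_of_final_sliceMap (hD : D.IsDerivator) (α : p ⋙ t ⟶ q ⋙ s)
    (hα : ∀ c, D.Final (sliceMap α c)) {Z : D.cat J} {W : D.cat K} {f : Z ⟶ (D.pull t).obj W}
    (hf : IsUniv (D.pull t) f)
    {f' : (D.pull p).obj Z ⟶ (D.pull q).obj ((D.pull s).obj W)}
    (hf' : D.overComp f' (D.cart s W) =
      D.overComp (D.cart p Z) f ≫ (D.pull₂ α).app W) :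
    IsUniv (D.pull q) f' := by
  refine isUniv_of_sliceArrow hD fun c => ?_
  have h₁ := (hα c _ _ _).1 (isUniv_sliceArrow hD hf (s.obj c))
  let j : (D.pull (pt c)).obj ((D.pull s).obj W) ≅ (D.pull (pt (s.obj c))).obj W :=
    (D.pullComp (pt c) s).symm.app W ≪≫ (D.pullIso (ptComp s c)).app W
  have hj : j.hom ≫ D.cart (pt (s.obj c)) W =
      D.overComp (D.cart (pt c) _) (D.cart s W) ≫ (D.pull₂ (ptComp s c).hom).app W := by
    rw [cart_overComp_cart]
    simp [j, cart, pullIso]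
  let a : (D.pull (overProj q c)).obj ((D.pull p).obj Z) ≅
      (D.pull (sliceMap α c)).obj ((D.pull (overProj t (s.obj c))).obj Z) :=
    (D.pullComp (overProj q c) p).symm.app Z ≪≫
      (D.pullComp (sliceMap α c) (overProj t (s.obj c))).app Z
  -- The slice arrow of `f'` at `c` is the restriction of that of `f` at `s c`, up to the
  -- isomorphisms `a` and `j`. After composing with the tautological arrow, the identity reduces to
  -- the equality `h₂` of 2-cells.
  have key : D.sliceArrow f' c ≫ (D.pull (toPoint (Shape.over q c))).map j.hom =
      a.hom ≫ D.overComp (D.cart (sliceMap α c) _) (D.sliceArrow f (s.obj c)) := by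
    apply D.overComp_cart_injective
    have h₂ : Functor.whiskerLeft (overProj q c) α ≫ Functor.whiskerRight (overCell q c) s ≫
        Functor.whiskerLeft (toPoint (Shape.over q c)) (ptComp s c).hom =
        Functor.whiskerLeft (sliceMap α c) (overCell t (s.obj c)) := by
      ext y
      exact congrArg (α.app y.left ≫ ·) (Category.comp_id (s.map y.hom))
    have hl : D.overComp (D.sliceArrow f' c ≫ (D.pull (toPoint (Shape.over q c))).map j.hom)
        (D.cart (pt (s.obj c)) W) = (D.pullComp (overProj q c) p).inv.app Z ≫
        D.overComp (D.cart (overProj q c ⋙ p) Z) f ≫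
          (D.pull₂ (Functor.whiskerLeft (sliceMap α c) (overCell t (s.obj c)))).app W := by
      rw [overComp_map_left, hj, overComp_pull₂_right, ← overComp_assoc, sliceArrow,
        overLift_overComp_cart, overComp_pull₂_left, overComp_assoc, hf', overComp_pull₂_right,
        ← overComp_assoc, cart_overComp_cart, comp_overComp]
      rw [Category.assoc, Category.assoc, Category.assoc]
      exact congrArg (fun m => (D.pullComp (overProj q c) p).inv.app Z ≫
        D.overComp (D.cart (overProj q c ⋙ p) Z) f ≫ m) ((D.pull₂_app_comp₃ _ _ _ W).trans
        (congrArg (fun β => (D.pull₂ β).app W) h₂))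
    have hr : D.overComp (a.hom ≫ D.overComp (D.cart (sliceMap α c) _)
        (D.sliceArrow f (s.obj c))) (D.cart (pt (s.obj c)) W) =
        (D.pullComp (overProj q c) p).inv.app Z ≫
        D.overComp (D.cart (overProj q c ⋙ p) Z) f ≫
          (D.pull₂ (Functor.whiskerLeft (sliceMap α c) (overCell t (s.obj c)))).app W := by
      rw [comp_overComp, overComp_assoc, sliceArrow, overLift_overComp_cart, overComp_pull₂_right,
        ← overComp_assoc, cart_overComp_cart, comp_overComp]
      rw [Category.assoc]
      exact comp_cancel_middle ((D.pullComp (overProj q c) p).inv.app Z)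
        ((D.pullComp (sliceMap α c) (overProj t (s.obj c))).hom.app Z)
        ((D.pullComp (sliceMap α c) (overProj t (s.obj c))).inv.app Z)
        (Iso.hom_inv_id_app _ _) _
    exact hl.trans hr.symm
  have h₃ : IsUniv (D.pull (toPoint (Shape.over q c)))
      (D.sliceArrow f' c ≫ (D.pull (toPoint (Shape.over q c))).map j.hom) := by
    rw [key]
    exact h₁.precomp_iso a.hom
  exact h₃.of_postcomp_iso

end Exact

end Prederivator

namespace Prederivator

variable {Dia : DiagramDomain.{w}} {D : Prederivator.{w, v, u} Dia}

theorem Final.of_iso {I J : Dia.Shape} {w w' : I ⥤ J} (θ : w ≅ w') (hw : D.Final w) :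
    D.Final w' := by
  intro X T f
  rw [hw X T f, ← D.isUniv_comp_pull₂_iff (Functor.whiskerRight θ.hom (toPoint J))]
  have h₁ : D.overComp (D.cart w X) f ≫
      (D.pull₂ (Functor.whiskerRight θ.hom (toPoint J))).app T =
      (D.pullIso θ).hom.app X ≫ D.overComp (D.cart w' X) f := by
    rw [← overComp_pull₂_left, ← comp_overComp]
    simp [cart, pullIso]
  rw [h₁]
  exact ⟨fun h => h.of_precomp_iso _, fun h => h.precomp_iso _⟩

/-- An exact square with `p` and `q` identities: a fully faithful functor has a fully faithful left
Kan extension. -/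
theorem isIso_of_isUniv_of_fullyFaithful (hD : D.IsDerivator) {J K : Dia.Shape} (t : J ⥤ K)
    [t.Full] [t.Faithful] {Z : D.cat J} {W : D.cat K} {f : Z ⟶ (D.pull t).obj W}
    (hf : IsUniv (D.pull t) f) : IsIso f := by
  let α : 𝟭 J ⋙ t ⟶ 𝟭 J ⋙ t := 𝟙 t
  have hα : ∀ c, D.Final (sliceMap α c) := fun c => by
    have h₁ : (sliceMap α c).Faithful :=
      ⟨fun {y z} g g' h => CostructuredArrow.hom_ext _ _ (congrArg (fun m => m.left) h)⟩
    have h₂ : (sliceMap α c).Full := ⟨fun {y z} g => ⟨CostructuredArrow.homMk g.left (by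
      have h := CostructuredArrow.w g
      apply t.map_injective
      simpa [sliceMap, α] using h), by ext; rfl⟩⟩
    have h₃ : (sliceMap α c).EssSurj := ⟨fun z =>
      ⟨CostructuredArrow.mk (Y := (z.left : J)) (S := 𝟭 J) (t.preimage z.hom),
        ⟨CostructuredArrow.isoMk (Iso.refl _) (by simp [sliceMap, α])⟩⟩⟩
    have h₄ : (sliceMap α c).IsEquivalence := {}
    exact final_of_isRightAdjoint _
  have h₁ : IsUniv (D.pull (𝟭 J)) ((D.pull (𝟭 J)).map f) :=
    isUniv_of_final_sliceMap hD α hα hf (by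
      rw [map_overComp_cart]
      have : D.pull₂ α = 𝟙 _ := D.pull₂_id _
      rw [this]
      simp)
  have h₂ : (D.pull (𝟭 J)).IsEquivalence := by
    rw [D.pull_id]
    infer_instance
  have := h₁.isIso_of_isEquivalence
  exact isIso_of_reflects_iso f (D.pull (𝟭 J))

/-! ### Slices of products and exactness of product squares -/

section Slices

variable {J K A B : Dia.Shape}

/-- The inclusion of `A_{/b}` in the slice of `K × A` over `(k, b)`. -/
def sliceSectR (K : Dia.Shape) (U : A ⥤ B) (k : K) (b : B) :
    Shape.over U b ⥤ Shape.over (timesMap (𝟭 K) U) ((k, b) : K.times B) where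
  obj y := CostructuredArrow.mk (S := timesMap (𝟭 K) U) (T := ((k, b) : K.times B))
    (Y := ((k, y.left) : K.times A)) (Prod.mkHom (𝟙 k) y.hom)
  map g := CostructuredArrow.homMk (Prod.mkHom (𝟙 k) g.left) (by
    refine Prod.ext (Category.id_comp _) (CostructuredArrow.w g))
  map_id y := CostructuredArrow.hom_ext _ _ rfl
  map_comp f g := CostructuredArrow.hom_ext _ _ (Prod.ext (Category.id_comp (𝟙 k)).symm rfl)

/-- The inclusion of `J_{/k}` in the slice of `J × A` over `(k, a)`. -/
def sliceSectL (A : Dia.Shape) (F : J ⥤ K) (k : K) (a : A) :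
    Shape.over F k ⥤ Shape.over (timesMap F (𝟭 A)) ((k, a) : K.times A) where
  obj y := CostructuredArrow.mk (S := timesMap F (𝟭 A)) (T := ((k, a) : K.times A))
    (Y := ((y.left, a) : J.times A)) (Prod.mkHom y.hom (𝟙 a))
  map g := CostructuredArrow.homMk (Prod.mkHom g.left (𝟙 a)) (by
    refine Prod.ext (CostructuredArrow.w g) (Category.id_comp _))
  map_id y := CostructuredArrow.hom_ext _ _ rfl
  map_comp f g := CostructuredArrow.hom_ext _ _ (Prod.ext rfl (Category.id_comp (𝟙 a)).symm)

/-- The slice of the product is the product of K_{/k} and A_{/b}, and the identity of `k` is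
terminal in K_{/k}; the left adjoint is the projection to A_{/b}. -/
instance isRightAdjoint_sliceSectR (U : A ⥤ B) (k : K) (b : B) :
    (sliceSectR K U k b).IsRightAdjoint := by
  refine isRightAdjoint_of_exists_isUniv fun z => ⟨CostructuredArrow.mk (Y := z.left.2) z.hom.2,
    CostructuredArrow.homMk (Prod.mkHom z.hom.1 (𝟙 _)) ?_, fun y h => ?_⟩
  · refine Prod.ext (Category.comp_id _) ?_
    exact (congrArg (· ≫ _) (U.map_id _)).trans (Category.id_comp (X := U.obj z.left.2) _)
  · have hw := CostructuredArrow.w h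
    refine ⟨CostructuredArrow.homMk h.left.2 (congrArg (fun m => m.2) hw), ?_, fun g hg => ?_⟩
    · refine CostructuredArrow.hom_ext _ _ (Prod.ext ?_ (Category.id_comp (X := z.left.2) _))
      have h₁ : h.left.1 ≫ 𝟙 k = z.hom.1 := congrArg (fun m => m.1) hw
      exact (Category.comp_id _).trans (h₁.symm.trans (Category.comp_id _))
    · ext
      have h₁ : 𝟙 _ ≫ g.left = h.left.2 := congrArg (fun m => m.left.2) hg
      exact (Category.id_comp _).symm.trans h₁

instance isRightAdjoint_sliceSectL (F : J ⥤ K) (k : K) (a : A) :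
    (sliceSectL A F k a).IsRightAdjoint := by
  refine isRightAdjoint_of_exists_isUniv fun z => ⟨CostructuredArrow.mk (Y := z.left.1) z.hom.1,
    CostructuredArrow.homMk (Prod.mkHom (𝟙 _) z.hom.2) ?_, fun y h => ?_⟩
  · refine Prod.ext ?_ (Category.comp_id _)
    exact (congrArg (· ≫ _) (F.map_id _)).trans (Category.id_comp (X := F.obj z.left.1) _)
  · have hw := CostructuredArrow.w h
    refine ⟨CostructuredArrow.homMk h.left.1 (congrArg (fun m => m.1) hw), ?_, fun g hg => ?_⟩
    · refine CostructuredArrow.hom_ext _ _ (Prod.ext (Category.id_comp (X := z.left.1) _) ?_)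
      have h₁ : h.left.2 ≫ 𝟙 a = z.hom.2 := congrArg (fun m => m.2) hw
      exact (Category.comp_id _).trans (h₁.symm.trans (Category.comp_id _))
    · ext
      have h₁ : 𝟙 _ ≫ g.left = h.left.1 := congrArg (fun m => m.left.1) hg
      exact (Category.id_comp _).symm.trans h₁

end Slices

section Products

variable {J K A B : Dia.Shape}

/-- The commutative square with sides `F × A` and `K × U`. -/
def timesSquare (F : J ⥤ K) (U : A ⥤ B) :
    timesMap F (𝟭 A) ⋙ timesMap (𝟭 K) U ⟶ timesMap (𝟭 J) U ⋙ timesMap F (𝟭 B) := 𝟙 _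

/-- The transpose of `timesSquare`. -/
def timesSquare' (F : J ⥤ K) (U : A ⥤ B) :
    timesMap (𝟭 J) U ⋙ timesMap F (𝟭 B) ⟶ timesMap F (𝟭 A) ⋙ timesMap (𝟭 K) U := 𝟙 _

/-- Both slices contain A_{/c.2} as a final part, and the slice functor is compatible with the two
inclusions up to isomorphism; so it is final by cancellation. -/
theorem final_sliceMap_timesSquare (F : J ⥤ K) (U : A ⥤ B) (c : J.times B) :
    D.Final (sliceMap (timesSquare F U) c) := by
  refine (final_of_isRightAdjoint (sliceSectR J U c.1 c.2)).of_comp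
    ((final_of_isRightAdjoint (sliceSectR K U (F.obj c.1) c.2)).of_iso ?_)
  refine NatIso.ofComponents (fun y => CostructuredArrow.isoMk (Iso.refl _) ?_) fun {y z} g => ?_
  · refine Prod.ext ?_ ?_
    · change 𝟙 (F.obj c.1) ≫ 𝟙 (F.obj c.1) ≫ F.map (𝟙 c.1) = 𝟙 (F.obj c.1)
      simp
    · change U.map (𝟙 y.left) ≫ 𝟙 (U.obj y.left) ≫ y.hom = y.hom
      simp
  · refine CostructuredArrow.hom_ext _ _ (Prod.ext ?_ ?_)
    · change 𝟙 (F.obj c.1) ≫ 𝟙 (F.obj c.1) = 𝟙 (F.obj c.1) ≫ F.map (𝟙 c.1)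
      simp
    · exact (Category.comp_id g.left).trans (Category.id_comp g.left).symm

/-- The same argument with J_{/c.1} as the common final part. This is Beck–Chevalley for extensions
along F × id, needed to make right Kan extensions compatible with restriction. -/
theorem final_sliceMap_timesSquare' (F : J ⥤ K) (U : A ⥤ B) (c : K.times A) :
    D.Final (sliceMap (timesSquare' F U) c) := by
  refine (final_of_isRightAdjoint (sliceSectL A F c.1 c.2)).of_comp
    ((final_of_isRightAdjoint (sliceSectL B F c.1 (U.obj c.2))).of_iso ?_)
  refine NatIso.ofComponents (fun y => CostructuredArrow.isoMk (Iso.refl _) ?_) fun {y z} g => ?_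
  · refine Prod.ext ?_ ?_
    · change F.map (𝟙 y.left) ≫ 𝟙 (F.obj y.left) ≫ y.hom = y.hom
      simp
    · change 𝟙 (U.obj c.2) ≫ 𝟙 (U.obj c.2) ≫ U.map (𝟙 c.2) = 𝟙 (U.obj c.2)
      simp
  · refine CostructuredArrow.hom_ext _ _ (Prod.ext ?_ ?_)
    · exact (Category.comp_id g.left).trans (Category.id_comp g.left).symm
    · change 𝟙 (U.obj c.2) ≫ 𝟙 (U.obj c.2) = 𝟙 (U.obj c.2) ≫ U.map (𝟙 c.2)
      simp

end Products

section TimesShape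

variable {A C J L : Dia.Shape} {p : A ⥤ J} {t : J ⥤ L} {q : A ⥤ C} {s : C ⥤ L}

/-- The product of a shape `K` with a square. -/
def shapeTimes (K : Dia.Shape) (α : p ⋙ t ⟶ q ⋙ s) :
    timesMap (𝟭 K) p ⋙ timesMap (𝟭 K) t ⟶ timesMap (𝟭 K) q ⋙ timesMap (𝟭 K) s :=
  timesMap₂ (𝟙 (𝟭 K)) α

theorem final_sliceMap_shapeTimes (K : Dia.Shape) (α : p ⋙ t ⟶ q ⋙ s)
    (hα : ∀ c, D.Final (sliceMap α c)) (c : K.times C) :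
    D.Final (sliceMap (shapeTimes K α) c) := by
  refine (final_of_isRightAdjoint (sliceSectR K q c.1 c.2)).of_comp
    (((hα c.2).comp (final_of_isRightAdjoint (sliceSectR K t c.1 (s.obj c.2)))).of_iso ?_)
  refine NatIso.ofComponents (fun y => CostructuredArrow.isoMk (Iso.refl _) ?_) fun {y z} g => ?_
  · refine Prod.ext ?_ ?_
    · change 𝟙 c.1 ≫ 𝟙 c.1 ≫ 𝟙 c.1 = 𝟙 c.1
      simp
    · change t.map (𝟙 (p.obj y.left)) ≫ α.app y.left ≫ s.map y.hom = α.app y.left ≫ s.map y.hom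
      simp
  · refine CostructuredArrow.hom_ext _ _ (Prod.ext ?_ ?_)
    · rfl
    · exact (Category.comp_id (p.map g.left)).trans (Category.id_comp (p.map g.left)).symm

end TimesShape

end Prederivator

namespace Prederivator

variable {Dia : DiagramDomain.{w}} {D : Prederivator.{w, v, u} Dia}

/-! ## Vanishing and pointwise detection -/

/-- Der1 for the empty family: the category over an empty coproduct is equivalent to an empty
product, where all hom-sets are singletons. Any empty shape is isomorphic to that coproduct. -/
theorem subsingleton_hom_of_isEmpty (hD : D.IsDerivator) {E : Dia.Shape} [IsEmpty E]
    (X Y : D.cat E) : Nonempty (X ⟶ Y) ∧ Subsingleton (X ⟶ Y) := by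
  let K : PEmpty.{w + 1} → Dia.Shape := PEmpty.elim
  let S : Dia.Shape := ⟨Σ i, K i, Dia.poset _ inferInstance (fun x => x.1.elim) fun x => x.1.elim⟩
  have hS := hD.der1 PEmpty K S.mem
  let P : D.cat S ⥤ ∀ i : PEmpty.{w + 1}, D.cat (K i) := Functor.pi' fun i =>
    D.pull (K := S) (Sigma.incl (C := fun i => (K i : Type w)) i)
  have hP : P.IsEquivalence := hS
  let F : E ⥤ S := { obj := fun e => isEmptyElim e, map := fun {e} => isEmptyElim e,
                     map_id := fun e => isEmptyElim e, map_comp := fun {e} => isEmptyElim e }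
  let G : S ⥤ E := { obj := fun x => x.1.elim, map := fun {x} => x.1.elim,
                     map_id := fun x => x.1.elim, map_comp := fun {x} => x.1.elim }
  let i : D.pull G ⋙ D.pull F ≅ 𝟭 _ := (D.pullComp F G).symm ≪≫
    D.pullIso (NatIso.ofComponents (fun e => isEmptyElim e) (fun {e} => isEmptyElim e)) ≪≫ D.pullId E
  refine ⟨⟨i.inv.app X ≫ (D.pull F).map (P.preimage fun j => j.elim) ≫ i.hom.app Y⟩, ⟨fun f g => ?_⟩⟩
  have h₁ : (D.pull G).map f = (D.pull G).map g := P.map_injective (funext fun j => j.elim)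
  have h₂ : (D.pull G ⋙ D.pull F).map f = (D.pull G ⋙ D.pull F).map g :=
    congrArg (D.pull F).map h₁
  exact (NatIso.naturality_1 i f).symm.trans
    ((congrArg (fun m => i.inv.app X ≫ m ≫ i.hom.app Y) h₂).trans (NatIso.naturality_1 i g))

theorem exists_isZero (hD : D.IsDerivator) (hpt : D.IsPointed) (K : Dia.Shape) :
    ∃ Z : D.cat K, IsZero Z := by
  obtain ⟨Z, hZ⟩ := hpt
  exact ⟨_, pull_isZero hD (toPoint K) hZ⟩

theorem isZero_of_pt (hD : D.IsDerivator) (hpt : D.IsPointed) {K : Dia.Shape} {X : D.cat K}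
    (hX : ∀ k : K, IsZero ((D.pull (pt k)).obj X)) : IsZero X := by
  obtain ⟨Z, hZ⟩ := exists_isZero hD hpt K
  have : IsIso (hZ.to_ X) := (hD.der2 _).2 fun k =>
    (pull_isZero hD (pt k) hZ).isIso (hX k) _
  exact hZ.of_iso (asIso (hZ.to_ X)).symm

/-- An initial object is isomorphic to the zero object that pointedness provides. -/
theorem isZero_of_hom_to (hD : D.IsDerivator) (hpt : D.IsPointed) {K : Dia.Shape} {X : D.cat K}
    (hX : ∀ Y, Nonempty (X ⟶ Y) ∧ Subsingleton (X ⟶ Y)) : IsZero X := by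
  obtain ⟨Z, hZ⟩ := exists_isZero hD hpt K
  obtain ⟨a⟩ := (hX Z).1
  have := (hX X).2
  exact hZ.of_iso ⟨a, hZ.to_ X, Subsingleton.elim _ _, hZ.eq_of_src _ _⟩

theorem isZero_of_hom_from (hD : D.IsDerivator) (hpt : D.IsPointed) {K : Dia.Shape} {X : D.cat K}
    (hX : ∀ Y, Nonempty (Y ⟶ X) ∧ Subsingleton (Y ⟶ X)) : IsZero X := by
  obtain ⟨Z, hZ⟩ := exists_isZero hD hpt K
  obtain ⟨a⟩ := (hX Z).1
  have := (hX X).2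
  exact hZ.of_iso ⟨hZ.from_ X, a, Subsingleton.elim _ _, hZ.eq_of_src _ _⟩

/-- A left Kan extension along `t` vanishes where no object of the image of `t` maps to. -/
theorem isZero_of_isUniv (hD : D.IsDerivator) (hpt : D.IsPointed) {I J K : Dia.Shape} {t : J ⥤ K}
    {g : I ⥤ K} (h : ∀ j i, IsEmpty (t.obj j ⟶ g.obj i)) {Z : D.cat J} {W : D.cat K}
    {f : Z ⟶ (D.pull t).obj W} (hf : IsUniv (D.pull t) f) : IsZero ((D.pull g).obj W) := by
  refine isZero_of_pt hD hpt fun i => ?_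
  have : IsEmpty (Shape.over t (g.obj i)) := ⟨fun y => (h _ i).false (CostructuredArrow.hom y)⟩
  have hs := isUniv_sliceArrow hD hf (g.obj i)
  -- The value is a colimit over an empty slice, hence initial.
  have hz : IsZero ((D.pull (pt (g.obj i))).obj W) := isZero_of_hom_to hD hpt fun T => by
    obtain ⟨⟨a⟩, -⟩ := subsingleton_hom_of_isEmpty hD ((D.pull (overProj t (g.obj i))).obj Z)
      ((D.pull (toPoint (Shape.over t (g.obj i)))).obj T)
    have hsub := fun X Y => (subsingleton_hom_of_isEmpty hD (E := Shape.over t (g.obj i)) X Y).2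
    exact ⟨⟨hs.desc a⟩, ⟨fun b b' => hs.hom_ext ((hsub _ _).elim _ _)⟩⟩
  exact hz.of_iso ((D.pullComp (pt i) g).symm.app W ≪≫ (D.pullIso (ptComp g i)).app W)

/-- A right Kan extension along `t` vanishes where no object maps to the image of `t`. -/
theorem isZero_of_isCouniv (hD : D.IsDerivator) (hpt : D.IsPointed) {I J K : Dia.Shape} {t : J ⥤ K}
    {g : I ⥤ K} (h : ∀ i j, IsEmpty (g.obj i ⟶ t.obj j)) {Z : D.cat J} {W : D.cat K}
    {f : (D.pull t).obj W ⟶ Z} (hf : IsCouniv (D.pull t) f) : IsZero ((D.pull g).obj W) := by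
  have := hD.der3_left g
  refine isZero_of_hom_from hD hpt fun T => ?_
  -- Maps T ⟶ g^* t_* Z correspond to maps t^* g_! T ⟶ Z, and t^* g_! T is zero by the previous
  -- lemma with `g` and `t` exchanged.
  obtain ⟨W', e, he⟩ := exists_isUniv (D.pull g) T
  have hz := isZero_of_isUniv hD hpt h he
  refine ⟨⟨e ≫ (D.pull g).map (hf.lift (hz.to_ Z))⟩, ⟨fun a b => ?_⟩⟩
  rw [← he.fac a, ← he.fac b]
  congr 2
  exact hf.hom_ext (hz.eq_of_src _ _)

/-- Every object of the category over `J` is, up to isomorphism, a restriction t^* t_! Z, so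
couniversality of `f` tests against all objects: `f` is monic and has a section. -/
theorem isIso_of_isCouniv_of_fullyFaithful (hD : D.IsDerivator) {J K : Dia.Shape} (t : J ⥤ K)
    [t.Full] [t.Faithful] {Z : D.cat J} {W : D.cat K} {f : (D.pull t).obj W ⟶ Z}
    (hf : IsCouniv (D.pull t) f) : IsIso f := by
  have := hD.der3_left t
  obtain ⟨W', e, he⟩ := exists_isUniv (D.pull t) Z
  have := isIso_of_isUniv_of_fullyFaithful hD t he
  obtain ⟨g, hg⟩ : ∃ g, (D.pull t).map g ≫ f = inv e := ⟨hf.lift (inv e), hf.fac _⟩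
  have hinj : ∀ {Y : D.cat J} (a b : Y ⟶ (D.pull t).obj W), a ≫ f = b ≫ f → a = b := by
    intro Y a b hab
    obtain ⟨Y', y, hy⟩ := exists_isUniv (D.pull t) Y
    rw [← hy.fac a, ← hy.fac b] at hab ⊢
    have := isIso_of_isUniv_of_fullyFaithful hD t hy
    rw [Category.assoc, Category.assoc, cancel_epi] at hab
    rw [hf.hom_ext hab]
  refine ⟨e ≫ (D.pull t).map g, hinj _ _ ?_, ?_⟩
  · simp [hg]
  · simp [hg]

theorem isZero_of_slot (hD : D.IsDerivator) (hpt : D.IsPointed) {K B : Dia.Shape}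
    {X : D.cat (K.times B)} (hX : ∀ b : B, IsZero ((D.pull (slot K b)).obj X)) : IsZero X := by
  refine isZero_of_pt hD hpt fun k => ?_
  exact (pull_isZero hD (pt k.1) (hX k.2)).of_iso
    (((D.pullComp (pt k.1) (slot K k.2)).symm ≪≫ D.pullIso (ptComp (slot K k.2) k.1)).symm.app X)

end Prederivator

namespace Prederivator

variable {Dia : DiagramDomain.{w}}

/-! ## The category of morphisms of prederivators -/

section Modifications

variable {D : Prederivator.{w, v, u} Dia} {E : Prederivator.{w, v', u'} Dia}
  {E' : Prederivator.{w, v'', u''} Dia}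

theorem Modification.ext' {Φ Ψ : Hom D E} {ρ σ : Modification Φ Ψ}
    (h : ∀ K X, (ρ.app K).app X = (σ.app K).app X) : ρ = σ := by
  cases ρ
  cases σ
  congr
  ext K X
  exact h K X

instance : Category (Hom D E) where
  Hom Φ Ψ := Modification Φ Ψ
  id Φ := { app := fun K => 𝟙 _, naturality := by simp }
  comp ρ σ :=
    { app := fun K => ρ.app K ≫ σ.app K
      naturality := fun F X => by
        rw [NatTrans.comp_app, Functor.map_comp, Category.assoc, σ.naturality, ← Category.assoc,
          ρ.naturality, Category.assoc, NatTrans.comp_app] }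
  id_comp ρ := Modification.ext' fun K X => Category.id_comp _
  comp_id ρ := Modification.ext' fun K X => Category.comp_id _
  assoc ρ σ τ := Modification.ext' fun K X => Category.assoc _ _ _

/-- A modification whose components are isomorphisms is an isomorphism. -/
noncomputable def Hom.isoOfIsIso {Φ Ψ : Hom D E} (ρ : Φ ⟶ Ψ)
    (h : ∀ K X, IsIso ((ρ.app K).app X)) : Φ ≅ Ψ where
  hom := ρ
  inv :=
    { app := fun K => @inv _ _ _ _ (ρ.app K) (NatIso.isIso_of_isIso_app _)
      naturality := fun {J K} F X => by
        have hn := ρ.naturality F X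
        have := h K X
        have := h J ((D.pull F).obj X)
        simp only [NatIso.isIso_inv_app, Functor.map_inv]
        rw [IsIso.inv_comp_eq, ← Category.assoc, hn, Category.assoc, IsIso.hom_inv_id,
          Category.comp_id] }
  hom_inv_id := Modification.ext' fun K X => by
    have := fun K => NatIso.isIso_of_isIso_app (ρ.app K)
    exact (NatTrans.comp_app _ _ _).symm.trans (congrArg (fun m => m.app X) (IsIso.hom_inv_id (ρ.app K)))
  inv_hom_id := Modification.ext' fun K X => by
    have := fun K => NatIso.isIso_of_isIso_app (ρ.app K)
    exact (NatTrans.comp_app _ _ _).symm.trans (congrArg (fun m => m.app X) (IsIso.inv_hom_id (ρ.app K)))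

theorem Hom.isIso_app {Φ Ψ : Hom D E} (i : Φ ≅ Ψ) (K : Dia.Shape) : IsIso (i.hom.app K) :=
  ⟨i.inv.app K, by
    ext X
    exact congrArg (fun m : Φ ⟶ Φ => (Modification.app m K).app X) i.hom_inv_id, by
    ext X
    exact congrArg (fun m : Ψ ⟶ Ψ => (Modification.app m K).app X) i.inv_hom_id⟩

theorem Hom.isIso_app_app {Φ Ψ : Hom D E} (i : Φ ≅ Ψ) (K : Dia.Shape) (X : D.cat K) :
    IsIso ((i.hom.app K).app X) := by
  have := Hom.isIso_app i K
  infer_instance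

theorem Hom.isIsomorphic_of_iso {Φ Ψ : Hom D E} (i : Φ ≅ Ψ) : Φ.IsIsomorphic Ψ :=
  ⟨i.hom, Hom.isIso_app i⟩

/-- The value at `X` of an isomorphism of morphisms. -/
noncomputable def Hom.isoApp {Φ Ψ : Hom D E} (i : Φ ≅ Ψ) {K : Dia.Shape} (X : D.cat K) :
    (Φ.app K).obj X ≅ (Ψ.app K).obj X :=
  @asIso _ _ _ _ ((i.hom.app K).app X) (Hom.isIso_app_app i K X)

theorem Hom.comp_nat_app (Φ : Hom D E) (Ψ : Hom E E') {J K : Dia.Shape} (F : J ⥤ K) (X : D.cat K) :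
    ((Φ.comp Ψ).nat F).hom.app X =
      (Ψ.nat F).hom.app ((Φ.app K).obj X) ≫ (Ψ.app J).map ((Φ.nat F).hom.app X) := by
  simp [Hom.comp]

theorem Hom.id_nat_app (D : Prederivator.{w, v, u} Dia) {J K : Dia.Shape} (F : J ⥤ K)
    (X : D.cat K) : ((Hom.id D).nat F).hom.app X = 𝟙 _ := by
  simp [Hom.id]

/-- Whiskering of a modification on the left. -/
def Hom.whiskerLeft (Φ : Hom D E) {Ψ Ψ' : Hom E E'} (ρ : Ψ ⟶ Ψ') : Φ.comp Ψ ⟶ Φ.comp Ψ' where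
  app K := Functor.whiskerLeft (Φ.app K) (ρ.app K)
  naturality {J K} F X := by
    have h₁ := ρ.naturality F ((Φ.app K).obj X)
    have h₂ : (Ψ.app J).map ((Φ.nat F).hom.app X) ≫ (ρ.app J).app ((Φ.app J).obj _) =
      (ρ.app J).app _ ≫ (Ψ'.app J).map ((Φ.nat F).hom.app X) :=
      (ρ.app J).naturality ((Φ.nat F).hom.app X)
    have key : (E'.pull F).map ((ρ.app K).app ((Φ.app K).obj X)) ≫
        (Ψ'.nat F).hom.app ((Φ.app K).obj X) ≫ (Ψ'.app J).map ((Φ.nat F).hom.app X) =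
        ((Ψ.nat F).hom.app ((Φ.app K).obj X) ≫ (Ψ.app J).map ((Φ.nat F).hom.app X)) ≫
          (ρ.app J).app ((Φ.app J).obj ((D.pull F).obj X)) := by
      rw [Category.assoc, h₂, ← Category.assoc, h₁, Category.assoc]
      rfl
    exact (congrArg (_ ≫ ·) (Hom.comp_nat_app Φ Ψ' F X)).trans
      (key.trans (congrArg (· ≫ _) (Hom.comp_nat_app Φ Ψ F X)).symm)

/-- Whiskering of a modification on the right. -/
def Hom.whiskerRight {Φ Φ' : Hom D E} (ρ : Φ ⟶ Φ') (Ψ : Hom E E') : Φ.comp Ψ ⟶ Φ'.comp Ψ where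
  app K := Functor.whiskerRight (ρ.app K) (Ψ.app K)
  naturality {J K} F X := by
    have h₁ := ρ.naturality F X
    have h₂ := (Ψ.nat F).hom.naturality ((ρ.app K).app X)
    rw [Functor.comp_map, Functor.comp_map] at h₂
    have key : (E'.pull F).map ((Ψ.app K).map ((ρ.app K).app X)) ≫
        (Ψ.nat F).hom.app ((Φ'.app K).obj X) ≫ (Ψ.app J).map ((Φ'.nat F).hom.app X) =
        ((Ψ.nat F).hom.app ((Φ.app K).obj X) ≫ (Ψ.app J).map ((Φ.nat F).hom.app X)) ≫
          (Ψ.app J).map ((ρ.app J).app ((D.pull F).obj X)) := by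
      rw [Category.assoc, ← Functor.map_comp, ← h₁, Functor.map_comp, ← Category.assoc, h₂,
        Category.assoc]
    exact (congrArg (_ ≫ ·) (Hom.comp_nat_app Φ' Ψ F X)).trans
      (key.trans (congrArg (· ≫ _) (Hom.comp_nat_app Φ Ψ F X)).symm)

/-- Whiskering of an isomorphism on the left. -/
def Hom.isoWhiskerLeft (Φ : Hom D E) {Ψ Ψ' : Hom E E'} (i : Ψ ≅ Ψ') : Φ.comp Ψ ≅ Φ.comp Ψ' where
  hom := Φ.whiskerLeft i.hom
  inv := Φ.whiskerLeft i.inv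
  hom_inv_id := Modification.ext' fun K X =>
    congrArg (fun m : Ψ ⟶ Ψ => (Modification.app m K).app ((Φ.app K).obj X)) i.hom_inv_id
  inv_hom_id := Modification.ext' fun K X =>
    congrArg (fun m : Ψ' ⟶ Ψ' => (Modification.app m K).app ((Φ.app K).obj X)) i.inv_hom_id

/-- Whiskering of an isomorphism on the right. -/
def Hom.isoWhiskerRight {Φ Φ' : Hom D E} (i : Φ ≅ Φ') (Ψ : Hom E E') : Φ.comp Ψ ≅ Φ'.comp Ψ where
  hom := Hom.whiskerRight i.hom Ψ
  inv := Hom.whiskerRight i.inv Ψ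
  hom_inv_id := Modification.ext' fun K X => ((Ψ.app K).map_comp _ _).symm.trans
    ((congrArg (fun m : Φ ⟶ Φ => (Ψ.app K).map ((Modification.app m K).app X)) i.hom_inv_id).trans
      ((Ψ.app K).map_id _))
  inv_hom_id := Modification.ext' fun K X => ((Ψ.app K).map_comp _ _).symm.trans
    ((congrArg (fun m : Φ' ⟶ Φ' => (Ψ.app K).map ((Modification.app m K).app X)) i.inv_hom_id).trans
      ((Ψ.app K).map_id _))

/-- Two morphisms with the same underlying functors and structure isomorphisms are isomorphic. -/
def Hom.isoOfEq {Φ Ψ : Hom D E} (i : ∀ K, Φ.app K ≅ Ψ.app K)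
    (h : ∀ {J K : Dia.Shape} (F : J ⥤ K) (X : D.cat K),
      (E.pull F).map ((i K).hom.app X) ≫ (Ψ.nat F).hom.app X =
      (Φ.nat F).hom.app X ≫ (i J).hom.app ((D.pull F).obj X)) : Φ ≅ Ψ where
  hom := { app := fun K => (i K).hom, naturality := h }
  inv :=
    { app := fun K => (i K).inv
      naturality := fun {J K} F X => by
        have h₁ := h F X
        have h₂ := (E.pull F).mapIso ((i K).app X)
        rw [← cancel_epi ((E.pull F).map ((i K).hom.app X)), ← Category.assoc, ← Functor.map_comp,
          Iso.hom_inv_id_app, ← Category.assoc, h₁, Category.assoc, Iso.hom_inv_id_app]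
        simp }
  hom_inv_id := Modification.ext' fun K X => (i K).hom_inv_id_app X
  inv_hom_id := Modification.ext' fun K X => (i K).inv_hom_id_app X

/-- Composition of morphisms is associative. -/
def Hom.assoc {D₀ : Prederivator.{w, v, u} Dia} {D₁ : Prederivator.{w, v', u'} Dia}
    {D₂ : Prederivator.{w, v'', u''} Dia} {D₃ : Prederivator.{w, v, u} Dia} (Φ : Hom D₀ D₁)
    (Ψ : Hom D₁ D₂) (Θ : Hom D₂ D₃) : (Φ.comp Ψ).comp Θ ≅ Φ.comp (Ψ.comp Θ) :=
  Hom.isoOfEq (fun K => Functor.associator _ _ _) fun F X => by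
    simp [Hom.comp_nat_app]
    simp [Hom.comp]

/-- The identity is a left unit. -/
def Hom.idComp (Φ : Hom D E) : (Hom.id D).comp Φ ≅ Φ :=
  Hom.isoOfEq (fun K => Functor.leftUnitor _) fun F X => by
    rw [Hom.comp_nat_app, Hom.id_nat_app]
    simp [Hom.comp, Hom.id]

/-- The identity is a right unit. -/
def Hom.compId (Φ : Hom D E) : Φ.comp (Hom.id E) ≅ Φ :=
  Hom.isoOfEq (fun K => Functor.rightUnitor _) fun F X => by
    rw [Hom.comp_nat_app, Hom.id_nat_app]
    simp [Hom.comp, Hom.id]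

end Modifications

/-! ## Adjunctions of morphisms -/

section Adjunctions

variable {D : Prederivator.{w, v, u} Dia} {E : Prederivator.{w, v', u'} Dia}
  {E' : Prederivator.{w, v'', u''} Dia}

/-- The adjunction of functors at a shape. -/
def Hom.Adjunction.pointwise {Φ : Hom D E} {Ψ : Hom E D} (adj : Hom.Adjunction Φ Ψ)
    (K : Dia.Shape) : Φ.app K ⊣ Ψ.app K where
  unit := adj.unit.app K
  counit := adj.counit.app K
  left_triangle_components X := adj.left_triangle K X
  right_triangle_components Y := adj.right_triangle K Y

theorem Hom.Adjunction.isUniv_unit {Φ : Hom D E} {Ψ : Hom E D} (adj : Hom.Adjunction Φ Ψ)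
    (K : Dia.Shape) (X : D.cat K) : IsUniv (Ψ.app K) ((adj.unit.app K).app X) :=
  _root_.isUniv_unit (adj.pointwise K) X

theorem Hom.Adjunction.isCouniv_counit {Φ : Hom D E} {Ψ : Hom E D} (adj : Hom.Adjunction Φ Ψ)
    (K : Dia.Shape) (X : E.cat K) : IsCouniv (Φ.app K) ((adj.counit.app K).app X) :=
  _root_.isCouniv_counit (adj.pointwise K) X

theorem Hom.unit_naturality {Φ : Hom D E} {Ψ : Hom E D} (η : Hom.id D ⟶ Φ.comp Ψ)
    {J K : Dia.Shape} (F : J ⥤ K) (X : D.cat K) :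
    (D.pull F).map ((η.app K).app X) ≫ (Ψ.nat F).hom.app ((Φ.app K).obj X) ≫
      (Ψ.app J).map ((Φ.nat F).hom.app X) = (η.app J).app ((D.pull F).obj X) := by
  have h := η.naturality F X
  rw [Hom.comp_nat_app, Hom.id_nat_app] at h
  exact h.trans (Category.id_comp _)

theorem Hom.counit_naturality {Φ : Hom D E} {Ψ : Hom E D} (ε : Ψ.comp Φ ⟶ Hom.id E)
    {J K : Dia.Shape} (F : J ⥤ K) (Y : E.cat K) :
    (Φ.nat F).hom.app ((Ψ.app K).obj Y) ≫ (Φ.app J).map ((Ψ.nat F).hom.app Y) ≫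
      (ε.app J).app ((E.pull F).obj Y) = (E.pull F).map ((ε.app K).app Y) := by
  have h := ε.naturality F Y
  rw [Hom.comp_nat_app, Hom.id_nat_app] at h
  exact (Category.assoc _ _ _).symm.trans (h.symm.trans (Category.comp_id _))

theorem comp_middle₃ {C : Type*} [Category C] {X₁ X₂ X₃ X₄ X₅ X₆ : C} {a : X₁ ⟶ X₂} {b : X₂ ⟶ X₃}
    {c : X₃ ⟶ X₄} {d : X₄ ⟶ X₅} {e : X₂ ⟶ X₅} {k : X₅ ⟶ X₆} (h : b ≫ c ≫ d = e) :
    a ≫ b ≫ c ≫ d ≫ k = (a ≫ e) ≫ k := by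
  simp [← h]

section Constructors

variable {Φ : Hom D E} {Ψ : Hom E D}

/-- The modification `𝟭 ⟶ Ψ Φ` with given components. -/
def Hom.mkUnit (η : ∀ (K : Dia.Shape) (X : D.cat K), X ⟶ (Ψ.app K).obj ((Φ.app K).obj X))
    (hη : ∀ (K : Dia.Shape) {X Y : D.cat K} (f : X ⟶ Y),
      f ≫ η K Y = η K X ≫ (Ψ.app K).map ((Φ.app K).map f))
    (hnat : ∀ (J K : Dia.Shape) (F : J ⥤ K) (X : D.cat K),
      (D.pull F).map (η K X) ≫ (Ψ.nat F).hom.app ((Φ.app K).obj X) ≫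
        (Ψ.app J).map ((Φ.nat F).hom.app X) = η J ((D.pull F).obj X)) :
    Hom.id D ⟶ Φ.comp Ψ where
  app K := ⟨η K, fun _ _ f => hη K f⟩
  naturality F X := (congrArg (_ ≫ ·) (Hom.comp_nat_app Φ Ψ F X)).trans
    ((hnat _ _ F X).trans ((Category.id_comp _).symm.trans
      (congrArg (· ≫ _) (Hom.id_nat_app D F X).symm)))

/-- The modification `Φ Ψ ⟶ 𝟭` with given components. -/
def Hom.mkCounit (ε : ∀ (K : Dia.Shape) (Y : E.cat K), (Φ.app K).obj ((Ψ.app K).obj Y) ⟶ Y)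
    (hε : ∀ (K : Dia.Shape) {X Y : E.cat K} (f : X ⟶ Y),
      (Φ.app K).map ((Ψ.app K).map f) ≫ ε K Y = ε K X ≫ f)
    (hnat : ∀ (J K : Dia.Shape) (F : J ⥤ K) (Y : E.cat K),
      (Φ.nat F).hom.app ((Ψ.app K).obj Y) ≫ (Φ.app J).map ((Ψ.nat F).hom.app Y) ≫
        ε J ((E.pull F).obj Y) = (E.pull F).map (ε K Y)) :
    Ψ.comp Φ ⟶ Hom.id E where
  app K := ⟨ε K, fun _ _ f => hε K f⟩
  naturality F Y := (congrArg (_ ≫ ·) (Hom.id_nat_app E F Y)).trans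
    ((Category.comp_id _).trans ((hnat _ _ F Y).symm.trans ((Category.assoc _ _ _).symm.trans
      (congrArg (· ≫ _) (Hom.comp_nat_app Ψ Φ F Y).symm))))

/-- The counit is the factorization of the identity through the universal unit. Its naturality, the
modification axiom and the remaining triangle identity are equalities of arrows out of universal
ones, hence can be tested after composition with `η`. -/
theorem Hom.isLeftAdjointTo_of_unit_of_isUniv
    (η : ∀ (K : Dia.Shape) (X : D.cat K), X ⟶ (Ψ.app K).obj ((Φ.app K).obj X))
    (hη : ∀ (K : Dia.Shape) {X Y : D.cat K} (f : X ⟶ Y),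
      f ≫ η K Y = η K X ≫ (Ψ.app K).map ((Φ.app K).map f))
    (hnat : ∀ {J K : Dia.Shape} (F : J ⥤ K) (X : D.cat K),
      (D.pull F).map (η K X) ≫ (Ψ.nat F).hom.app ((Φ.app K).obj X) ≫
        (Ψ.app J).map ((Φ.nat F).hom.app X) = η J ((D.pull F).obj X))
    (h : ∀ K X, IsUniv (Ψ.app K) (η K X)) : Φ.IsLeftAdjointTo Ψ := by
  let ε : ∀ (K : Dia.Shape) (Y : E.cat K), (Φ.app K).obj ((Ψ.app K).obj Y) ⟶ Y :=
    fun K Y => (h K ((Ψ.app K).obj Y)).desc (𝟙 _)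
  have hfac : ∀ K Y, η K ((Ψ.app K).obj Y) ≫ (Ψ.app K).map (ε K Y) = 𝟙 _ :=
    fun K Y => (h K _).fac _
  refine ⟨Hom.mkUnit η hη @hnat, Hom.mkCounit ε (fun K X Y f => (h K _).hom_ext ?_)
    fun J K F Y => ?_, fun K X => (h K X).hom_ext ?_, fun K Y => hfac K Y⟩
  · rw [Functor.map_comp, Functor.map_comp, ← Category.assoc, ← Category.assoc, hfac, ← hη,
      Category.assoc, hfac, Category.comp_id, Category.id_comp]
  · have h₁ := hnat F ((Ψ.app K).obj Y)
    have h₂ := (Ψ.nat F).hom.naturality (ε K Y)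
    rw [Functor.comp_map, Functor.comp_map] at h₂
    have h₃ : η J ((D.pull F).obj ((Ψ.app K).obj Y)) ≫
        (Ψ.app J).map ((Φ.nat F).inv.app ((Ψ.app K).obj Y)) =
        (D.pull F).map (η K _) ≫ (Ψ.nat F).hom.app _ := by
      have h₅ : (Ψ.app J).map ((Φ.nat F).hom.app ((Ψ.app K).obj Y)) ≫
          (Ψ.app J).map ((Φ.nat F).inv.app ((Ψ.app K).obj Y)) = 𝟙 _ := by
        rw [← Functor.map_comp, Iso.hom_inv_id_app, (Ψ.app J).map_id]
      rw [← h₁, Category.assoc, Category.assoc]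
      exact (congrArg (fun m => _ ≫ _ ≫ m) h₅).trans (congrArg (_ ≫ ·) (Category.comp_id _))
    have h₄ : (Φ.app J).map ((Ψ.nat F).hom.app Y) ≫ ε J ((E.pull F).obj Y) =
        (Φ.nat F).inv.app ((Ψ.app K).obj Y) ≫ (E.pull F).map (ε K Y) := by
      refine (h J _).hom_ext ?_
      have h₅ : η J ((D.pull F).obj ((Ψ.app K).obj Y)) ≫ (Ψ.app J).map
          ((Φ.app J).map ((Ψ.nat F).hom.app Y) ≫ ε J ((E.pull F).obj Y)) =
          (Ψ.nat F).hom.app Y := by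
        rw [Functor.map_comp, ← Category.assoc, ← hη, Category.assoc]
        exact (congrArg (_ ≫ ·) (hfac J ((E.pull F).obj Y))).trans (Category.comp_id _)
      have h₆ : (D.pull F).map (η K ((Ψ.app K).obj Y)) ≫
          (D.pull F).map ((Ψ.app K).map (ε K Y)) = 𝟙 _ := by
        rw [← Functor.map_comp, hfac, (D.pull F).map_id]
      refine h₅.trans (Eq.symm ?_)
      rw [(Ψ.app J).map_comp]
      refine (Category.assoc _ _ _).symm.trans ((congrArg (· ≫ _) h₃).trans ?_)
      rw [Category.assoc, ← h₂, ← Category.assoc, h₆]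
      exact Category.id_comp _
    rw [h₄, Iso.hom_inv_id_app_assoc]
  · change η K X ≫ (Ψ.app K).map ((Φ.app K).map (η K X) ≫ ε K ((Φ.app K).obj X)) =
      η K X ≫ (Ψ.app K).map (𝟙 _)
    rw [Functor.map_comp, ← Category.assoc, ← hη, Category.assoc, hfac, Category.comp_id,
      (Ψ.app K).map_id, Category.comp_id]

theorem Hom.isLeftAdjointTo_of_counit_of_isCouniv
    (ε : ∀ (K : Dia.Shape) (Y : E.cat K), (Φ.app K).obj ((Ψ.app K).obj Y) ⟶ Y)
    (hε : ∀ (K : Dia.Shape) {X Y : E.cat K} (f : X ⟶ Y),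
      (Φ.app K).map ((Ψ.app K).map f) ≫ ε K Y = ε K X ≫ f)
    (hnat : ∀ {J K : Dia.Shape} (F : J ⥤ K) (Y : E.cat K),
      (Φ.nat F).hom.app ((Ψ.app K).obj Y) ≫ (Φ.app J).map ((Ψ.nat F).hom.app Y) ≫
        ε J ((E.pull F).obj Y) = (E.pull F).map (ε K Y))
    (h : ∀ K Y, IsCouniv (Φ.app K) (ε K Y)) : Φ.IsLeftAdjointTo Ψ := by
  let η : ∀ (K : Dia.Shape) (X : D.cat K), X ⟶ (Ψ.app K).obj ((Φ.app K).obj X) :=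
    fun K X => (h K ((Φ.app K).obj X)).lift (𝟙 _)
  have hfac : ∀ K X, (Φ.app K).map (η K X) ≫ ε K ((Φ.app K).obj X) = 𝟙 _ :=
    fun K Y => (h K _).fac _
  refine ⟨Hom.mkUnit η (fun K X Y f => (h K _).hom_ext ?_) fun J K F X => (h J _).hom_ext ?_,
    Hom.mkCounit ε hε @hnat, fun K X => hfac K X, fun K Y => (h K Y).hom_ext ?_⟩
  · rw [Functor.map_comp, Functor.map_comp, Category.assoc, Category.assoc, hfac, hε,
      ← Category.assoc, hfac, Category.comp_id, Category.id_comp]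
  · have h₂ := (Φ.nat F).hom.naturality (η K X)
    rw [Functor.comp_map, Functor.comp_map] at h₂
    have h₁ := hnat F ((Φ.app K).obj X)
    refine Eq.trans ?_ (hfac J ((D.pull F).obj X)).symm
    rw [← cancel_epi ((Φ.nat F).hom.app X), (Φ.app J).map_comp, (Φ.app J).map_comp,
      Category.assoc, Category.assoc, ← reassoc_of% h₂]
    refine (congrArg (fun m => _ ≫ _ ≫ _ ≫ m) (hε J ((Φ.nat F).hom.app X))).trans ?_
    refine (comp_middle₃ h₁).trans ((congrArg (· ≫ _) ?_).trans
      ((Category.id_comp ((Φ.nat F).hom.app X)).trans (Category.comp_id _).symm))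
    exact ((E.pull F).map_comp _ _).symm.trans
      ((congrArg (E.pull F).map (hfac K X)).trans ((E.pull F).map_id _))
  · change (Φ.app K).map (η K ((Ψ.app K).obj Y) ≫ (Ψ.app K).map (ε K Y)) ≫ ε K Y =
      (Φ.app K).map (𝟙 _) ≫ ε K Y
    rw [Functor.map_comp, Category.assoc, hε, ← Category.assoc, hfac, Category.id_comp,
      (Φ.app K).map_id, Category.id_comp]

end Constructors

/-- A modification with universal components is the unit of an adjunction. -/
theorem Hom.isLeftAdjointTo_of_isUniv {Φ : Hom D E} {Ψ : Hom E D} (η : Hom.id D ⟶ Φ.comp Ψ)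
    (h : ∀ K X, IsUniv (Ψ.app K) ((η.app K).app X)) : Φ.IsLeftAdjointTo Ψ :=
  Hom.isLeftAdjointTo_of_unit_of_isUniv (fun K X => (η.app K).app X)
    (fun K _ _ f => (η.app K).naturality f) (Hom.unit_naturality η) h

/-- A modification with couniversal components is the counit of an adjunction. -/
theorem Hom.isLeftAdjointTo_of_isCouniv {Φ : Hom D E} {Ψ : Hom E D} (ε : Ψ.comp Φ ⟶ Hom.id E)
    (h : ∀ K Y, IsCouniv (Φ.app K) ((ε.app K).app Y)) : Φ.IsLeftAdjointTo Ψ :=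
  Hom.isLeftAdjointTo_of_counit_of_isCouniv (fun K X => (ε.app K).app X)
    (fun K _ _ f => (ε.app K).naturality f) (Hom.counit_naturality ε) h

/-- A morphism whose components have left adjoints that are compatible with restriction has a left
adjoint. -/
theorem Hom.exists_leftAdjoint (Ψ : Hom E D) (h₁ : ∀ K, (Ψ.app K).IsRightAdjoint)
    (h₂ : ∀ {J K : Dia.Shape} (F : J ⥤ K) {X : D.cat K} {Y : E.cat K} (f : X ⟶ (Ψ.app K).obj Y),
      IsUniv (Ψ.app K) f →
        IsUniv (Ψ.app J) ((D.pull F).map f ≫ (Ψ.nat F).hom.app Y)) :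
    ∃ Φ : Hom D E, Φ.IsLeftAdjointTo Ψ := by
  let P : ∀ K, D.cat K ⥤ E.cat K := fun K => (Ψ.app K).leftAdjoint
  let adj : ∀ K, P K ⊣ Ψ.app K := fun K => Adjunction.ofIsRightAdjoint (Ψ.app K)
  let η : ∀ K (X : D.cat K), X ⟶ (Ψ.app K).obj ((P K).obj X) := fun K X => (adj K).unit.app X
  have hu : ∀ K X, IsUniv (Ψ.app K) (η K X) := fun K X => isUniv_unit (adj K) X
  have hη : ∀ (K : Dia.Shape) {X Y : D.cat K} (f : X ⟶ Y),
      f ≫ η K Y = η K X ≫ (Ψ.app K).map ((P K).map f) := fun K X Y f => (adj K).unit.naturality f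
  have hF : ∀ {J K : Dia.Shape} (F : J ⥤ K) (X : D.cat K), IsUniv (Ψ.app J)
      ((D.pull F).map (η K X) ≫ (Ψ.nat F).hom.app ((P K).obj X)) := fun F X => h₂ F _ (hu _ X)
  -- The structure isomorphism of the left adjoint is the mate: the comparison between two universal
  -- arrows out of F^* X, one restricted from `K` (universal by `h₂`) and one formed over `J`.
  let n : ∀ {J K : Dia.Shape} (F : J ⥤ K) (X : D.cat K),
      (E.pull F).obj ((P K).obj X) ⟶ (P J).obj ((D.pull F).obj X) :=
    fun {J K} F X => (hF F X).desc (η J ((D.pull F).obj X))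
  have hn : ∀ {J K : Dia.Shape} (F : J ⥤ K) (X : D.cat K), (D.pull F).map (η K X) ≫
      (Ψ.nat F).hom.app ((P K).obj X) ≫ (Ψ.app J).map (n F X) = η J ((D.pull F).obj X) :=
    fun {J K} F X => (Category.assoc _ _ _).symm.trans ((hF F X).fac _)
  have hiso : ∀ {J K : Dia.Shape} (F : J ⥤ K) (X : D.cat K), IsIso (n F X) :=
    fun {J K} F X => (hF F X).isIso_of_fac (hu J _) ((hF F X).fac _)
  have hnn : ∀ {J K : Dia.Shape} (F : J ⥤ K) {X Y : D.cat K} (f : X ⟶ Y),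
      (E.pull F).map ((P K).map f) ≫ n F Y = n F X ≫ (P J).map ((D.pull F).map f) := by
    intro J K F X Y f
    refine (hF F X).hom_ext ?_
    have h₃ := (Ψ.nat F).hom.naturality ((P K).map f)
    rw [Functor.comp_map, Functor.comp_map] at h₃
    rw [Functor.map_comp, Functor.map_comp, Category.assoc, ← reassoc_of% h₃, Category.assoc,
      reassoc_of% (hn F X), ← hη, ← hn F Y, ← Category.assoc, ← Functor.map_comp, ← hη,
      Functor.map_comp, Category.assoc]
  -- Each coherence law is an equality of arrows out of a universal one and reduces to the
  -- corresponding law of `Ψ`.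
  let Φ : Hom D E :=
    { app := P
      nat := fun {J K} F => NatIso.ofComponents (fun X => @asIso _ _ _ _ (n F X) (hiso F X))
        fun f => hnn F f
      nat_id := fun K X => (hF (𝟭 K) X).hom_ext (by
        have h₃ := Ψ.nat_id K ((P K).obj X)
        have h₄ := (D.pullId K).hom.naturality (η K X)
        change _ ≫ (Ψ.app K).map (n (𝟭 K) X ≫ (P K).map ((D.pullId K).hom.app X)) = _
        rw [Functor.map_comp, Category.assoc, reassoc_of% (hn (𝟭 K) X), ← hη, Category.assoc]
        exact h₄.symm.trans (congrArg (_ ≫ ·) h₃.symm))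
      nat_comp := fun {I J K} F G X => (hF (F ⋙ G) X).hom_ext (by
        have h₃ := Ψ.nat_comp F G ((P K).obj X)
        have h₄ := (D.pullComp F G).hom.naturality (η K X)
        have h₅ := (Ψ.nat F).hom.naturality (n G X)
        rw [Functor.comp_map] at h₄ h₅
        change _ ≫ (Ψ.app I).map (n (F ⋙ G) X ≫ (P I).map ((D.pullComp F G).hom.app X)) =
          _ ≫ (Ψ.app I).map ((E.pullComp F G).hom.app ((P K).obj X) ≫ (E.pull F).map (n G X) ≫
            n F ((D.pull G).obj X))
        rw [Functor.map_comp, Functor.map_comp, Functor.map_comp, Category.assoc,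
          reassoc_of% (hn (F ⋙ G) X), ← hη, Category.assoc, reassoc_of% h₃]
        rw [Functor.comp_map] at h₅
        have h₆ : (D.pull F).map ((D.pull G).map (η K X) ≫ (Ψ.nat G).hom.app ((P K).obj X) ≫
            (Ψ.app J).map (n G X)) ≫ (Ψ.nat F).hom.app ((P J).obj ((D.pull G).obj X)) ≫
            (Ψ.app I).map (n F ((D.pull G).obj X)) = η I ((D.pull F).obj ((D.pull G).obj X)) := by
          rw [hn G, hn F]
        rw [← reassoc_of% h₅, reassoc_of% h₄]
        simp only [Functor.map_comp, Category.assoc] at h₆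
        exact congrArg (_ ≫ ·) h₆.symm)
      nat_naturality := fun {J K F G} α X => (hF F X).hom_ext (by
        have h₃ := Ψ.nat_naturality α ((P K).obj X)
        have h₄ := (D.pull₂ α).naturality (η K X)
        change _ ≫ (Ψ.app J).map (n F X ≫ (P J).map ((D.pull₂ α).app X)) =
          _ ≫ (Ψ.app J).map ((E.pull₂ α).app ((P K).obj X) ≫ n G X)
        rw [Functor.map_comp, Functor.map_comp, Category.assoc, reassoc_of% (hn F X), ← hη,
          Category.assoc, reassoc_of% h₃, reassoc_of% h₄, hn G X]) }
  exact ⟨Φ, Hom.isLeftAdjointTo_of_unit_of_isUniv η hη (fun F X => hn F X) hu⟩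

/-- A morphism whose components have right adjoints that are compatible with restriction has a
right adjoint. -/
theorem Hom.exists_rightAdjoint (Φ : Hom D E) (h₁ : ∀ K, (Φ.app K).IsLeftAdjoint)
    (h₂ : ∀ {J K : Dia.Shape} (F : J ⥤ K) {X : E.cat K} {Y : D.cat K} (f : (Φ.app K).obj Y ⟶ X),
      IsCouniv (Φ.app K) f →
        IsCouniv (Φ.app J) ((Φ.nat F).inv.app Y ≫ (E.pull F).map f)) :
    ∃ Ψ : Hom E D, Φ.IsLeftAdjointTo Ψ := by
  let P : ∀ K, E.cat K ⥤ D.cat K := fun K => (Φ.app K).rightAdjoint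
  let adj : ∀ K, Φ.app K ⊣ P K := fun K => Adjunction.ofIsLeftAdjoint (Φ.app K)
  let ε : ∀ K (X : E.cat K), (Φ.app K).obj ((P K).obj X) ⟶ X := fun K X => (adj K).counit.app X
  have hu : ∀ K X, IsCouniv (Φ.app K) (ε K X) := fun K X => isCouniv_counit (adj K) X
  have hε : ∀ (K : Dia.Shape) {X Y : E.cat K} (f : X ⟶ Y),
      (Φ.app K).map ((P K).map f) ≫ ε K Y = ε K X ≫ f := fun K X Y f => (adj K).counit.naturality f
  have hF : ∀ {J K : Dia.Shape} (F : J ⥤ K) (X : E.cat K), IsCouniv (Φ.app J)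
      ((Φ.nat F).inv.app ((P K).obj X) ≫ (E.pull F).map (ε K X)) := fun F X => h₂ F _ (hu _ X)
  let n : ∀ {J K : Dia.Shape} (F : J ⥤ K) (X : E.cat K),
      (D.pull F).obj ((P K).obj X) ⟶ (P J).obj ((E.pull F).obj X) :=
    fun {J K} F X => (hu J _).lift ((Φ.nat F).inv.app ((P K).obj X) ≫ (E.pull F).map (ε K X))
  have hn : ∀ {J K : Dia.Shape} (F : J ⥤ K) (X : E.cat K), (Φ.nat F).hom.app ((P K).obj X) ≫
      (Φ.app J).map (n F X) ≫ ε J ((E.pull F).obj X) = (E.pull F).map (ε K X) := by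
    intro J K F X
    have : (Φ.app J).map (n F X) ≫ ε J ((E.pull F).obj X) = _ := (hu J _).fac _
    rw [this, Iso.hom_inv_id_app_assoc]
  have hiso : ∀ {J K : Dia.Shape} (F : J ⥤ K) (X : E.cat K), IsIso (n F X) := by
    intro J K F X
    have h₃ : (Φ.app J).map (n F X) ≫ ε J ((E.pull F).obj X) = _ := (hu J _).fac _
    refine ⟨(hF F X).lift (ε J _), (hF F X).hom_ext ?_, (hu J _).hom_ext ?_⟩
    · rw [Functor.map_comp, Category.assoc, (hF F X).fac, h₃, (Φ.app J).map_id]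
      exact (Category.id_comp _).symm
    · rw [Functor.map_comp, Category.assoc, h₃, (hF F X).fac, (Φ.app J).map_id, Category.id_comp]
  -- Couniversality tested after the isomorphism `Φ.nat F`, so that the checks below use the form
  -- `hn` without inverses.
  have hext : ∀ {J K : Dia.Shape} (F : J ⥤ K) {X : D.cat K} {Z : E.cat J}
      {f g : (D.pull F).obj X ⟶ (P J).obj Z}
      (_ : (Φ.nat F).hom.app X ≫ (Φ.app J).map f ≫ ε J Z =
        (Φ.nat F).hom.app X ≫ (Φ.app J).map g ≫ ε J Z), f = g :=
    fun {J K} F {X Z f g} h => (hu J _).hom_ext ((cancel_epi _).1 h)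
  have hnn : ∀ {J K : Dia.Shape} (F : J ⥤ K) {X Y : E.cat K} (f : X ⟶ Y),
      (D.pull F).map ((P K).map f) ≫ n F Y = n F X ≫ (P J).map ((E.pull F).map f) := by
    intro J K F X Y f
    refine hext F ?_
    have h₃ := (Φ.nat F).hom.naturality ((P K).map f)
    rw [Functor.comp_map, Functor.comp_map] at h₃
    rw [Functor.map_comp, Functor.map_comp, Category.assoc, Category.assoc, ← reassoc_of% h₃,
      hn F Y, hε, reassoc_of% (hn F X), ← Functor.map_comp, hε, Functor.map_comp]
  let Ψ : Hom E D :=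
    { app := P
      nat := fun {J K} F => NatIso.ofComponents (fun X => @asIso _ _ _ _ (n F X) (hiso F X))
        fun f => hnn F f
      nat_id := fun K X => hext (𝟭 K) (by
        have h₃ := Φ.nat_id K ((P K).obj X)
        have h₄ := (E.pullId K).hom.naturality (ε K X)
        change _ ≫ (Φ.app K).map (n (𝟭 K) X ≫ (P K).map ((E.pullId K).hom.app X)) ≫ _ = _
        rw [Functor.map_comp, Category.assoc, hε, reassoc_of% (hn (𝟭 K) X), reassoc_of% h₃]
        exact h₄)
      nat_comp := fun {I J K} F G X => hext (F ⋙ G) (by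
        have h₃ := Φ.nat_comp F G ((P K).obj X)
        have h₄ := (E.pullComp F G).hom.naturality (ε K X)
        have h₅ := (Φ.nat F).hom.naturality (n G X)
        rw [Functor.comp_map] at h₄ h₅
        change _ ≫ (Φ.app I).map (n (F ⋙ G) X ≫ (P I).map ((E.pullComp F G).hom.app X)) ≫ _ =
          _ ≫ (Φ.app I).map ((D.pullComp F G).hom.app ((P K).obj X) ≫ (D.pull F).map (n G X) ≫
            n F ((E.pull G).obj X)) ≫ _
        rw [Functor.comp_map] at h₅
        simp only [Functor.map_comp, Category.assoc]
        rw [hε, reassoc_of% (hn (F ⋙ G) X), reassoc_of% h₃, ← reassoc_of% h₅]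
        have h₆ : (E.pull F).map ((Φ.nat G).hom.app ((P K).obj X) ≫ (Φ.app J).map (n G X) ≫
            ε J ((E.pull G).obj X)) = (E.pull F).map ((E.pull G).map (ε K X)) := by
          rw [hn G]
        rw [Functor.map_comp, Functor.map_comp, ← hn F] at h₆
        exact h₄.trans (congrArg (_ ≫ ·) h₆.symm))
      nat_naturality := fun {J K F G} α X => hext F (by
        have h₃ := Φ.nat_naturality α ((P K).obj X)
        have h₄ := (E.pull₂ α).naturality (ε K X)
        change _ ≫ (Φ.app J).map (n F X ≫ (P J).map ((E.pull₂ α).app X)) ≫ _ =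
          _ ≫ (Φ.app J).map ((D.pull₂ α).app ((P K).obj X) ≫ n G X) ≫ _
        rw [Functor.map_comp, Functor.map_comp, Category.assoc, Category.assoc, hε,
          reassoc_of% (hn F X), reassoc_of% h₃, hn G X, h₄]) }
  exact ⟨Ψ, Hom.isLeftAdjointTo_of_counit_of_isCouniv ε hε (fun F X => hn F X) hu⟩

end Adjunctions

end Prederivator

namespace Prederivator

variable {Dia : DiagramDomain.{w}}

section Adjunctions

variable {D : Prederivator.{w, v, u} Dia} {E : Prederivator.{w, v', u'} Dia}
  {E' : Prederivator.{w, v'', u''} Dia}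

/-- The pasting computation for the unit of a composite adjunction, with all structure maps
abstracted. -/
theorem comp_unit_naturality_aux {C₁ C₂ C₃ : Type*} [Category C₁] [Category C₂] [Category C₃]
    (P₁ : C₂ ⥤ C₁) (P₂ : C₃ ⥤ C₂) {X X₁ X₂ : C₁} {Y Y₁ Y₂ : C₂} {Z₁ Z₂ Z₃ : C₃} {a : X ⟶ X₁}
    {b : X₁ ⟶ P₁.obj Y} {c : Y ⟶ Y₁} {d : X ⟶ P₁.obj Y₁} (h₁ : a ≫ b ≫ P₁.map c = d)
    {e : Y ⟶ Y₂} {f : Y₂ ⟶ P₂.obj Z₁} {g : Z₁ ⟶ Z₂} {k : Y ⟶ P₂.obj Z₂}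
    (h₂ : e ≫ f ≫ P₂.map g = k) {l : Y₁ ⟶ P₂.obj Z₃} {m : Z₂ ⟶ Z₃}
    (h₃ : c ≫ l = k ≫ P₂.map m) {e' : X₁ ⟶ X₂} {b' : X₂ ⟶ P₁.obj Y₂}
    (h₄ : e' ≫ b' = b ≫ P₁.map e) {q : X ⟶ X₂} (h₅ : q = a ≫ e') :
    q ≫ (b' ≫ P₁.map f) ≫ P₁.map (P₂.map (g ≫ m)) = d ≫ P₁.map l := by
  calc _ = a ≫ (e' ≫ b') ≫ P₁.map (f ≫ P₂.map g ≫ P₂.map m) := by simp [h₅]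
    _ = a ≫ b ≫ P₁.map ((e ≫ f ≫ P₂.map g) ≫ P₂.map m) := by rw [h₄]; simp
    _ = d ≫ P₁.map l := by rw [h₂, ← h₃, ← h₁]; simp

theorem Hom.IsLeftAdjointTo.comp {Φ₁ : Hom D E} {Ψ₁ : Hom E D} {Φ₂ : Hom E E'} {Ψ₂ : Hom E' E}
    (h₁ : Φ₁.IsLeftAdjointTo Ψ₁) (h₂ : Φ₂.IsLeftAdjointTo Ψ₂) :
    (Φ₁.comp Φ₂).IsLeftAdjointTo (Ψ₂.comp Ψ₁) := by
  obtain ⟨a₁⟩ := h₁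
  obtain ⟨a₂⟩ := h₂
  refine Hom.isLeftAdjointTo_of_unit_of_isUniv (Φ := Φ₁.comp Φ₂) (Ψ := Ψ₂.comp Ψ₁)
    (fun K X => (a₁.pointwise K).unit.app X ≫
      (Ψ₁.app K).map ((a₂.pointwise K).unit.app ((Φ₁.app K).obj X)))
    (fun K X Y f => ?_) ?_
    fun K X => (a₁.isUniv_unit K X).comp (a₂.isUniv_unit K ((Φ₁.app K).obj X))
  · have h := ((a₁.pointwise K).comp (a₂.pointwise K)).unit.naturality f
    simp only [Adjunction.comp_unit_app] at h
    exact h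
  · intro J K F X
    have h₁ : (D.pull F).map ((a₁.pointwise K).unit.app X) ≫
        (Ψ₁.nat F).hom.app ((Φ₁.app K).obj X) ≫ (Ψ₁.app J).map ((Φ₁.nat F).hom.app X) =
        (a₁.pointwise J).unit.app ((D.pull F).obj X) := Hom.unit_naturality a₁.unit F X
    have h₂ : (E.pull F).map ((a₂.pointwise K).unit.app ((Φ₁.app K).obj X)) ≫
        (Ψ₂.nat F).hom.app ((Φ₂.app K).obj ((Φ₁.app K).obj X)) ≫
        (Ψ₂.app J).map ((Φ₂.nat F).hom.app ((Φ₁.app K).obj X)) =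
        (a₂.pointwise J).unit.app ((E.pull F).obj ((Φ₁.app K).obj X)) :=
      Hom.unit_naturality a₂.unit F ((Φ₁.app K).obj X)
    have h₃ : (Φ₁.nat F).hom.app X ≫ (a₂.pointwise J).unit.app ((Φ₁.app J).obj _) =
      (a₂.pointwise J).unit.app ((E.pull F).obj ((Φ₁.app K).obj X)) ≫
      (Ψ₂.app J).map ((Φ₂.app J).map ((Φ₁.nat F).hom.app X)) :=
      (a₂.pointwise J).unit.naturality ((Φ₁.nat F).hom.app X)
    have h₄ := (Ψ₁.nat F).hom.naturality ((a₂.pointwise K).unit.app ((Φ₁.app K).obj X))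
    rw [Functor.comp_map, Functor.comp_map] at h₄
    rw [Hom.comp_nat_app, Hom.comp_nat_app]
    exact comp_unit_naturality_aux (Ψ₁.app J) (Ψ₂.app J) h₁ h₂ h₃ h₄
      (Functor.map_comp _ _ _)

/-- Transport of the unit along an isomorphism preserves universality, so no counit has to be
transported. -/
theorem Hom.IsLeftAdjointTo.of_iso_right {Φ : Hom D E} {Ψ Ψ' : Hom E D}
    (h : Φ.IsLeftAdjointTo Ψ) (i : Ψ ≅ Ψ') : Φ.IsLeftAdjointTo Ψ' := by
  obtain ⟨a⟩ := h
  refine Hom.isLeftAdjointTo_of_isUniv (a.unit ≫ Φ.whiskerLeft i.hom) fun K X => ?_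
  have := Hom.isIso_app i K
  exact (a.isUniv_unit K X).of_natTrans (i.hom.app K)

theorem Hom.IsLeftAdjointTo.of_iso_left {Φ Φ' : Hom D E} {Ψ : Hom E D}
    (h : Φ.IsLeftAdjointTo Ψ) (i : Φ ≅ Φ') : Φ'.IsLeftAdjointTo Ψ := by
  obtain ⟨a⟩ := h
  refine Hom.isLeftAdjointTo_of_isUniv (a.unit ≫ Hom.whiskerRight i.hom Ψ) fun K X => ?_
  have := Hom.isIso_app_app i K X
  exact (a.isUniv_unit K X).postcomp_iso ((i.hom.app K).app X)

end Adjunctions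

/-! ## Kan extensions as morphisms -/

section KanExtensions

variable {D : Prederivator.{w, v, u} Dia}

theorem pull₂_eqToHom (D : Prederivator.{w, v, u} Dia) {J K : Dia.Shape} {F G : J ⥤ K}
    (h : F = G) : D.pull₂ (eqToHom h) = eqToHom (congrArg D.pull h) := by
  subst h
  exact D.pull₂_id F

theorem map_comp_eqToHom_overComp_cart {A C J K : Dia.Shape} {p : A ⥤ J} {t : J ⥤ K} {q : A ⥤ C}
    {s : C ⥤ K} (h : p ⋙ t = q ⋙ s) {Z : D.cat J} {W : D.cat K} (f : Z ⟶ (D.pull t).obj W) :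
    D.overComp ((D.pull p).map f ≫ (eqToHom (D.pull_square h)).app W) (D.cart s W) =
      D.overComp (D.cart p Z) f ≫ (D.pull₂ (eqToHom h)).app W := by
  rw [pull₂_eqToHom]
  simp [overComp, cart, pullComp]

theorem isUniv_map_comp_eqToHom (hD : D.IsDerivator) {A C J K : Dia.Shape} {p : A ⥤ J} {t : J ⥤ K}
    {q : A ⥤ C} {s : C ⥤ K} (h : p ⋙ t = q ⋙ s)
    (hα : ∀ c, D.Final (sliceMap (eqToHom h) c)) {Z : D.cat J} {W : D.cat K}
    {f : Z ⟶ (D.pull t).obj W} (hf : IsUniv (D.pull t) f) :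
    IsUniv (D.pull q) ((D.pull p).map f ≫ (eqToHom (D.pull_square h)).app W) :=
  isUniv_of_final_sliceMap hD (eqToHom h) hα hf (map_comp_eqToHom_overComp_cart h f)

/-- Der3 gives the extensions for each `K`; exactness of the product of `F` with `U` makes them
compatible with restriction along `F`. -/
theorem exists_lan (hD : D.IsDerivator) {A B : Dia.Shape} (U : A ⥤ B) :
    ∃ l : Hom (D.shift A) (D.shift B), l.IsLeftAdjointTo (D.res U) :=
  Hom.exists_leftAdjoint _ (fun _ => hD.der3_left _) fun F _ _ _ hf =>
    isUniv_map_comp_eqToHom hD (timesMap_square F U) (final_sliceMap_timesSquare F U) hf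

/-- Passage to adjoints: if F'_! is left adjoint to `F'`, then by `key` maps U Y' ⟶ F X are maps U'
F'_! Y' ⟶ X, hence maps F'_! Y' ⟶ Y, hence maps Y' ⟶ F' Y. Thus a Beck–Chevalley property of left
Kan extensions yields one of right Kan extensions. -/
theorem isCouniv_of_isUniv {C₁ C₂ C₃ C₄ : Type*} [Category C₁] [Category C₂] [Category C₃]
    [Category C₄] {U : C₂ ⥤ C₁} {U' : C₄ ⥤ C₃} {F : C₃ ⥤ C₁} {F' : C₄ ⥤ C₂} [F'.IsRightAdjoint]
    (θ : F' ⋙ U ⟶ U' ⋙ F)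
    (key : ∀ (Y' : C₂) (Y'' : C₄) (η : Y' ⟶ F'.obj Y''), IsUniv F' η →
      IsUniv F (U.map η ≫ θ.app Y'')) {X : C₃} {Y : C₄} {f : U'.obj Y ⟶ X} (hf : IsCouniv U' f) :
    IsCouniv U (θ.app Y ≫ F.map f) := by
  have hfac : ∀ {Y' : C₂} {Y'' : C₄} (η : Y' ⟶ F'.obj Y'') (k : Y'' ⟶ Y),
      U.map (η ≫ F'.map k) ≫ θ.app Y ≫ F.map f =
        (U.map η ≫ θ.app Y'') ≫ F.map (U'.map k ≫ f) := by
    intro Y' Y'' η k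
    have h := θ.naturality k
    rw [Functor.comp_map, Functor.comp_map] at h
    rw [Functor.map_comp, Functor.map_comp, Category.assoc, Category.assoc, reassoc_of% h]
  intro Y' h
  obtain ⟨Y'', η, hη⟩ := exists_isUniv F' Y'
  refine ⟨η ≫ F'.map (hf.lift ((key _ _ _ hη).desc h)), ?_, fun g hg => ?_⟩
  · exact (hfac η _).trans (by rw [hf.fac, (key _ _ _ hη).fac])
  · rw [← hη.fac g]
    congr 2
    refine hf.hom_ext ((key _ _ _ hη).hom_ext ?_)
    refine (hfac η _).symm.trans ?_
    rw [hη.fac, hf.fac, (key _ _ _ hη).fac, hg]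

theorem exists_ran (hD : D.IsDerivator) {A B : Dia.Shape} (U : A ⥤ B) :
    ∃ r : Hom (D.shift A) (D.shift B), (D.res U).IsLeftAdjointTo r := by
  refine Hom.exists_rightAdjoint _ (fun K => hD.der3_right _) fun {J K} F {X Y} f hf => ?_
  have : ((D.shift B).pull F).IsRightAdjoint := hD.der3_left (timesMap F (𝟭 B))
  exact isCouniv_of_isUniv (F' := (D.shift B).pull F) ((D.res U).nat F).inv
    (fun Y' Y'' η hη => isUniv_map_comp_eqToHom hD (timesMap_square F U).symm
      (final_sliceMap_timesSquare' F U) hη) hf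

theorem pull_isEquivalence (D : Prederivator.{w, v, u} Dia) {J K : Dia.Shape} (F : J ⥤ K)
    [F.IsEquivalence] : (D.pull F).IsEquivalence :=
  (CategoryTheory.Equivalence.mk (D.pull F) (D.pull F.inv)
    ((D.pullId K).symm ≪≫ D.pullIso F.asEquivalence.counitIso.symm ≪≫ D.pullComp F.inv F)
    ((D.pullComp F F.inv).symm ≪≫ D.pullIso F.asEquivalence.unitIso.symm ≪≫
      D.pullId J)).isEquivalence_functor

theorem exists_lan_of_isEquivalence {E E' : Prederivator.{w, v, u} Dia} (Ψ : Hom E E')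
    (h : ∀ K, (Ψ.app K).IsEquivalence) : ∃ l : Hom E' E, l.IsLeftAdjointTo Ψ := by
  refine Hom.exists_leftAdjoint Ψ (fun K => inferInstance) fun {_ _} F {X Y} f hf => ?_
  have := hf.isIso_of_isEquivalence
  exact IsUniv.of_isIso

theorem exists_ran_of_isEquivalence {E E' : Prederivator.{w, v, u} Dia} (Φ : Hom E E')
    (h : ∀ K, (Φ.app K).IsEquivalence) : ∃ r : Hom E' E, Φ.IsLeftAdjointTo r := by
  refine Hom.exists_rightAdjoint Φ (fun K => inferInstance) fun {_ _} F {X Y} f hf => ?_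
  have := hf.isIso_of_isEquivalence
  exact IsCouniv.of_isIso

theorem eqToHom_paste {C₁ C₂ C₃ C₁' C₂' C₃' : Type*} [Category C₁] [Category C₂] [Category C₃]
    [Category C₁'] [Category C₂'] [Category C₃'] {U : C₁ ⥤ C₂} {V : C₂ ⥤ C₃} {W : C₁ ⥤ C₃}
    {U' : C₁' ⥤ C₂'} {V' : C₂' ⥤ C₃'} {W' : C₁' ⥤ C₃'} {F₁ : C₁ ⥤ C₁'} {F₂ : C₂ ⥤ C₂'}
    {F₃ : C₃ ⥤ C₃'} (h : U ⋙ V = W) (h' : U' ⋙ V' = W') (h₁ : U ⋙ F₂ = F₁ ⋙ U')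
    (h₂ : V ⋙ F₃ = F₂ ⋙ V') (h₃ : W ⋙ F₃ = F₁ ⋙ W') (X : C₁) :
    F₃.map ((eqToHom h).app X) ≫ (eqToHom h₃).app X =
      ((eqToHom h₂).app (U.obj X) ≫ V'.map ((eqToHom h₁).app X)) ≫
        (eqToHom h').app (F₁.obj X) := by
  simp [eqToHom_map]

/-- Restriction is functorial. -/
def resComp (D : Prederivator.{w, v, u} Dia) {A A' B : Dia.Shape} (U : A ⥤ B) (U' : A' ⥤ A) :
    (D.res U).comp (D.res U') ≅ D.res (U' ⋙ U) :=
  Hom.isoOfEq (fun K => eqToIso (D.pull_comp (timesMap (𝟭 K) U') (timesMap (𝟭 K) U)).symm)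
    fun {J K} F X => (eqToHom_paste (D.pull_comp (timesMap (𝟭 K) U') (timesMap (𝟭 K) U)).symm
      (D.pull_comp (timesMap (𝟭 J) U') (timesMap (𝟭 J) U)).symm (D.pull_square (timesMap_square F U))
      (D.pull_square (timesMap_square F U')) (D.pull_square (timesMap_square F (U' ⋙ U))) X).trans
      (congrArg (· ≫ _) (Hom.comp_nat_app (D.res U) (D.res U') F X).symm)

theorem slot_comp_timesMap (K : Dia.Shape) {A B : Dia.Shape} (U : A ⥤ B) (a : A) :
    slot K a ⋙ timesMap (𝟭 K) U = slot K (U.obj a) := by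
  refine CategoryTheory.Functor.ext (fun _ => rfl) fun X Y f => ?_
  refine Eq.trans ?_ ((Category.id_comp _).trans (Category.comp_id _)).symm
  exact Prod.ext rfl (U.map_id a)

theorem pull_slot_comp (D : Prederivator.{w, v, u} Dia) (K : Dia.Shape) {A B : Dia.Shape}
    (U : A ⥤ B) (a : A) :
    D.pull (timesMap (𝟭 K) U) ⋙ D.pull (slot K a) = D.pull (slot K (U.obj a)) := by
  rw [← slot_comp_timesMap, D.pull_comp]

/-- Evaluation of a restriction. -/
def resEv (D : Prederivator.{w, v, u} Dia) {A B : Dia.Shape} (U : A ⥤ B) (a : A) :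
    (D.res U).comp (D.ev a) ≅ D.ev (U.obj a) :=
  Hom.isoOfEq (fun K => eqToIso (D.pull_slot_comp K U a)) fun {J K} F X =>
    (eqToHom_paste (D.pull_slot_comp K U a) (D.pull_slot_comp J U a)
      (D.pull_square (timesMap_square F U)) (D.pull_square (slot_square F a))
      (D.pull_square (slot_square F (U.obj a))) X).trans
      (congrArg (· ≫ _) (Hom.comp_nat_app (D.res U) (D.ev a) F X).symm)

theorem timesMap₂_transpose {J K A B : Dia.Shape} (F : J ⥤ K) {U U' : A ⥤ B} (l : U ⟶ U') :
    Functor.whiskerRight (timesMap₂ (𝟙 (𝟭 J)) l) (timesMap F (𝟭 B)) =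
      eqToHom (timesMap_square F U).symm ≫
        Functor.whiskerLeft (timesMap F (𝟭 A)) (timesMap₂ (𝟙 (𝟭 K)) l) ≫
        eqToHom (timesMap_square F U').symm.symm := by
  refine NatTrans.ext (funext fun x => ?_)
  rw [NatTrans.comp_app, NatTrans.comp_app, eqToHom_app, eqToHom_app]
  refine Eq.trans ?_ ((Category.id_comp _).trans (Category.comp_id _)).symm
  exact Prod.ext (F.map_id x.1) rfl

theorem eqToHom_transpose {C C' : Type*} [Category C] [Category C'] {G H G' H' : C ⥤ C'}
    (e₁ : G = G') (e₂ : H = H') {X : C} {m : G.obj X ⟶ H.obj X} {n : G'.obj X ⟶ H'.obj X}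
    (h : (eqToHom e₁.symm).app X ≫ m = n ≫ (eqToHom e₂.symm).app X) :
    m ≫ (eqToHom e₂).app X = (eqToHom e₁).app X ≫ n := by
  subst e₁ e₂
  simpa using h

/-- The modification `U^* ⟶ U'^*` induced by a natural transformation. -/
def res₂ (D : Prederivator.{w, v, u} Dia) {A B : Dia.Shape} {U U' : A ⥤ B} (l : U ⟶ U') :
    D.res U ⟶ D.res U' where
  app K := D.pull₂ (timesMap₂ (𝟙 (𝟭 K)) l)
  naturality {J K} F X := by
    have h := D.square_naturality (timesMap F (𝟭 A)) (timesMap F (𝟭 B))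
      (timesMap₂ (𝟙 (𝟭 J)) l) (timesMap₂ (𝟙 (𝟭 K)) l) (timesMap_square F U).symm
      (timesMap_square F U').symm (timesMap₂_transpose F l) X
    exact eqToHom_transpose (D.pull_square (timesMap_square F U))
      (D.pull_square (timesMap_square F U')) h

instance isEquivalence_slot_point (K : Dia.Shape) (a : Dia.point) :
    (slot K a).IsEquivalence :=
  (CategoryTheory.Equivalence.mk (slot K a) (CategoryTheory.Prod.fst K Dia.point)
    (Iso.refl _) (NatIso.ofComponents (fun _ => Iso.prod (Iso.refl _)
      (eqToIso (Subsingleton.elim (α := Discrete PUnit) _ _))) fun _ => Prod.ext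
        ((Category.comp_id _).trans (Category.id_comp _).symm)
          (Subsingleton.elim (α := _ ⟶ (_ : Discrete PUnit)) _ _))).isEquivalence_functor

/-- Evaluation at `a` is restriction along `pt a` followed by the equivalence of the shift by the
point with `D` itself. -/
theorem exists_lan_ev (hD : D.IsDerivator) {A : Dia.Shape} (a : A) :
    ∃ l : Hom D (D.shift A), l.IsLeftAdjointTo (D.ev a) := by
  obtain ⟨l₁, h₁⟩ := exists_lan hD (pt a)
  obtain ⟨l₂, h₂⟩ := exists_lan_of_isEquivalence (D.ev (A := Dia.point) ⟨⟨⟩⟩)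
    fun K => pull_isEquivalence D (slot K _)
  exact ⟨l₂.comp l₁, (h₂.comp h₁).of_iso_right (resEv D (pt a) _)⟩

theorem exists_ran_ev (hD : D.IsDerivator) {A : Dia.Shape} (a : A) :
    ∃ r : Hom D (D.shift A), (D.ev a).IsLeftAdjointTo r := by
  obtain ⟨l₁, h₁⟩ := exists_ran hD (pt a)
  obtain ⟨l₂, h₂⟩ := exists_ran_of_isEquivalence (D.ev (A := Dia.point) ⟨⟨⟩⟩)
    fun K => pull_isEquivalence D (slot K _)
  exact ⟨l₂.comp l₁, (h₁.comp h₂).of_iso_left (resEv D (pt a) _)⟩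

end KanExtensions

end Prederivator

/-! ## Fully faithful Kan extensions and vanishing -/

namespace DiagramDomain

variable {Dia : DiagramDomain.{w}}

instance full_timesMap (K : Dia.Shape) {A B : Dia.Shape} (U : A ⥤ B) [U.Full] :
    (timesMap (𝟭 K) U).Full where
  map_surjective f := ⟨Prod.mkHom f.1 (U.preimage f.2), Prod.ext rfl (U.map_preimage f.2)⟩

instance faithful_timesMap (K : Dia.Shape) {A B : Dia.Shape} (U : A ⥤ B) [U.Faithful] :
    (timesMap (𝟭 K) U).Faithful where
  map_injective h := Prod.ext (congrArg (fun m => m.1) h)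
    (U.map_injective (congrArg (fun m => m.2) h))

instance full_slot (K : Dia.Shape) {A : Dia.Shape} [Quiver.IsThin A] (a : A) :
    (slot K a).Full where
  map_surjective f := ⟨f.1, Prod.ext rfl (Subsingleton.elim _ _)⟩

instance faithful_slot (K : Dia.Shape) {A : Dia.Shape} (a : A) : (slot K a).Faithful where
  map_injective h := congrArg (fun m => m.1) h

end DiagramDomain

namespace Prederivator

variable {Dia : DiagramDomain.{w}} {D : Prederivator.{w, v, u} Dia}

/-- Der2, with the points of `K` divided into those in the image of `t` and those where source and
target vanish. -/
theorem isIso_of_isIso_pull {J K : Dia.Shape} (t : J ⥤ K) (hD : D.IsDerivator) {X Y : D.cat K} (d : X ⟶ Y)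
    (hd : IsIso ((D.pull t).map d))
    (h : ∀ k, (∃ j, t.obj j = k) ∨
      (IsZero ((D.pull (pt k)).obj X) ∧ IsZero ((D.pull (pt k)).obj Y))) : IsIso d := by
  refine (hD.der2 d).2 fun k => ?_
  obtain ⟨j, rfl⟩ | ⟨h₁, h₂⟩ := h k
  · exact (NatIso.isIso_map_iff ((D.pullComp (pt j) t).symm ≪≫ D.pullIso (ptComp t j)) d).1
      (inferInstanceAs (IsIso ((D.pull (pt j)).map ((D.pull t).map d))))
  · exact h₁.isIso h₂ _

section Pointwise

variable {J K : Dia.Shape} (t : J ⥤ K) [t.Full] [t.Faithful]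

/-- Recognizes objects extended by zero. On the image of `t` the unit is invertible by a triangle
identity, as the counit is invertible for fully faithful `t`; at the other points both sides are
zero. -/
theorem isIso_unit_of_isZero (hD : D.IsDerivator) (hpt : D.IsPointed) {r : D.cat J ⥤ D.cat K}
    (adj : D.pull t ⊣ r) {X : D.cat K} (h : ∀ k, (∃ j, t.obj j = k) ∨
      (IsZero ((D.pull (pt k)).obj X) ∧ ∀ j, IsEmpty (k ⟶ t.obj j))) :
    IsIso (adj.unit.app X) := by
  have hc := isCouniv_counit adj ((D.pull t).obj X)
  have := isIso_of_isCouniv_of_fullyFaithful hD t hc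
  have hi : (D.pull t).map (adj.unit.app X) ≫ adj.counit.app ((D.pull t).obj X) = 𝟙 _ :=
    adj.left_triangle_components X
  have : IsIso ((D.pull t).map (adj.unit.app X) ≫ adj.counit.app ((D.pull t).obj X)) := by
    rw [hi]
    infer_instance
  refine isIso_of_isIso_pull t hD _ (IsIso.of_isIso_comp_right _ (adj.counit.app _)) fun k =>
    (h k).imp_right fun hk => ⟨hk.1, ?_⟩
  exact isZero_of_isCouniv hD hpt (fun _ j => hk.2 j) hc

/-- The dual criterion, for left Kan extensions that extend by zero. -/
theorem isIso_counit_of_isZero (hD : D.IsDerivator) (hpt : D.IsPointed) {l : D.cat J ⥤ D.cat K}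
    (adj : l ⊣ D.pull t) {X : D.cat K} (h : ∀ k, (∃ j, t.obj j = k) ∨
      (IsZero ((D.pull (pt k)).obj X) ∧ ∀ j, IsEmpty (t.obj j ⟶ k))) :
    IsIso (adj.counit.app X) := by
  have hc := isUniv_unit adj ((D.pull t).obj X)
  have := isIso_of_isUniv_of_fullyFaithful hD t hc
  have hi : adj.unit.app ((D.pull t).obj X) ≫ (D.pull t).map (adj.counit.app X) = 𝟙 _ :=
    adj.right_triangle_components X
  have : IsIso (adj.unit.app ((D.pull t).obj X) ≫ (D.pull t).map (adj.counit.app X)) := by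
    rw [hi]
    infer_instance
  refine isIso_of_isIso_pull t hD _ (IsIso.of_isIso_comp_left (adj.unit.app _) _) fun k =>
    (h k).imp_right fun hk => ⟨?_, hk.1⟩
  exact isZero_of_isUniv hD hpt (fun j _ => hk.2 j) hc

end Pointwise

theorem isZero_pt_of_slot (hD : D.IsDerivator) {K B : Dia.Shape} {X : D.cat (K.times B)} (k : K)
    (b : B) (h : IsZero ((D.pull (slot K b)).obj X)) :
    IsZero ((D.pull (pt ((k, b) : K.times B))).obj X) :=
  (pull_isZero hD (pt k) h).of_iso
    (((D.pullComp (pt k) (slot K b)).symm ≪≫ D.pullIso (ptComp (slot K b) k)).symm.app X)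

section Hom

variable {A B : Dia.Shape} {K : Dia.Shape}

theorem isIso_unit_res (hD : D.IsDerivator) (hpt : D.IsPointed) (U : A ⥤ B) [U.Full] [U.Faithful]
    {r : Hom (D.shift A) (D.shift B)} (adj : Hom.Adjunction (D.res U) r) {X : (D.shift B).cat K}
    (h : ∀ b, (∃ a, U.obj a = b) ∨
      (IsZero (((D.ev b).app K).obj X) ∧ ∀ a, IsEmpty (b ⟶ U.obj a))) :
    IsIso ((adj.unit.app K).app X) := by
  refine isIso_unit_of_isZero (timesMap (𝟭 K) U) hD hpt (adj.pointwise K) fun k => ?_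
  obtain ⟨a, ha⟩ | ⟨h₁, h₂⟩ := h k.2
  · exact Or.inl ⟨(k.1, a), Prod.ext rfl ha⟩
  · exact Or.inr ⟨isZero_pt_of_slot hD k.1 k.2 h₁, fun j => ⟨fun f => (h₂ j.2).false f.2⟩⟩

theorem isIso_counit_res (hD : D.IsDerivator) (hpt : D.IsPointed) (U : A ⥤ B) [U.Full]
    [U.Faithful] {l : Hom (D.shift A) (D.shift B)} (adj : Hom.Adjunction l (D.res U))
    {X : (D.shift B).cat K} (h : ∀ b, (∃ a, U.obj a = b) ∨
      (IsZero (((D.ev b).app K).obj X) ∧ ∀ a, IsEmpty (U.obj a ⟶ b))) :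
    IsIso ((adj.counit.app K).app X) := by
  refine isIso_counit_of_isZero (timesMap (𝟭 K) U) hD hpt (adj.pointwise K) fun k => ?_
  obtain ⟨a, ha⟩ | ⟨h₁, h₂⟩ := h k.2
  · exact Or.inl ⟨(k.1, a), Prod.ext rfl ha⟩
  · exact Or.inr ⟨isZero_pt_of_slot hD k.1 k.2 h₁, fun j => ⟨fun f => (h₂ j.2).false f.2⟩⟩

theorem isIso_unit_ev (hD : D.IsDerivator) (hpt : D.IsPointed) [Quiver.IsThin B] (b₀ : B)
    {r : Hom D (D.shift B)} (adj : Hom.Adjunction (D.ev b₀) r) {X : (D.shift B).cat K}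
    (h : ∀ b, b₀ = b ∨ (IsZero (((D.ev b).app K).obj X) ∧ IsEmpty (b ⟶ b₀))) :
    IsIso ((adj.unit.app K).app X) := by
  refine isIso_unit_of_isZero (slot K b₀) hD hpt (adj.pointwise K) fun k => ?_
  obtain ha | ⟨h₁, h₂⟩ := h k.2
  · exact Or.inl ⟨k.1, Prod.ext rfl ha⟩
  · exact Or.inr ⟨isZero_pt_of_slot hD k.1 k.2 h₁, fun j => ⟨fun f => h₂.false f.2⟩⟩

theorem isZero_ev_of_lan (hD : D.IsDerivator) (hpt : D.IsPointed) {U : A ⥤ B}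
    {l : Hom (D.shift A) (D.shift B)} (h : l.IsLeftAdjointTo (D.res U)) {b : B}
    (hb : ∀ a, IsEmpty (U.obj a ⟶ b)) (X : (D.shift A).cat K) :
    IsZero (((D.ev b).app K).obj ((l.app K).obj X)) := by
  obtain ⟨adj⟩ := h
  exact isZero_of_isUniv hD hpt (t := timesMap (𝟭 K) U) (g := slot K b)
    (fun j _ => ⟨fun f => (hb j.2).false f.2⟩) (adj.isUniv_unit K X)

theorem isZero_ev_of_ran (hD : D.IsDerivator) (hpt : D.IsPointed) {U : A ⥤ B}
    {r : Hom (D.shift A) (D.shift B)} (h : (D.res U).IsLeftAdjointTo r) {b : B}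
    (hb : ∀ a, IsEmpty (b ⟶ U.obj a)) (X : (D.shift A).cat K) :
    IsZero (((D.ev b).app K).obj ((r.app K).obj X)) := by
  obtain ⟨adj⟩ := h
  exact isZero_of_isCouniv hD hpt (t := timesMap (𝟭 K) U) (g := slot K b)
    (fun _ j => ⟨fun f => (hb j.2).false f.2⟩) (adj.isCouniv_counit K X)

theorem isZero_ev_of_lan_ev (hD : D.IsDerivator) (hpt : D.IsPointed) {b₀ : B}
    {l : Hom D (D.shift B)} (h : l.IsLeftAdjointTo (D.ev b₀)) {b : B}
    (hb : IsEmpty (b₀ ⟶ b)) (X : D.cat K) :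
    IsZero (((D.ev b).app K).obj ((l.app K).obj X)) := by
  obtain ⟨adj⟩ := h
  exact isZero_of_isUniv hD hpt (t := slot K b₀) (g := slot K b)
    (fun _ _ => ⟨fun f => hb.false f.2⟩) (adj.isUniv_unit K X)

theorem isIso_unit_lan (hD : D.IsDerivator) (U : A ⥤ B) [U.Full] [U.Faithful]
    {l : Hom (D.shift A) (D.shift B)} (adj : Hom.Adjunction l (D.res U)) (K : Dia.Shape)
    (X : (D.shift A).cat K) : IsIso ((adj.unit.app K).app X) :=
  isIso_of_isUniv_of_fullyFaithful hD (timesMap (𝟭 K) U) (adj.isUniv_unit K X)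

theorem isIso_unit_lan_ev (hD : D.IsDerivator) [Quiver.IsThin B] (b : B)
    {l : Hom D (D.shift B)} (adj : Hom.Adjunction l (D.ev b)) (K : Dia.Shape)
    (X : D.cat K) : IsIso ((adj.unit.app K).app X) :=
  isIso_of_isUniv_of_fullyFaithful hD (slot K b) (adj.isUniv_unit K X)

theorem isIso_counit_ran (hD : D.IsDerivator) (U : A ⥤ B) [U.Full] [U.Faithful]
    {r : Hom (D.shift A) (D.shift B)} (adj : Hom.Adjunction (D.res U) r) (K : Dia.Shape)
    (X : (D.shift A).cat K) : IsIso ((adj.counit.app K).app X) :=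
  isIso_of_isCouniv_of_fullyFaithful hD (timesMap (𝟭 K) U) (adj.isCouniv_counit K X)

end Hom

end Prederivator

/-! ## The right adjoint of an extension by zero -/

section Couniversal

variable {C₁ C₂ C₃ : Type*} [Category C₁] [Category C₂] [Category C₃]

theorem IsUniv.comp_of_isIso {G : C₁ ⥤ C₂} {Y : C₁} (h : IsUniv G (𝟙 (G.obj Y))) {X X' : C₂}
    {f : X ⟶ X'} {m : X' ⟶ G.obj Y} (hf : IsIso f) (hm : IsIso m) : IsUniv G (f ≫ m) := by
  have := h.precomp_iso (f ≫ m)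
  rwa [Category.comp_id] at this

theorem isCouniv_of_existsUnique {G : C₁ ⥤ C₂} [G.Full] [G.Faithful] {X : C₁} {Y Y₁ Y₂ : C₂}
    {a : G.obj X ⟶ Y₁} (ha : IsIso a) {m : Y₁ ⟶ Y₂} {b : Y₂ ⟶ Y} (hb : IsIso b)
    (h : ∀ (X' : C₁) (h : G.obj X' ⟶ Y₂), ∃! g : G.obj X' ⟶ Y₁, g ≫ m = h) :
    IsCouniv G (a ≫ m ≫ b) := by
  intro X' k
  obtain ⟨g, hg, hg'⟩ := h X' (k ≫ inv b)
  refine ⟨G.preimage (g ≫ inv a), ?_, fun y hy => G.map_injective ?_⟩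
  · simp [reassoc_of% hg]
  · have := hg' (G.map y ≫ a) (by simp [← hy])
    simp [← this]

/-- Maps Z ⟶ L V are maps Z' ⟶ V, hence maps F Z' ⟶ W by couniversality of `c`, hence maps Z ⟶ G W
by universality of `f ≫ μ`. On the cylinder, `L`, `F`, `G` are l^*, k^*, j^*. -/
theorem existsUnique_of_isUniv_of_isCouniv {L : C₁ ⥤ C₃} {F : C₁ ⥤ C₂} {G : C₂ ⥤ C₃}
    (μ : L ⟶ F ⋙ G) {Z : C₃} {Z' V : C₁} {W : C₂} {f : Z ⟶ L.obj Z'} (hf : IsUniv L f)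
    (hm : IsUniv G (f ≫ μ.app Z')) {c : F.obj V ⟶ W} (hc : IsCouniv F c) (h : Z ⟶ G.obj W) :
    ∃! g : Z ⟶ L.obj V, g ≫ μ.app V ≫ G.map c = h := by
  have key : ∀ g : Z' ⟶ V, (f ≫ L.map g) ≫ μ.app V ≫ G.map c =
      (f ≫ μ.app Z') ≫ G.map (F.map g ≫ c) := by
    intro g
    have hn := μ.naturality g
    rw [Functor.comp_map] at hn
    rw [Category.assoc, reassoc_of% hn, G.map_comp, Category.assoc]
  refine ⟨f ≫ L.map (hc.lift (hm.desc h)), ?_, fun g hg => ?_⟩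
  · exact (key _).trans (by rw [hc.fac, hm.fac])
  · rw [← hf.fac g]
    congr 2
    refine hc.hom_ext (hm.hom_ext ?_)
    rw [← key, hf.fac, hc.fac, hm.fac, hg]

end Couniversal

namespace DiagramDomain

variable {Dia : DiagramDomain.{w}}

/-- The product of a shape with an adjunction. -/
def timesAdj (K : Dia.Shape) {A B : Dia.Shape} {F : A ⥤ B} {G : B ⥤ A} (adj : F ⊣ G) :
    timesMap (𝟭 K) F ⊣ timesMap (𝟭 K) G where
  unit := timesMap₂ (𝟙 (𝟭 K)) adj.unit
  counit := timesMap₂ (𝟙 (𝟭 K)) adj.counit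
  left_triangle_components x :=
    Prod.ext (Category.comp_id _) (adj.left_triangle_components x.2)
  right_triangle_components x :=
    Prod.ext (Category.comp_id _) (adj.right_triangle_components x.2)

theorem isIso_timesMap₂ {J K A B : Dia.Shape} {F G : J ⥤ K} {U W : A ⥤ B} (α : F ⟶ G) (β : U ⟶ W)
    [IsIso α] [IsIso β] : IsIso (timesMap₂ α β) := by
  have : ∀ x, IsIso ((timesMap₂ α β).app x) := fun x =>
    (isIso_prod_iff _ _).2 ⟨inferInstanceAs (IsIso (α.app x.1)), inferInstanceAs (IsIso (β.app x.2))⟩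
  exact NatIso.isIso_of_isIso_app _

end DiagramDomain

namespace Prederivator

variable {Dia : DiagramDomain.{w}} {D : Prederivator.{w, v, u} Dia}

theorem isIso_pull₂_app_pull {I J K : Dia.Shape} {F G : I ⥤ J} (α : F ⟶ G) (H : J ⥤ K)
    [IsIso (Functor.whiskerRight α H)] (X : D.cat K) :
    IsIso ((D.pull₂ α).app ((D.pull H).obj X)) := by
  have h₁ : IsIso (D.pull₂ (Functor.whiskerRight α H)) := inferInstance
  rw [D.pull₂_whiskerRight] at h₁
  rw [isIso_comp_left_iff, isIso_comp_right_iff] at h₁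
  exact inferInstanceAs (IsIso ((Functor.whiskerLeft (D.pull H) (D.pull₂ α)).app X))

theorem isIso_adjArrow {I J : Dia.Shape} {w : I ⥤ J} {l : J ⥤ I} (adj : l ⊣ w) [IsIso adj.unit]
    (X : D.cat J) : IsIso (adjArrow adj X) := by
  unfold adjArrow overLift one
  infer_instance

theorem isZero_ev_res_iff {A B K : Dia.Shape} (U : A ⥤ B) (a : A) (X : (D.shift B).cat K) :
    IsZero (((D.ev a).app K).obj (((D.res U).app K).obj X)) ↔
      IsZero (((D.ev (U.obj a)).app K).obj X) :=
  (Hom.isoApp (D.resEv U a) X).isZero_iff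

theorem isUniv_id_of_isIso_counit {C C' : Type*} [Category C] [Category C'] {G : C ⥤ C'}
    {F : C' ⥤ C} (adj : F ⊣ G) (X : C) [IsIso (adj.counit.app X)] :
    IsUniv G (𝟙 (G.obj X)) := by
  have := (isUniv_unit adj (G.obj X)).postcomp_iso (adj.counit.app X)
  rwa [adj.right_triangle_components] at this

/-! ### The mapping cylinder of a sieve -/

section Cylinder

variable {A B P T : Dia.Shape} {U : A ⥤ B} {j : B ⥤ P} [j.Full] [j.Faithful]
  {k : P ⥤ T} {l : B ⥤ T} {pr : T ⥤ B} (adj : l ⊣ pr) [IsIso adj.unit]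
  (cyl : l ⟶ j ⋙ k) [IsIso (Functor.whiskerRight cyl pr)]

/-- The comparison of the two ends of a cylinder. -/
def cylinderComparison (D : Prederivator.{w, v, u} Dia) : D.res l ⟶ (D.res k).comp (D.res j) :=
  D.res₂ cyl ≫ (D.resComp k j).inv

-- For `Z` supported on the sieve, k^* pr^* Z vanishes off the end `j` of the cylinder, hence is j_!
-- of its restriction there. That restriction is identified with `Z` because `pr` collapses the
-- cylinder.
variable {cyl} in
theorem isUniv_cylinder (hD : D.IsDerivator) (hpt : D.IsPointed)
    (hj : ∀ p, (∃ b, j.obj b = p) ∨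
      ((∀ b, IsEmpty (j.obj b ⟶ p)) ∧ ∀ a, IsEmpty (pr.obj (k.obj p) ⟶ U.obj a)))
    {K : Dia.Shape} {Z : (D.shift B).cat K}
    (hZ : ∀ b, (∀ a, IsEmpty (b ⟶ U.obj a)) → IsZero (((D.ev b).app K).obj Z)) :
    IsUniv ((D.res j).app K) (adjArrow (timesAdj K adj) Z ≫
      ((cylinderComparison cyl D).app K).app (((D.res pr).app K).obj Z)) := by
  obtain ⟨lj, ⟨adjj⟩⟩ := exists_lan hD j
  have h₁ : IsIso ((adjj.pointwise K).counit.app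
      (((D.res k).app K).obj (((D.res pr).app K).obj Z))) :=
    isIso_counit_res hD hpt j adjj fun p => (hj p).imp_right fun h =>
      ⟨(isZero_ev_res_iff k p _).2 ((isZero_ev_res_iff pr _ _).2 (hZ _ h.2)), h.1⟩
  have h₂ := isUniv_id_of_isIso_counit (adjj.pointwise K)
    (((D.res k).app K).obj (((D.res pr).app K).obj Z))
  have h₃ : IsIso (timesAdj K adj).unit := isIso_timesMap₂ (𝟙 (𝟭 K)) adj.unit
  have h₄ := isIso_adjArrow (D := D) (timesAdj K adj) Z
  have h₅ : IsIso (Functor.whiskerRight (timesMap₂ (𝟙 (𝟭 K)) cyl) (timesMap (𝟭 K) pr)) :=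
    isIso_timesMap₂ (𝟙 (𝟭 K)) (Functor.whiskerRight cyl pr)
  have h₆ : IsIso (((D.res₂ cyl).app K).app (((D.res pr).app K).obj Z)) :=
    isIso_pull₂_app_pull (D := D) (timesMap₂ (𝟙 (𝟭 K)) cyl) (timesMap (𝟭 K) pr) Z
  have h₇ : IsIso (((D.resComp k j).inv.app K).app (((D.res pr).app K).obj Z)) :=
    Hom.isIso_app_app (D.resComp k j).symm K _
  have h₈ : IsIso (((cylinderComparison cyl D).app K).app (((D.res pr).app K).obj Z)) :=
    IsIso.comp_isIso (f := ((D.res₂ cyl).app K).app (((D.res pr).app K).obj Z))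
  exact h₂.comp_of_isIso h₄ h₈

-- For `Y` over `B` put R Y = l^* k_* j_! Y, thought of as the part of `Y` supported on the sieve;
-- the right adjoint of `e` is U^* R. For `Z` extended by zero, Hom(Z, l^* k_* j_! Y) = Hom(pr^* Z,
-- k_* j_! Y) = Hom(k^* pr^* Z, j_! Y) = Hom(j_! Z, j_! Y) = Hom(Z, Y).
include adj cyl in
theorem exists_rightAdjoint_of_cylinder [U.Full] [U.Faithful] [k.Full] [k.Faithful]
    (hD : D.IsDerivator) (hpt : D.IsPointed)
    (hU : ∀ b, (∃ a, U.obj a = b) ∨ ∀ a, IsEmpty (b ⟶ U.obj a))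
    (hj : ∀ p, (∃ b, j.obj b = p) ∨
      ((∀ b, IsEmpty (j.obj b ⟶ p)) ∧ ∀ a, IsEmpty (pr.obj (k.obj p) ⟶ U.obj a)))
    (hl : ∀ b, (∀ a, IsEmpty (b ⟶ U.obj a)) →
      ∃ p, k.obj p = l.obj b ∧ ∀ b', IsEmpty (j.obj b' ⟶ p))
    {e : Hom (D.shift A) (D.shift B)} (he : (D.res U).IsLeftAdjointTo e) :
    ∃ s, e.IsLeftAdjointTo s := by
  obtain ⟨adjU⟩ := id he
  obtain ⟨lj, ⟨adjj⟩⟩ := exists_lan hD j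
  obtain ⟨rk, ⟨adjk⟩⟩ := exists_ran hD k
  let M := lj.comp rk
  let R := M.comp (D.res l)
  -- Off the sieve, `l b` lies in the image of `k`, where k_* leaves the value unchanged, and j_! is
  -- zero at that point of `P`.
  have hR : ∀ K X b, (∀ a, IsEmpty (b ⟶ U.obj a)) →
      IsZero (((D.ev b).app K).obj ((R.app K).obj X)) := by
    intro K X b hb
    refine (isZero_ev_res_iff l b _).2 ?_
    obtain ⟨p, hp, hp'⟩ := hl b hb
    rw [← hp]
    refine (isZero_ev_res_iff k p _).1 ?_
    have := isIso_counit_ran hD k adjk K ((lj.app K).obj X)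
    exact (isZero_ev_of_lan hD hpt ⟨adjj⟩ hp' X).of_iso
      (((D.ev p).app K).mapIso (@asIso _ _ _ _ ((adjk.counit.app K).app ((lj.app K).obj X)) this))
  have h₁ : ∀ K X, IsIso ((adjU.unit.app K).app ((R.app K).obj X)) := fun K X =>
    isIso_unit_res hD hpt U adjU fun b => (hU b).imp_right fun hb => ⟨hR K X b hb, hb⟩
  let i₁ : (R.comp (D.res U)).comp e ≅ R := Hom.assoc R (D.res U) e ≪≫
    (Hom.isoOfIsIso (R.whiskerLeft adjU.unit) h₁).symm ≪≫ Hom.compId R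
  -- The map j^* k^* k_* j_! ⟶ j^* j_! given by the counit of k^* ⊣ k_*. The counit sought is e U^*
  -- R ≅ R = l^* k_* j_! ⟶ j^* k^* k_* j_! ⟶ j^* j_! ≅ id.
  let c : M.comp ((D.res k).comp (D.res j)) ⟶ lj.comp (D.res j) := (Hom.assoc lj rk _).hom ≫
    lj.whiskerLeft ((Hom.assoc rk (D.res k) (D.res j)).inv ≫
      Hom.whiskerRight adjk.counit (D.res j) ≫ (Hom.idComp (D.res j)).hom)
  let i₃ : lj.comp (D.res j) ≅ Hom.id _ :=
    (Hom.isoOfIsIso adjj.unit (isIso_unit_lan hD j adjj)).symm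
  let ε : (R.comp (D.res U)).comp e ⟶ Hom.id _ :=
    i₁.hom ≫ (M.whiskerLeft (cylinderComparison cyl D) ≫ c) ≫ i₃.hom
  refine ⟨R.comp (D.res U), Hom.isLeftAdjointTo_of_isCouniv ε fun K Y => ?_⟩
  have hc := fun X => isIso_counit_ran hD U adjU K X
  -- The counit of U^* ⊣ `e` is invertible, so `e` is fully faithful and couniversality may be
  -- tested on maps out of e X'.
  have : IsIso (adjU.pointwise K).counit := NatIso.isIso_of_isIso_app (adjU.counit.app K)
  have : (e.app K).Full := (adjU.pointwise K).fullyFaithfulROfIsIsoCounit.full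
  have : (e.app K).Faithful := (adjU.pointwise K).fullyFaithfulROfIsIsoCounit.faithful
  refine isCouniv_of_existsUnique (G := e.app K) (X := ((R.comp (D.res U)).app K).obj Y)
    (Hom.isIso_app_app i₁ K Y) (Hom.isIso_app_app i₃ K Y) fun X' h => ?_
  have key := existsUnique_of_isUniv_of_isCouniv ((cylinderComparison cyl D).app K)
    (isUniv_adjArrow (timesAdj K adj) ((e.app K).obj X'))
    (isUniv_cylinder adj hD hpt hj fun b hb => isZero_ev_of_ran hD hpt he hb X')
    (adjk.isCouniv_counit K ((lj.app K).obj Y)) h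
  have hcY : (c.app K).app Y =
      ((D.res j).app K).map ((adjk.counit.app K).app ((lj.app K).obj Y)) :=
    (Category.id_comp _).trans ((Category.id_comp _).trans (Category.comp_id _))
  have hm : ∀ g : (e.app K).obj X' ⟶ (R.app K).obj Y, g ≫ ((M.whiskerLeft (cylinderComparison cyl D) ≫ c).app K).app Y =
      g ≫ ((cylinderComparison cyl D).app K).app ((M.app K).obj Y) ≫
        ((D.res j).app K).map ((adjk.counit.app K).app ((lj.app K).obj Y)) := fun g =>
    congrArg (fun m => g ≫ ((cylinderComparison cyl D).app K).app ((M.app K).obj Y) ≫ m) hcY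
  obtain ⟨g, hg, hg'⟩ := key
  exact ⟨g, (hm g).trans hg, fun y hy => hg' y ((hm y).symm.trans hy)⟩

end Cylinder

end Prederivator

theorem Monotone.full_functor {α β : Type*} [Preorder α] [Preorder β] {f : α → β}
    (hf : Monotone f) (h : ∀ a b, f a ≤ f b → a ≤ b) : hf.functor.Full where
  map_surjective g := ⟨homOfLE (h _ _ (leOfHom g)), Subsingleton.elim _ _⟩

theorem Monotone.faithful_functor {α β : Type*} [Preorder α] [Preorder β] {f : α → β}
    (hf : Monotone f) : hf.functor.Faithful where
  map_injective _ := Subsingleton.elim _ _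

namespace Prederivator

variable {Dia : DiagramDomain.{w}} {D : Prederivator.{w, v, u} Dia}

/-- The extension by zero along the inclusion of a sieve in a poset has a right adjoint. -/
theorem exists_rightAdjoint_of_sieve (hD : D.IsDerivator) (hpt : D.IsPointed) {β : Type w}
    [PartialOrder β] [Countable β] {A : Dia.Shape} {U : A ⥤ Dia.ofPoset β} [U.Full] [U.Faithful]
    (hU : ∀ b, (∃ a, U.obj a = b) ∨ ∀ a, IsEmpty (b ⟶ U.obj a))
    {e : Hom (D.shift A) (D.shift (Dia.ofPoset β))} (he : (D.res U).IsLeftAdjointTo e) :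
    ∃ s, e.IsLeftAdjointTo s := by
  let T := Dia.ofPoset (Set.univ : Set (β × ULift.{w} Bool))
  -- The cylinder is β × {0 < 1}. Its subposet `S` consists of the whole top copy (the end `j`) and
  -- those bottom points that are off the sieve; the bottom points in the sieve are filled in by
  -- k_*. The end `l` is the bottom copy.
  let S : Set (β × ULift.{w} Bool) := {x | x.2.down = true ∨ ∀ a, IsEmpty (x.1 ⟶ U.obj a)}
  let P := Dia.ofPoset S
  have hj : Monotone (fun b : β => (⟨(b, ⟨true⟩), Or.inl rfl⟩ : S)) := fun _ _ h => ⟨h, le_rfl⟩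
  have hk : Monotone (fun x : S => (⟨x.1, trivial⟩ : (Set.univ : Set (β × ULift.{w} Bool)))) := fun _ _ h => h
  have hl : GaloisConnection (fun b : β => (⟨(b, ⟨false⟩), trivial⟩ :
      (Set.univ : Set (β × ULift.{w} Bool)))) fun x => x.1.1 :=
    fun _ _ => ⟨fun h => h.1, fun h => ⟨h, Bool.false_le _⟩⟩
  let j : Dia.ofPoset β ⥤ P := hj.functor
  let k : P ⥤ T := hk.functor
  let l : Dia.ofPoset β ⥤ T := hl.monotone_l.functor
  let pr : T ⥤ Dia.ofPoset β := hl.monotone_u.functor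
  have : j.Full := hj.full_functor fun _ _ h => h.1
  have : j.Faithful := hj.faithful_functor
  have : k.Full := hk.full_functor fun _ _ h => h
  have : k.Faithful := hk.faithful_functor
  let adj : l ⊣ pr := hl.adjunction
  have hadj : ∀ b, IsIso (adj.unit.app b) := fun b => ⟨𝟙 b, Subsingleton.elim _ _, Subsingleton.elim _ _⟩
  have : IsIso adj.unit := NatIso.isIso_of_isIso_app _
  let cyl : l ⟶ j ⋙ k := { app := fun b => homOfLE ⟨le_rfl, Bool.false_le _⟩ }
  have hcyl : ∀ b, IsIso ((Functor.whiskerRight cyl pr).app b) := fun b =>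
    ⟨𝟙 b, Subsingleton.elim _ _, Subsingleton.elim _ _⟩
  have : IsIso (Functor.whiskerRight cyl pr) := NatIso.isIso_of_isIso_app _
  have hempty : ∀ (x : S), x.1.2.down = false → ∀ b, IsEmpty (j.obj b ⟶ x) := fun x hx b =>
    ⟨fun f => by
      have h : true ≤ x.1.2.down := (leOfHom f).2
      rw [hx] at h
      exact absurd h (by decide)⟩
  refine exists_rightAdjoint_of_cylinder adj cyl hD hpt hU (fun p => ?_) (fun b hb => ?_) he
  · obtain ⟨⟨b, ⟨c⟩⟩, hp⟩ := p
    cases c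
    · exact Or.inr ⟨hempty _ rfl, hp.resolve_left (by simp)⟩
    · exact Or.inl ⟨b, rfl⟩
  · exact ⟨(⟨(b, ⟨false⟩), Or.inr hb⟩ : S), rfl, hempty _ rfl⟩

end Prederivator

/-! ## Morphisms into vanishing subprederivators -/

theorem IsUniv.id_of_isIso {C C' : Type*} [Category C] [Category C'] {G : C ⥤ C'} {X : C'} {Y : C}
    {f : X ⟶ G.obj Y} (h : IsUniv G f) (hf : IsIso f) : IsUniv G (𝟙 (G.obj Y)) := by
  simpa using h.precomp_iso (inv f)

theorem isIso_counit_of_isUniv_id {C C' : Type*} [Category C] [Category C'] {G : C ⥤ C'}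
    {F : C' ⥤ C} (adj : F ⊣ G) {X : C} (h : IsUniv G (𝟙 (G.obj X))) : IsIso (adj.counit.app X) :=
  (isUniv_unit adj (G.obj X)).isIso_of_fac h (adj.right_triangle_components X)

namespace Prederivator

variable {Dia : DiagramDomain.{w}} {D : Prederivator.{w, v, u} Dia}

section Vanishing

variable {E : Prederivator.{w, v, u} Dia} {A B : Dia.Shape}

/-- The factorization through a vanishing subprederivator. -/
def liftVanishing (hD : D.IsDerivator) (i : A ⥤ B) (Φ : Hom E (D.shift B))
    (h : ∀ K X, D.vanishes i K ((Φ.app K).obj X)) : Hom E (D.vanishing hD i) where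
  app K := (D.vanishes i K).lift (Φ.app K) (h K)
  nat F := NatIso.ofComponents (fun X => ObjectProperty.isoMk _ ((Φ.nat F).app X)) fun f => by
    apply ObjectProperty.hom_ext
    exact (Φ.nat F).hom.naturality f
  nat_id K X := by
    apply ObjectProperty.hom_ext
    refine (Φ.nat_id K X).trans ?_
    exact (eqToHom_app ((D.shift B).pull_id K) _).trans
      (eqToHom_app_hom ((D.vanishing hD i).pull_id K) ((D.vanishes i K).lift (Φ.app K) (h K) |>.obj X)
        _).symm
  nat_comp F G X := by
    apply ObjectProperty.hom_ext
    refine (Φ.nat_comp F G X).trans (congrArg (· ≫ _) ?_)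
    exact (eqToHom_app ((D.shift B).pull_comp F G) _).trans (eqToHom_app_hom ((D.vanishing hD i).pull_comp F G)
      ((D.vanishes i _).lift (Φ.app _) (h _) |>.obj X) _).symm
  nat_naturality α X := by
    apply ObjectProperty.hom_ext
    exact Φ.nat_naturality α X

/-- A morphism is recovered from its factorization. -/
def liftVanishingComp (hD : D.IsDerivator) (i : A ⥤ B) (Φ : Hom E (D.shift B))
    (h : ∀ K X, D.vanishes i K ((Φ.app K).obj X)) :
    (liftVanishing hD i Φ h).comp (D.vanishingIncl hD i) ≅ Φ :=
  Hom.isoOfEq (fun _ => Iso.refl _) fun F X =>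
    (congrArg (· ≫ _) (CategoryTheory.Functor.map_id _ _)).trans ((Category.id_comp _).trans
      ((Category.id_comp _).symm.trans ((Category.comp_id _).symm.trans
        (congrArg (· ≫ _) (Hom.comp_nat_app (liftVanishing hD i Φ h) (D.vanishingIncl hD i) F X).symm))))

/-- The inclusion is fully faithful, so the unit of `Φ` stays universal when only vanishing objects
are tested. -/
theorem isLeftAdjointTo_liftVanishing (hD : D.IsDerivator) (i : A ⥤ B) {Φ : Hom E (D.shift B)}
    (h : ∀ K X, D.vanishes i K ((Φ.app K).obj X)) {Ψ : Hom (D.shift B) E}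
    (hΦ : Φ.IsLeftAdjointTo Ψ) :
    (liftVanishing hD i Φ h).IsLeftAdjointTo ((D.vanishingIncl hD i).comp Ψ) := by
  obtain ⟨adj⟩ := hΦ
  refine Hom.isLeftAdjointTo_of_isUniv (adj.unit ≫
    Hom.whiskerRight (liftVanishingComp hD i Φ h).inv Ψ ≫ (Hom.assoc _ _ _).hom) fun K X => ?_
  have h₁ : IsUniv (D.vanishes i K).ι
      (𝟙 ((D.vanishes i K).ι.obj (((liftVanishing hD i Φ h).app K).obj X))) := IsUniv.of_isIso
  have h₂ := (adj.isUniv_unit K X).comp h₁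
  exact (congrArg (IsUniv ((D.vanishes i K).ι ⋙ Ψ.app K))
    (congrArg ((adj.unit.app K).app X ≫ ·) (Category.comp_id _))).mpr h₂

theorem isZero_ev_of_vanishes (hD : D.IsDerivator) {i : A ⥤ B} {K : Dia.Shape}
    {X : (D.shift B).cat K} (h : D.vanishes i K X) (a : A) :
    IsZero (((D.ev (i.obj a)).app K).obj X) :=
  (isZero_ev_res_iff i a X).1 (pull_isZero hD (slot K a) h)

theorem vanishes_of_isZero_ev (hD : D.IsDerivator) (hpt : D.IsPointed) {i : A ⥤ B} {K : Dia.Shape}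
    {X : (D.shift B).cat K} (h : ∀ a, IsZero (((D.ev (i.obj a)).app K).obj X)) :
    D.vanishes i K X :=
  isZero_of_slot hD hpt fun a => (isZero_ev_res_iff i a X).2 (h a)

end Vanishing

/-! ## Cocartesian squares -/

/-- If W = t_! t'_! Z then W is t_! of its own restriction, since t^* t_! is the identity for fully
faithful `t`. -/
theorem isUniv_id_of_comp (hD : D.IsDerivator) {I J K : Dia.Shape} (t' : I ⥤ J) (t : J ⥤ K)
    [t.Full] [t.Faithful] {Z : D.cat I} {W : D.cat K} {f : Z ⟶ (D.pull (t' ⋙ t)).obj W}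
    (hf : IsUniv (D.pull (t' ⋙ t)) f) : IsUniv (D.pull t) (𝟙 ((D.pull t).obj W)) := by
  have := hD.der3_left t
  have := hD.der3_left t'
  obtain ⟨N, e₁, he₁⟩ := exists_isUniv (D.pull t') Z
  obtain ⟨M, e₂, he₂⟩ := exists_isUniv (D.pull t) N
  obtain ⟨i, -⟩ := (he₁.comp he₂).exists_iso (hf.of_natTrans (D.pullComp t' t).hom)
  have h := he₂.postcomp_iso i.hom
  exact h.id_of_isIso (isIso_of_isUniv_of_fullyFaithful hD t h)

/-- For posets, a left adjoint of the slice functor is a choice of a least `a` with x ≤ p a,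
provided it satisfies q a ≤ c. -/
theorem final_sliceMap_of_thin {A C J K : Dia.Shape} {p : A ⥤ J} {t : J ⥤ K} {q : A ⥤ C}
    {s : C ⥤ K} [Quiver.IsThin A] [Quiver.IsThin J] [Quiver.IsThin K] (α : p ⋙ t ⟶ q ⋙ s) (c : C)
    (h : ∀ x : J, (t.obj x ⟶ s.obj c) → ∃ a : A, Nonempty (q.obj a ⟶ c) ∧ Nonempty (x ⟶ p.obj a) ∧
      ∀ a', (x ⟶ p.obj a') → Nonempty (a ⟶ a')) (hC : Quiver.IsThin C) :
    D.Final (sliceMap α c) := by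
  have : (sliceMap α c).IsRightAdjoint := by
    refine isRightAdjoint_of_exists_isUniv fun x => ?_
    obtain ⟨a, ⟨g⟩, ⟨g'⟩, ha⟩ := h x.left x.hom
    refine ⟨CostructuredArrow.mk g, CostructuredArrow.homMk g' (Subsingleton.elim _ _),
      fun y k => ?_⟩
    obtain ⟨m⟩ := ha y.left k.left
    exact ⟨CostructuredArrow.homMk m (Subsingleton.elim _ _),
      CostructuredArrow.hom_ext _ _ (Subsingleton.elim _ _),
      fun _ _ => CostructuredArrow.hom_ext _ _ (Subsingleton.elim _ _)⟩
  exact final_of_isRightAdjoint _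

theorem isCocartesian_of_isIso {K : Dia.Shape} {l : Hom (D.shift Dia.lowerCorner) (D.shift Dia.square)}
    (adj : Hom.Adjunction l (D.res Dia.lowerCornerIncl)) {X : (D.shift Dia.square).cat K}
    (h : IsIso ((adj.counit.app K).app X)) : D.IsCocartesian X :=
  ⟨l.app K, ⟨adj.pointwise K⟩, _, ⟨@asIso _ _ _ _ _ h⟩⟩

end Prederivator

/-! ## The posets `□` and `V` -/

namespace VPoset

theorem square_ne_diag {n : ℤ} {s : Sq.{w}} (hs : s ≠ ⟨1, 1⟩) : square n s ≠ diag (n + 1) := by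
  intro h
  have h₁ : ((s.fst : ℕ) : ℤ) + n = n + 1 := congrArg VPoset.fst h
  have h₂ : ((s.snd : ℕ) : ℤ) + n = n + 1 := congrArg VPoset.snd h
  exact hs (Sq.ext (Fin.ext (by change (s.fst : ℕ) = 1; omega))
    (Fin.ext (by change (s.snd : ℕ) = 1; omega)))

/-- Below the square `i_n`, a point other than `(n + 1, n + 1)` has a least upper bound in the
corner of the square. -/
theorem exists_least_corner (n : ℤ) (x : VPoset.{w}) (hx : x ≠ diag (n + 1)) (s : Sq.{w})
    (h : x ≤ square n s) : ∃ t : Sq.{w}, t ≠ ⟨1, 1⟩ ∧ t ≤ s ∧ x ≤ square n t ∧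
      ∀ t', x ≤ square n t' → t ≤ t' := by
  have h₁ : x.fst ≤ ((s.fst : ℕ) : ℤ) + n := h.1
  have h₂ : x.snd ≤ ((s.snd : ℕ) : ℤ) + n := h.2
  have h₃ := s.fst.isLt
  have h₄ := s.snd.isLt
  have hmin : ∀ (m : ℤ) (c : Fin 2), m ≤ ((c : ℕ) : ℤ) + n → (if m ≤ n then 0 else 1 : Fin 2) ≤ c := by
    intro m c hc
    split_ifs with hm
    · exact Fin.zero_le c
    · change 1 ≤ (c : ℕ)
      omega
  have hle : ∀ (m : ℤ) (c : Fin 2), m ≤ ((c : ℕ) : ℤ) + n →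
      m ≤ (((if m ≤ n then 0 else 1 : Fin 2) : ℕ) : ℤ) + n := by
    intro m c hc
    have := c.isLt
    split_ifs with hm
    · simpa using hm
    · simp only [Fin.val_one, Nat.cast_one]
      omega
  -- The least vertex of the square above `x`, coordinate by coordinate. It is (1,1) only if both
  -- coordinates of `x` equal n + 1.
  refine ⟨⟨if x.fst ≤ n then 0 else 1, if x.snd ≤ n then 0 else 1⟩, fun ht => hx ?_,
    ⟨hmin _ _ h₁, hmin _ _ h₂⟩, ⟨hle _ _ h₁, hle _ _ h₂⟩, fun t' ht' =>
      ⟨hmin _ _ ht'.1, hmin _ _ ht'.2⟩⟩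
  have ht₁ : (if x.fst ≤ n then 0 else 1 : Fin 2) = 1 := congrArg Sq.fst ht
  have ht₂ : (if x.snd ≤ n then 0 else 1 : Fin 2) = 1 := congrArg Sq.snd ht
  split_ifs at ht₁ ht₂
  all_goals first
    | exact absurd ht₁ (by decide)
    | exact absurd ht₂ (by decide)
    | skip
  exact VPoset.ext (by change x.fst = n + 1; omega) (by change x.snd = n + 1; omega)

end VPoset

namespace Prederivator

variable {Dia : DiagramDomain.{w}} {D : Prederivator.{w, v, u} Dia}

theorem isIso_eqToHom_app {C C' : Type*} [Category C] [Category C'] {F G : C ⥤ C'} (h : F = G)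
    (X : C) : IsIso ((eqToHom h).app X) := by
  subst h
  infer_instance

/-- A left Kan extension along `V' ⊂ V` restricts to cocartesian squares. -/
theorem isIso_counit_square (hD : D.IsDerivator) {k : Hom (D.shift Dia.primeV) (D.shift Dia.V)}
    (hk : k.IsLeftAdjointTo (D.res Dia.primeIncl))
    {l : Hom (D.shift Dia.lowerCorner) (D.shift Dia.square)}
    (adj : Hom.Adjunction l (D.res Dia.lowerCornerIncl)) {K : Dia.Shape}
    (Y : (D.shift Dia.primeV).cat K) (n : ℕ) :
    IsIso ((adj.counit.app K).app (((D.res (Dia.squareIncl n)).app K).obj ((k.app K).obj Y))) := by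
  obtain ⟨adjk⟩ := hk
  -- The extension from V' is factored through V without the last vertex of the square.
  let J := Dia.ofPoset {x : VPoset.{w} // x ≠ VPoset.diag (n + 1)}
  have hv : Monotone (fun x : {x : VPoset.{w} // x ≠ VPoset.diag (n + 1)} => x.1) := fun _ _ h => h
  let v : J ⥤ Dia.V := hv.functor
  have : v.Full := hv.full_functor fun _ _ h => h
  have : v.Faithful := hv.faithful_functor
  -- Here n ≥ 0 enters: (n+1, n+1) is diagonal and has positive coordinates, hence is not in V'.
  have hn : ∀ x : {x : VPoset.{w} // x.IsNonpos ∨ x.IsBoundary}, x.1 ≠ VPoset.diag (n + 1) := by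
    rintro ⟨x, hx⟩ rfl
    obtain ⟨h, -⟩ | h := hx
    · change (n : ℤ) + 1 ≤ 0 at h
      omega
    · simp [VPoset.IsBoundary, VPoset.diag] at h
  let ι : Dia.primeV ⥤ J := Monotone.functor (f := fun x => ⟨x.1, hn x⟩) fun _ _ h => h
  let p : Dia.lowerCorner ⥤ J := Monotone.functor
    (f := fun s => ⟨VPoset.square n s.1, VPoset.square_ne_diag s.2⟩)
    fun _ _ h => VPoset.square_monotone n h
  have := full_timesMap K v
  have := faithful_timesMap K v
  have h₁ : IsUniv (D.pull (timesMap (𝟭 K) ι ⋙ timesMap (𝟭 K) v)) ((adjk.unit.app K).app Y) :=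
    adjk.isUniv_unit K Y
  have h₂ := isUniv_id_of_comp hD _ _ h₁
  let α : p ⋙ v ⟶ Dia.lowerCornerIncl ⋙ Dia.squareIncl n := 𝟙 _
  have hα : ∀ c, D.Final (sliceMap α c) := fun c => by
    refine final_sliceMap_of_thin α c (fun x hx => ?_) inferInstance
    obtain ⟨t, ht₁, ht₂, ht₃, ht₄⟩ := VPoset.exists_least_corner n x.1 x.2 c (leOfHom hx)
    exact ⟨⟨t, ht₁⟩, ⟨homOfLE ht₂⟩, ⟨homOfLE ht₃⟩, fun a' f => ⟨homOfLE (ht₄ _ (leOfHom f))⟩⟩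
  have h : timesMap (𝟭 K) p ⋙ timesMap (𝟭 K) v =
    timesMap (𝟭 K) Dia.lowerCornerIncl ⋙ timesMap (𝟭 K) (Dia.squareIncl n) := rfl
  have h₃ := isUniv_map_comp_eqToHom hD h (final_sliceMap_shapeTimes K α hα) h₂
  have h₄ : IsIso ((D.pull (timesMap (𝟭 K) p)).map
      (𝟙 ((D.pull (timesMap (𝟭 K) v)).obj ((k.app K).obj Y)))) := inferInstance
  have h₅ := isIso_eqToHom_app (D.pull_square h) ((k.app K).obj Y)
  exact isIso_counit_of_isUniv_id (adj.pointwise K)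
    (h₃.id_of_isIso (@IsIso.comp_isIso _ _ _ _ _ _ _ h₄ h₅))

end Prederivator

namespace Prederivator

variable {Dia : DiagramDomain.{w}} {D E : Prederivator.{w, v, u} Dia} {A B : Dia.Shape}

/-! ## Composites of Kan extensions and restrictions -/

/-- A left Kan extension along a fully faithful functor restricts to the original object. -/
noncomputable def lanRes (hD : D.IsDerivator) {U : A ⥤ B} [U.Full] [U.Faithful]
    {l : Hom (D.shift A) (D.shift B)} (adj : Hom.Adjunction l (D.res U)) (Φ : Hom E (D.shift A)) :
    (Φ.comp l).comp (D.res U) ≅ Φ :=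
  Hom.assoc Φ l _ ≪≫ Hom.isoWhiskerLeft Φ
    (Hom.isoOfIsIso adj.unit (isIso_unit_lan hD U adj)).symm ≪≫ Hom.compId Φ

/-- A right Kan extension along a fully faithful functor restricts to the original object. -/
noncomputable def ranRes (hD : D.IsDerivator) {U : A ⥤ B} [U.Full] [U.Faithful]
    {r : Hom (D.shift A) (D.shift B)} (adj : Hom.Adjunction (D.res U) r) (Φ : Hom E (D.shift A)) :
    (Φ.comp r).comp (D.res U) ≅ Φ :=
  Hom.assoc Φ r _ ≪≫ Hom.isoWhiskerLeft Φ
    (Hom.isoOfIsIso adj.counit (isIso_counit_ran hD U adj)) ≪≫ Hom.compId Φ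

/-- The values of a morphism at the image of `U` are the values of its restriction. -/
noncomputable def evIso {U : A ⥤ B} {Φ : Hom E (D.shift B)} {Ψ : Hom E (D.shift A)}
    (i : Φ.comp (D.res U) ≅ Ψ) (a : A) : Φ.comp (D.ev (U.obj a)) ≅ Ψ.comp (D.ev a) :=
  Hom.isoWhiskerLeft Φ (D.resEv U a).symm ≪≫ (Hom.assoc Φ (D.res U) (D.ev a)).symm ≪≫
    Hom.isoWhiskerRight i (D.ev a)

/-- An object with invertible unit is recovered from its image under the left adjoint. -/
noncomputable def compUnitIso {E' : Prederivator.{w, v, u} Dia} {Φ : Hom D E'} {Ψ : Hom E' D}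
    (adj : Hom.Adjunction Φ Ψ) (Q : Hom E D)
    (h : ∀ K X, IsIso ((adj.unit.app K).app ((Q.app K).obj X))) : (Q.comp Φ).comp Ψ ≅ Q :=
  Hom.assoc Q Φ Ψ ≪≫ (Hom.isoOfIsIso (Q.whiskerLeft adj.unit) h).symm ≪≫ Hom.compId Q

/-- An object with invertible counit is recovered from its image under the right adjoint. -/
noncomputable def compCounitIso {E' : Prederivator.{w, v, u} Dia} {Φ : Hom D E'} {Ψ : Hom E' D}
    (adj : Hom.Adjunction Φ Ψ) (Q : Hom E E')
    (h : ∀ K X, IsIso ((adj.counit.app K).app ((Q.app K).obj X))) : (Q.comp Ψ).comp Φ ≅ Q :=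
  Hom.assoc Q Ψ Φ ≪≫ Hom.isoOfIsIso (Q.whiskerLeft adj.counit) h ≪≫ Hom.compId Q

/-! ## Suspension -/

instance full_nonposIncl : (Dia.nonposIncl).Full := Monotone.full_functor _ fun _ _ h => h

instance faithful_nonposIncl : (Dia.nonposIncl).Faithful := Monotone.faithful_functor _

instance full_primeIncl : (Dia.primeIncl).Full := Monotone.full_functor _ fun _ _ h => h

instance faithful_primeIncl : (Dia.primeIncl).Faithful := Monotone.faithful_functor _

theorem lowerCorner_cases (s : Dia.lowerCorner) : Dia.lowerOrigin = s ∨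
    ((s.1 = ⟨1, 0⟩ ∨ s.1 = ⟨0, 1⟩) ∧ IsEmpty (s ⟶ Dia.lowerOrigin)) := by
  obtain ⟨⟨a, b⟩, hs⟩ := s
  have h : ∀ {s t : Dia.lowerCorner}, (s ⟶ t) → s.1.fst ≤ t.1.fst ∧ s.1.snd ≤ t.1.snd :=
    fun f => leOfHom f
  fin_cases a <;> fin_cases b
  · exact Or.inl rfl
  · exact Or.inr ⟨Or.inr rfl, ⟨fun f => absurd (a := (1 : Fin 2) ≤ 0) (h f).2 (by decide)⟩⟩
  · exact Or.inr ⟨Or.inl rfl, ⟨fun f => absurd (a := (1 : Fin 2) ≤ 0) (h f).1 (by decide)⟩⟩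
  · exact absurd rfl hs

/-- In a cocartesian square that vanishes at `(1, 0)` and `(0, 1)` the value at `(1, 1)` is the
suspension of the value at `(0, 0)`. -/
noncomputable def suspensionIso (hD : D.IsDerivator) (hpt : D.IsPointed)
    {r : Hom D (D.shift Dia.lowerCorner)} (adjr : Hom.Adjunction (D.ev Dia.lowerOrigin) r)
    {l : Hom (D.shift Dia.lowerCorner) (D.shift Dia.square)}
    (adjl : Hom.Adjunction l (D.res Dia.lowerCornerIncl)) (Q : Hom E (D.shift Dia.square))
    (hc : ∀ K X, IsIso ((adjl.counit.app K).app ((Q.app K).obj X)))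
    (hz : ∀ K X (s : Sq.{w}), s = ⟨1, 0⟩ ∨ s = ⟨0, 1⟩ →
      IsZero (((D.ev (A := Dia.square) s).app K).obj ((Q.app K).obj X))) :
    (Q.comp (D.ev (A := Dia.square) (⟨0, 0⟩ : Sq.{w}))).comp
      (((r.comp l).comp (D.res Dia.upperCornerIncl)).comp (D.ev Dia.upperApex)) ≅
      Q.comp (D.ev (A := Dia.square) (⟨1, 1⟩ : Sq.{w})) :=
  let P := Q.comp (D.res Dia.lowerCornerIncl)
  let i₁ : Q.comp (D.ev (A := Dia.square) (⟨0, 0⟩ : Sq.{w})) ≅ P.comp (D.ev Dia.lowerOrigin) :=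
    evIso (U := Dia.lowerCornerIncl) (Iso.refl P) Dia.lowerOrigin
  -- As (0,0) is least in the corner, `r` is extension by zero, and the corner of the square, which
  -- vanishes off the origin, is recovered from its value there.
  let i₂ : (P.comp (D.ev Dia.lowerOrigin)).comp r ≅ P := compUnitIso adjr P fun K X =>
    isIso_unit_ev hD hpt _ adjr fun b => (lowerCorner_cases b).imp_right fun h =>
      ⟨(isZero_ev_res_iff _ _ _).2 (hz K X _ h.1), h.2⟩
  let i₃ : P.comp l ≅ Q := compCounitIso adjl Q hc
  let i₄ : ((r.comp l).comp (D.res Dia.upperCornerIncl)).comp (D.ev Dia.upperApex) ≅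
      (r.comp l).comp (D.ev (A := Dia.square) (⟨1, 1⟩ : Sq.{w})) :=
    (evIso (U := Dia.upperCornerIncl) (Iso.refl _) Dia.upperApex).symm
  Hom.isoWhiskerLeft _ i₄ ≪≫ Hom.isoWhiskerRight i₁ _ ≪≫ (Hom.assoc _ (r.comp l) _).symm ≪≫
    Hom.isoWhiskerRight ((Hom.assoc _ r l).symm ≪≫ Hom.isoWhiskerRight i₂ l ≪≫ i₃) _

end Prederivator

namespace Prederivator

variable {Dia : DiagramDomain.{w}} {D : Prederivator.{w, v, u} Dia}

/-! ## Suspension prespectra -/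

section Prespectra

variable {z : Hom D (D.shift Dia.nonposV)} {e : Hom (D.shift Dia.nonposV) (D.shift Dia.primeV)}
  {k : Hom (D.shift Dia.primeV) (D.shift Dia.V)}

/-- V^{≤0} is a sieve in V'. -/
theorem nonposIncl_cases (b : Dia.primeV) : (∃ a, Dia.nonposIncl.obj a = b) ∨
    ∀ a, IsEmpty (b ⟶ Dia.nonposIncl.obj a) := by
  by_cases hb : b.1.IsNonpos
  · exact Or.inl ⟨⟨b.1, hb⟩, rfl⟩
  · refine Or.inr fun a => ⟨fun f => hb ?_⟩
    have h : b.1.fst ≤ a.1.fst ∧ b.1.snd ≤ a.1.snd := leOfHom f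
    exact ⟨h.1.trans a.2.1, h.2.trans a.2.2⟩

/-- The values of the free prespectrum at the points of `V'`. -/
noncomputable def freeEvPrime (hD : D.IsDerivator)
    (adjk : Hom.Adjunction k (D.res Dia.primeIncl)) (a : Dia.primeV) :
    ((z.comp e).comp k).comp (D.ev (Dia.primeIncl.obj a)) ≅ (z.comp e).comp (D.ev a) :=
  evIso (lanRes hD adjk (z.comp e)) a

/-- The values of the free prespectrum at the points of `V^{≤ 0}`. -/
noncomputable def freeEvNonpos (hD : D.IsDerivator)
    (adje : Hom.Adjunction (D.res Dia.nonposIncl) e)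
    (adjk : Hom.Adjunction k (D.res Dia.primeIncl)) (a : Dia.nonposV) :
    ((z.comp e).comp k).comp (D.ev (Dia.primeIncl.obj (Dia.nonposIncl.obj a))) ≅
      z.comp (D.ev a) :=
  freeEvPrime hD adjk (Dia.nonposIncl.obj a) ≪≫ evIso (ranRes hD adje z) a

/-- No other point of V^{≤0} lies above (0,0), so (0,0)_! vanishes away from it. -/
theorem isZero_free_nonpos (hD : D.IsDerivator) (hpt : D.IsPointed)
    (adjz : Hom.Adjunction z (D.ev Dia.nonposOrigin))
    (adje : Hom.Adjunction (D.res Dia.nonposIncl) e)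
    (adjk : Hom.Adjunction k (D.res Dia.primeIncl)) (a : Dia.nonposV)
    (ha : a.1 ≠ VPoset.diag 0) (K : Dia.Shape) (x : D.cat K) :
    IsZero (((D.ev (Dia.primeIncl.obj (Dia.nonposIncl.obj a))).app K).obj
      ((((z.comp e).comp k).app K).obj x)) := by
  refine (isZero_ev_of_lan_ev hD hpt ⟨adjz⟩ ⟨fun f => ha ?_⟩ x).of_iso
    (Hom.isoApp (freeEvNonpos hD adje adjk a) x)
  have h : (0 : ℤ) ≤ a.1.fst ∧ (0 : ℤ) ≤ a.1.snd := leOfHom f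
  exact VPoset.ext (le_antisymm a.2.1 h.1) (le_antisymm a.2.2 h.2)

/-- A boundary point in V^{≤0} is different from (0,0), so the preceding lemma applies; at any other
boundary point the extension by zero `e` vanishes. -/
theorem vanishes_free (hD : D.IsDerivator) (hpt : D.IsPointed)
    (adjz : Hom.Adjunction z (D.ev Dia.nonposOrigin))
    (adje : Hom.Adjunction (D.res Dia.nonposIncl) e)
    (adjk : Hom.Adjunction k (D.res Dia.primeIncl)) (K : Dia.Shape) (x : D.cat K) :
    D.vanishes Dia.boundaryIncl K ((((z.comp e).comp k).app K).obj x) := by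
  refine vanishes_of_isZero_ev hD hpt fun a => ?_
  obtain ⟨b, hb⟩ | hb := nonposIncl_cases (⟨a.1, Or.inr a.2⟩ : Dia.primeV)
  · have hb' : b.1 = a.1 := congrArg Subtype.val hb
    have h := isZero_free_nonpos hD hpt adjz adje adjk b (fun h => by
      have := a.2
      rw [← hb', h] at this
      simp [VPoset.IsBoundary, VPoset.diag] at this) K x
    have h' : Dia.primeIncl.obj (Dia.nonposIncl.obj b) = Dia.boundaryIncl.obj a := hb'
    rwa [h'] at h
  · exact (isZero_ev_of_ran hD hpt ⟨adje⟩ hb ((z.app K).obj x)).of_iso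
      (Hom.isoApp (freeEvPrime hD adjk (⟨a.1, Or.inr a.2⟩ : Dia.primeV)) x)

/-- The total right adjoint of the free prespectrum is evaluation at `(0, 0)` on prespectra. -/
noncomputable def spEvIso (hD : D.IsDerivator) (hpt : D.IsPointed)
    (adje : Hom.Adjunction (D.res Dia.nonposIncl) e)
    {s : Hom (D.shift Dia.primeV) (D.shift Dia.nonposV)} (adjs : Hom.Adjunction e s) :
    (((D.SpIncl hD).comp (D.res Dia.primeIncl)).comp s).comp (D.ev Dia.nonposOrigin) ≅
      D.SpEv hD 0 :=
  let Q := (D.SpIncl hD).comp (D.res Dia.primeIncl)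
  let Q' := Q.comp (D.res Dia.nonposIncl)
  -- A point of V' outside V^{≤0} lies in ∂V, where a prespectrum is zero; so its restriction to V'
  -- is extended by zero from V^{≤0}.
  let i₁ : Q'.comp e ≅ Q := compUnitIso adje Q fun K X =>
    isIso_unit_res hD hpt Dia.nonposIncl adje fun b => by
      by_cases hb : b.1.IsNonpos
      · exact Or.inl ⟨⟨b.1, hb⟩, rfl⟩
      · refine Or.inr ⟨(isZero_ev_res_iff _ _ _).2 (isZero_ev_of_vanishes hD X.property
          ⟨b.1, b.2.resolve_left hb⟩), (nonposIncl_cases b).resolve_left ?_⟩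
        rintro ⟨a, rfl⟩
        exact hb a.2
  -- Extension by zero is fully faithful, so the unit of its adjunction with `s` is invertible.
  have he : ∀ K Y, IsIso ((adjs.unit.app K).app Y) := fun K Y => by
    have hc : ∀ X, IsIso ((adje.counit.app K).app X) := isIso_counit_ran hD _ adje K
    have : IsIso (adje.pointwise K).counit := NatIso.isIso_of_isIso_app (adje.counit.app K)
    have : (e.app K).Full := (adje.pointwise K).fullyFaithfulROfIsIsoCounit.full
    have : (e.app K).Faithful := (adje.pointwise K).fullyFaithfulROfIsIsoCounit.faithful
    exact inferInstanceAs (IsIso ((adjs.pointwise K).unit.app Y))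
  let i₂ : Q.comp s ≅ Q' := Hom.isoWhiskerRight i₁.symm s ≪≫
    compUnitIso adjs Q' fun K _ => he K _
  Hom.isoWhiskerRight i₂ _ ≪≫ (evIso (U := Dia.nonposIncl) (Iso.refl Q') Dia.nonposOrigin).symm ≪≫
    (evIso (U := Dia.primeIncl) (Iso.refl Q) (Dia.nonposIncl.obj Dia.nonposOrigin)).symm

end Prespectra

theorem isZero_square (hD : D.IsDerivator) {K : Dia.Shape} {X : (D.shift Dia.V).cat K}
    (hX : D.vanishes Dia.boundaryIncl K X) (n : ℤ) (s : Sq.{w}) (hs : s = ⟨1, 0⟩ ∨ s = ⟨0, 1⟩) :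
    IsZero (((D.ev (A := Dia.square) s).app K).obj (((D.res (Dia.squareIncl n)).app K).obj X)) := by
  refine (isZero_ev_res_iff (Dia.squareIncl n) (s : Dia.square) X).2
    (isZero_ev_of_vanishes hD hX ⟨VPoset.square n s, ?_⟩)
  obtain rfl | rfl := hs <;> simp [VPoset.IsBoundary, VPoset.square]

end Prederivator

namespace Prederivator

variable {Dia : DiagramDomain.{w}} {D : Prederivator.{w, v, u} Dia}

/-- The levels of a prespectrum as values at the corners of its squares. -/
noncomputable def spEvSquareIso (hD : D.IsDerivator) (L : Hom D (D.Sp hD)) {m n : ℤ} (s : Sq.{w})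
    (hs : VPoset.square n s = VPoset.diag m) :
    L.comp (D.SpEv hD m) ≅ ((L.comp (D.SpIncl hD)).comp (D.res (Dia.squareIncl n))).comp
      (D.ev (A := Dia.square) s) :=
  (Hom.assoc L (D.SpIncl hD) (D.ev (A := Dia.V) (VPoset.diag m))).symm ≪≫
    eqToIso (congrArg (fun a => (L.comp (D.SpIncl hD)).comp (D.ev (A := Dia.V) a)) hs.symm) ≪≫
    evIso (U := Dia.squareIncl n) (Iso.refl _) s

end Prederivator

/-! ### The main theorem -/

open Prederivator

theorem mainTheorem8 (Dia : DiagramDomain.{w}) (D : Prederivator.{w, v, u} Dia)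
    (hD : D.IsDerivator) (hpt : D.IsPointed) :
    ∃ L : Prederivator.Hom D (D.Sp hD),
      -- `L` is left adjoint to `(0,0)^* : Sp 𝔻 → 𝔻`
      L.IsLeftAdjointTo (D.SpEv hD 0) ∧
      -- `L` is the composite `ι_! ∘ ι_{≤0,*} ∘ (0,0)_!`, where `ι_{≤0,*}` has a right adjoint `ι_{≤0}^!`
      -- and the total right adjoint `(0,0)^* ∘ ι_{≤0}^! ∘ ι^*` is `(0,0)^*` on `Sp 𝔻`
      (∃ (z : Prederivator.Hom D (D.shift Dia.nonposV))
        (e : Prederivator.Hom (D.shift Dia.nonposV) (D.shift Dia.primeV))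
        (s : Prederivator.Hom (D.shift Dia.primeV) (D.shift Dia.nonposV))
        (k : Prederivator.Hom (D.shift Dia.primeV) (D.shift Dia.V)),
        z.IsLeftAdjointTo (D.ev Dia.nonposOrigin) ∧
        (D.res Dia.nonposIncl).IsLeftAdjointTo e ∧
        e.IsLeftAdjointTo s ∧
        k.IsLeftAdjointTo (D.res Dia.primeIncl) ∧
        (L.comp (D.SpIncl hD)).IsIsomorphic ((z.comp e).comp k) ∧
        ((((D.SpIncl hD).comp (D.res Dia.primeIncl)).comp s).comp
          (D.ev Dia.nonposOrigin)).IsIsomorphic (D.SpEv hD 0)) ∧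
      -- `(Lx)_n ≅ Σⁿ x` for `n ≥ 0`
      (∃ S : Prederivator.Hom D D, D.IsSuspension S ∧
        ∀ n : ℕ, (L.comp (D.SpEv hD n)).IsIsomorphic (S.iterate n)) ∧
      -- `(Lx)_n = 0` for `n < 0`
      (∀ (K : Dia.Shape) (x : D.cat K) (n : ℤ), n < 0 →
        IsZero (((L.comp (D.SpEv hD n)).app K).obj x)) ∧
      -- the squares `i_n^* Lx` with `n ≥ 0` are cocartesian
      (∀ (K : Dia.Shape) (x : D.cat K) (n : ℕ),
        D.IsCocartesian
          ((((L.comp (D.SpIncl hD)).comp (D.res (Dia.squareIncl n))).app K).obj x)) := by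
  obtain ⟨z, ⟨adjz⟩⟩ := exists_lan_ev hD Dia.nonposOrigin
  obtain ⟨e, ⟨adje⟩⟩ := exists_ran hD Dia.nonposIncl
  obtain ⟨s, ⟨adjs⟩⟩ := exists_rightAdjoint_of_sieve hD hpt nonposIncl_cases ⟨adje⟩
  obtain ⟨k, ⟨adjk⟩⟩ := exists_lan hD Dia.primeIncl
  obtain ⟨r, ⟨adjr⟩⟩ := exists_ran_ev hD Dia.lowerOrigin
  obtain ⟨l, ⟨adjl⟩⟩ := exists_lan hD Dia.lowerCornerIncl
  have hv := vanishes_free hD hpt adjz adje adjk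
  let L : Prederivator.Hom D (D.Sp hD) := liftVanishing hD Dia.boundaryIncl _ hv
  have hL : L.IsLeftAdjointTo (D.SpEv hD 0) := by
    have h : ((z.comp e).comp k).IsLeftAdjointTo
        ((D.res Dia.primeIncl).comp (s.comp (D.ev Dia.nonposOrigin))) :=
      -- The adjunction `adjs`, not `adje`, enters: `e` is used as a left adjoint.
      Hom.IsLeftAdjointTo.comp (Hom.IsLeftAdjointTo.comp ⟨adjz⟩ ⟨adjs⟩) ⟨adjk⟩
    exact (isLeftAdjointTo_liftVanishing hD Dia.boundaryIncl hv h).of_iso_right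
      ((Hom.assoc (D.SpIncl hD) (D.res Dia.primeIncl) (s.comp (D.ev Dia.nonposOrigin))).symm ≪≫
        (Hom.assoc _ s (D.ev Dia.nonposOrigin)).symm ≪≫ spEvIso hD hpt adje adjs)
  have hc : ∀ (n : ℕ) (K : Dia.Shape) (x : D.cat K), IsIso ((adjl.counit.app K).app
      ((((L.comp (D.SpIncl hD)).comp (D.res (Dia.squareIncl n))).app K).obj x)) := fun n K x =>
    isIso_counit_square hD ⟨adjk⟩ adjl (((z.comp e).app K).obj x) n
  refine ⟨L, hL, ⟨z, e, s, k, ⟨adjz⟩, ⟨adje⟩, ⟨adjs⟩, ⟨adjk⟩,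
    Hom.isIsomorphic_of_iso (liftVanishingComp hD Dia.boundaryIncl _ hv),
    Hom.isIsomorphic_of_iso (spEvIso hD hpt adje adjs)⟩,
    ⟨_, ⟨r, l, ⟨adjr⟩, ⟨adjl⟩, Hom.isIsomorphic_of_iso (Iso.refl _)⟩, fun n => ?_⟩,
    fun K x n hn => ?_, fun K x n => isCocartesian_of_isIso adjl (hc n K x)⟩
  · suffices Nonempty (L.comp (D.SpEv hD n) ≅ Hom.iterate _ n) from
      Hom.isIsomorphic_of_iso this.some
    induction n with
    -- At (0,0) the value is that of (0,0)_! x, which is x because a point inclusion into a poset is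
    -- fully faithful.
    | zero =>
      refine ⟨(Hom.assoc L (D.SpIncl hD) (D.ev (A := Dia.V) (VPoset.diag 0))).symm ≪≫
        Hom.isoWhiskerRight (liftVanishingComp hD Dia.boundaryIncl _ hv) _ ≪≫
        freeEvNonpos hD adje adjk Dia.nonposOrigin ≪≫
        (Hom.isoOfIsIso adjz.unit (isIso_unit_lan_ev hD _ adjz)).symm⟩
    -- The square i_n joins level n at (0,0) to level n + 1 at (1,1); it is cocartesian and vanishes
    -- at its other two vertices.
    | succ n ih =>
      obtain ⟨i⟩ := ih
      exact ⟨spEvSquareIso hD L (n := n) ⟨1, 1⟩ (VPoset.ext (by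
          simp [VPoset.square, VPoset.diag, add_comm]) (by
          simp [VPoset.square, VPoset.diag, add_comm])) ≪≫
        (suspensionIso hD hpt adjr adjl _ (hc n) fun K x t ht =>
          isZero_square hD (hv K x) n t ht).symm ≪≫
        Hom.isoWhiskerRight ((spEvSquareIso hD L (n := n) ⟨0, 0⟩ (VPoset.ext (by
          simp [VPoset.square, VPoset.diag]) (by
          simp [VPoset.square, VPoset.diag]))).symm ≪≫ i) _⟩
  · exact isZero_free_nonpos hD hpt adjz adje adjk ⟨VPoset.diag n, hn.le, hn.le⟩
      (fun h => hn.ne (congrArg VPoset.fst h)) K x
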